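/- **Theorem 1.2.** There is a contractible, non-metrizable surface of Type I. More precisely: there exist rooted binary $\mathbb R$-special $\omega_1$-trees, and for each such tree $T$ and each strict total order $\vartriangleleft$ on $T$, the "fattening" $M_T$ of the road space $R_T$ described below is a surface of Type I which is contractible and not metrizable; moreover $R_T$ is contractible, and the inclusion $R_T\to M_T$ is a topological embedding and a homotopy equivalence. *Definitions.* A *surface* is a connected Hausdorff space in which each point has an open neighbourhood homeomorphic to $\mathbb R^2$. A space $X$ is *of Type I* if $X=\bigcup_{\alpha<\omega_1}X_\alpha$ with $X_\alpha$ open, $\overline{X_\alpha}$ Lindelöf, and $\overline{X_\alpha}\subset X_\beta$ whenever $\alpha<\beta<\omega_1$. A *tree* is a partially ordered set in which the predecessors of each point are well ordered; the order type of this set of predecessors is the height (level) of the point. Trees are assumed *Hausdorff*: two points at limit levels with the same predecessors are equal. An *$\omega_1$-tree* has height $\omega_1$ (the least $\alpha$ whose level is empty) and countable levels; it is *rooted* if it has a unique minimal element, *binary* if each point has exactly two immediate successors, *$\mathbb R$-special* if there is a strictly increasing function $T\to\mathbb R$. *Road space.* $R_T$ is $T$ together with a copy of the open interval $(0,1)$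 for each pair $(x,y)$ with $y$ an immediate successor of $x$ (with $0$ at $x$ and $1$ at $y$). For $\delta>0$ let $W_{x,\delta}$ be $x$ together with the portions $(0,\delta)$ of all intervals from $x$ to its immediate successors. Points inside intervals have their usual neighbourhoods. A set is a neighbourhood of the root if it contains some $W_{x,\delta}$, $x$ being the root; of an immediate successor $x$ of $z$ if it contains some $W_{x,\delta}$ and an end portion $(1-\delta,1)$ of the interval from $z$ to $x$; of a point $x$ at a limit level if, for some $z<x$ and $\delta>0$, it contains all points of $R_T$ strictly between $z$ and $x$ and all $W_{w,\delta}$ for $w\in T$, $z<w\le x$. *Fattening.* Let $A_L=\{(u,v):0<u<1,\ u+v\ge 1,\ v<\tfrac32\}$, $A_R=\{(u,v):0<v<1,\ u+v\ge 1,\ u<\tfrac32\}$ and $P=A_L\cup A_R$: a right isosceles triangle with legs $1$, with a $1\times\frac12$ rectangle on each leg; of its boundary only the open bottom side $\{u+v=1\}$ belongs to $P$. As a set, $M_T$ is the union of disjoint copies $M_x$ of $P$ for $x\in T$, where for the root one adds to $P$ the open rectangle $\{|u-v|<1,\ 0<u+v<1\}$. The $\vartriangleleft$-smaller immediate successor of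 a point of $T$ is called its left one, the other its right one. Given $z<x$ and a point $p$ in the bottom side of $M_x$ with coordinates $(s,1-s)$, the strip of half-width $\varepsilon$ in $M_z$ towards $p$ is $\{(u,v)\in A_L:|u-s|<\varepsilon\}$ if the left successor of $z$ is $\le x$, and $\{(u,v)\in A_R:|v-(1-s)|<\varepsilon\}$ if the right successor of $z$ is $\le x$. A set $U\subset M_T$ is open if (i) its trace on each $M_x$ is open for the topology of the plane on $M_x$; (ii) if $p\in U$ is in the bottom side of $M_x$ and $x$ is an immediate successor of $z$, then for some $\varepsilon>0$, $U$ contains the points of the strip of half-width $\varepsilon$ in $M_z$ towards $p$ with $\max(u,v)>\frac32-\varepsilon$; (iii) if $p\in U$ is in the bottom side of $M_x$ and $x$ is at a limit level, then for some $z<x$ and $\varepsilon>0$, $U$ contains the strips of half-width $\varepsilon$ towards $p$ in $M_w$ for all $w$ with $z<w<x$. *Inclusion.* $R_T\to M_T$ sends $x\in T$ to the point $(\frac12,\frac12)$ of $M_x$, and the point $t\in(0,1)$ of the interval from $x$ to its left (resp. right) successor to the point $(\frac12,\frac12+t)$ (resp. $(\frac12+t,\frac12)$) of $M_x$. -/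

import Mathlib

open Set Topology
open scoped Ordinal
open scoped ContinuousMap

universe u

/-! ### Surfaces and spaces of Type I -/

/-- A surface: a connected Hausdorff space in which every point has an open neighbourhood
homeomorphic to the Euclidean plane. -/
def IsSurface (X : Type u) [TopologicalSpace X] : Prop :=
  ConnectedSpace X ∧ T2Space X ∧
    ∀ x : X, ∃ U : Set X, IsOpen U ∧ x ∈ U ∧ Nonempty (U ≃ₜ EuclideanSpace ℝ (Fin 2))

/-- A space of Type I: the union of open sets `A α`, `α < ω₁`, with Lindelöf closures and such that
the closure of `A α` lies in `A β` whenever `α < β < ω₁`. -/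
def IsTypeI (X : Type u) [TopologicalSpace X] : Prop :=
  ∃ A : Ordinal.{u} → Set X,
    (⋃ α ∈ Iio ω₁, A α) = univ ∧
    (∀ α < ω₁, IsOpen (A α) ∧ IsLindelof (closure (A α))) ∧
    (∀ α β, α < β → β < ω₁ → closure (A α) ⊆ A β)

/-! ### Trees -/

/-- A (set-theoretic) tree: a partially ordered set in which the predecessors of each point are
well ordered. -/
class IsSetTree (T : Type u) [PartialOrder T] : Prop where
  wellOrdered_Iio : ∀ x : T, IsWellOrder (Iio x) (· < ·)

namespace IsSetTree

section

variable (T : Type u) [PartialOrder T]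

/-- The height of a point: the order type of its set of predecessors. -/
noncomputable def ht {T : Type u} [PartialOrder T] [IsSetTree T] (x : T) : Ordinal.{u} :=
  haveI := IsSetTree.wellOrdered_Iio x
  Ordinal.type (fun a b : Iio x => a < b)

/-- The `α`-th level of a tree. -/
def level [IsSetTree T] (α : Ordinal.{u}) : Set T := {x | ht x = α}

/-- The height of a tree: the least `α` such that the `α`-th level is empty. -/
noncomputable def height [IsSetTree T] : Ordinal.{u} := sInf {α | level T α = ∅}

/-- An `ω₁`-tree: height `ω₁` and countable levels. -/
def IsOmegaOneTree [IsSetTree T] : Prop :=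
  height T = ω₁ ∧ ∀ α, (level T α).Countable

/-- Rooted: there is a unique minimal element. -/
def IsRooted : Prop := ∃! x : T, IsMin x

/-- Binary: each point has exactly two immediate successors. -/
def IsBinary : Prop := ∀ x : T, {y : T | x ⋖ y}.ncard = 2

/-- Hausdorff: two points at a limit level with the same predecessors are equal. -/
def IsHausdorff [IsSetTree T] : Prop :=
  ∀ x y : T, Order.IsSuccLimit (ht x) → Order.IsSuccLimit (ht y) → Iio x = Iio y → x = y

/-- `ℝ`-special: there is a strictly increasing function to the real line. -/
def IsRealSpecial : Prop := ∃ f : T → ℝ, StrictMono f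

variable {T} in
/-- Two predecessors of a point of a tree have a common upper bound among its predecessors. -/
theorem exists_common [IsSetTree T] {x z z' : T} (hz : z < x) (hz' : z' < x) :
    ∃ y < x, z ≤ y ∧ z' ≤ y := by
  have := IsSetTree.wellOrdered_Iio x
  rcases trichotomous_of (α := Iio x) (· < ·) ⟨z, hz⟩ ⟨z', hz'⟩ with h | h | h
  · exact ⟨z', hz', (show z < z' from h).le, le_rfl⟩
  · exact ⟨z, hz, le_rfl, (congrArg Subtype.val h).ge⟩
  · exact ⟨z, hz, le_rfl, (show z' < z from h).le⟩

end

end IsSetTree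

/-! ### The road space

In both constructions below, a point `x` of the tree lies at a successor level if `z ⋖ x` for some
`z`, and at a limit level if `Order.IsSuccLimit x`, i.e. if it is not minimal and there is
no such `z`. -/

/-- The points of the road space of `T`: the points of `T`, and an open interval `(0, 1)` between
`x` and `y` for each immediate successor `y` of `x`. -/
inductive RoadSpace (T : Type u) [PartialOrder T] : Type u
  | node (x : T) : RoadSpace T
  | road (x y : T) (h : x ⋖ y) (t : Ioo (0 : ℝ) 1) : RoadSpace T

namespace RoadSpace

variable {T : Type u} [PartialOrder T]

/-- The point `x` together with the initial portions of length `δ` of all the intervals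
emanating from `x`. -/
def fan (x : T) (δ : ℝ) : Set (RoadSpace T) :=
  {p | p = node x ∨ ∃ (y : T) (h : x ⋖ y) (t : Ioo (0 : ℝ) 1), (t : ℝ) < δ ∧ p = road x y h t}

/-- The segment consisting of the points of the road space that lie strictly between `z` and `x`. -/
def segment (z x : T) : Set (RoadSpace T) :=
  {p | (∃ w, z < w ∧ w < x ∧ p = node w) ∨ 
      ∃ (a b : T) (h : a ⋖ b) (t : Ioo (0 : ℝ) 1), z ≤ a ∧ b ≤ x ∧ p = road a b h t}

/-- The topology of the road space. On the open intervals it is the usual one. A neighbourhood of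
`x ∈ T` contains a fan of `x`; if `x` is an immediate successor of `z` it contains moreover an end
portion of the interval from `z` to `x`; if `x` is at a limit level it contains moreover, for some
`z < x` and `δ > 0`, the segment between `z` and `x` and the fans of size `δ` of all the points
of `T` between `z` and `x`. -/
instance [IsSetTree T] : TopologicalSpace (RoadSpace T) where
  IsOpen U :=
    (∀ x y h, IsOpen {t | road x y h t ∈ U}) ∧
    (∀ x, node x ∈ U → ∃ δ > (0 : ℝ), fan x δ ⊆ U) ∧
    (∀ z x, ∀ h : z ⋖ x, node x ∈ U → ∃ δ > (0 : ℝ), ∀ t : Ioo (0 : ℝ) 1, 1 - δ < (t : ℝ) → road z x h t ∈ U) ∧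
    (∀ x, Order.IsSuccLimit x → node x ∈ U →
      ∃ z < x, ∃ δ > (0 : ℝ), segment z x ⊆ U ∧ ∀ w, z < w → w < x → fan w δ ⊆ U)
  isOpen_univ := by
    refine ⟨fun _ _ _ => by simp, fun _ _ => ⟨1, one_pos, subset_univ _⟩,
      fun _ _ _ _ => ⟨1, one_pos, fun _ _ => mem_univ _⟩, fun x hx _ => ?_⟩
    obtain ⟨z, hz⟩ := not_isMin_iff.1 hx.1
    exact ⟨z, hz, 1, one_pos, subset_univ _, fun _ _ _ => subset_univ _⟩
  isOpen_inter := by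
    rintro U V ⟨hU₁, hU₂, hU₃, hU₄⟩ ⟨hV₁, hV₂, hV₃, hV₄⟩
    have hfan : ∀ (x : T) {δ ε : ℝ}, δ ≤ ε → fan x δ ⊆ fan x ε := by
      rintro x δ ε hle p (rfl | ⟨y, h, t, ht, rfl⟩)
      · exact Or.inl rfl
      · exact Or.inr ⟨y, h, t, ht.trans_le hle, rfl⟩
    refine ⟨fun x y h => (hU₁ x y h).inter (hV₁ x y h), ?_, ?_, ?_⟩
    · rintro x ⟨hx, hx'⟩
      obtain ⟨δ, hδ, h⟩ := hU₂ x hx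
      obtain ⟨ε, hε, h'⟩ := hV₂ x hx'
      exact ⟨min δ ε, lt_min hδ hε, subset_inter ((hfan x (min_le_left _ _)).trans h)
        ((hfan x (min_le_right _ _)).trans h')⟩
    · rintro z x hzx ⟨hx, hx'⟩
      obtain ⟨δ, hδ, h⟩ := hU₃ z x hzx hx
      obtain ⟨ε, hε, h'⟩ := hV₃ z x hzx hx'
      refine ⟨min δ ε, lt_min hδ hε, fun t ht => ⟨h t ?_, h' t ?_⟩⟩
      · linarith [min_le_left δ ε]
      · linarith [min_le_right δ ε]
    · rintro x hlim ⟨hx, hx'⟩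
      obtain ⟨z, hz, δ, hδ, h, k⟩ := hU₄ x hlim hx
      obtain ⟨z', hz', ε, hε, h', k'⟩ := hV₄ x hlim hx'
      have hseg : ∀ {a b : T}, a ≤ b → segment b x ⊆ segment a x := by
        rintro a b hab p (⟨w, hw, hwx, rfl⟩ | ⟨c, d, hcd, t, hc, hd, rfl⟩)
        · exact Or.inl ⟨w, hab.trans_lt hw, hwx, rfl⟩
        · exact Or.inr ⟨c, d, hcd, t, hab.trans hc, hd, rfl⟩
      obtain ⟨y, hy, hzy, hzy'⟩ := IsSetTree.exists_common hz hz'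
      exact ⟨y, hy, min δ ε, lt_min hδ hε,
        subset_inter ((hseg hzy).trans h) ((hseg hzy').trans h'),
        fun w hw hwx => subset_inter
          ((hfan w (min_le_left _ _)).trans (k w (hzy.trans_lt hw) hwx))
          ((hfan w (min_le_right _ _)).trans (k' w (hzy'.trans_lt hw) hwx))⟩
  isOpen_sUnion := by
    intro s hs
    refine ⟨fun x y h => ?_, ?_, ?_, ?_⟩
    · have : {t | road x y h t ∈ ⋃₀ s} = ⋃ U ∈ s, {t | road x y h t ∈ U} := by ext; simp
      rw [this]
      exact isOpen_biUnion fun U hU => (hs U hU).1 x y h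
    · rintro x ⟨U, hU, hx⟩
      obtain ⟨δ, hδ, h⟩ := (hs U hU).2.1 x hx
      exact ⟨δ, hδ, h.trans (subset_sUnion_of_mem hU)⟩
    · rintro z x hzx ⟨U, hU, hx⟩
      obtain ⟨δ, hδ, h⟩ := (hs U hU).2.2.1 z x hzx hx
      exact ⟨δ, hδ, fun t ht => ⟨U, hU, h t ht⟩⟩
    · rintro x hlim ⟨U, hU, hx⟩
      obtain ⟨z, hz, δ, hδ, h, k⟩ := (hs U hU).2.2.2 x hlim hx
      exact ⟨z, hz, δ, hδ, h.trans (subset_sUnion_of_mem hU),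
        fun w hw hw' => (k w hw hw').trans (subset_sUnion_of_mem hU)⟩

end RoadSpace

/-! ### The fattening of the road space -/

/-- The left half of the model piece: the right isosceles triangle with vertices
`(0, 1)`, `(1, 1)`, `(1, 0)`, together with the rectangle `(0, 1) × [1, 3/2)` glued to its left leg.
Of the boundary, only the open bottom side (the hypotenuse, where `q.1 + q.2 = 1`) is included. -/
def leftArm : Set (ℝ × ℝ) := {q | 0 < q.1 ∧ q.1 < 1 ∧ 1 ≤ q.1 + q.2 ∧ q.2 < 3 / 2}

/-- The right half of the model piece: the same triangle, together with the rectangle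
`[1, 3/2) × (0, 1)` glued to its right leg. -/
def rightArm : Set (ℝ × ℝ) := {q | 0 < q.2 ∧ q.2 < 1 ∧ 1 ≤ q.1 + q.2 ∧ q.1 < 3 / 2}

/-- The model piece: a triangle and two rectangles, drawn with the axes pointing to the north-east
and to the north-west. -/
def piece : Set (ℝ × ℝ) := leftArm ∪ rightArm

/-- The open rectangle that is added below the bottom side of the piece of the root. -/
def collar : Set (ℝ × ℝ) := {q | |q.1 - q.2| < 1 ∧ 0 < q.1 + q.2 ∧ q.1 + q.2 < 1}

/-- The points of the fattening `M_T` of the road space of `T`: a copy of the model piece for each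
point of `T`, enlarged by the collar at the root. The relation `r` is a strict total
order on `T`, which decides which of the two immediate successors of a point is drawn on the left;
it enters in the topology only. -/
@[ext]
structure Fattening (T : Type u) [PartialOrder T] (r : T → T → Prop) : Type u where
  /-- the index of the piece that contains the point -/
  base : T
  /-- the position of the point in the piece -/
  pt : ℝ × ℝ
  mem : pt ∈ piece ∨ (IsMin base ∧ pt ∈ collar)

namespace Fattening

variable {T : Type u} [PartialOrder T]

/-- The immediate successor `y` of `x` is drawn on the left: it is the `r`-smaller one. -/
def IsLeft (r : T → T → Prop) (x y : T) : Prop := x ⋖ y ∧ ∃ y', x ⋖ y' ∧ r y y'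

/-- The immediate successor `y` of `x` is drawn on the right: it is the `r`-bigger one. -/
def IsRight (r : T → T → Prop) (x y : T) : Prop := x ⋖ y ∧ ∃ y', x ⋖ y' ∧ r y' y

/-- For `z < x`: the open strip of half-width `ε` in the piece of `z` that runs, perpendicularly to
the top side towards `x`, from the bottom side to that top side, around the same position
as `q` (which will be a point of the bottom side of the piece of `x`). Here the bottom side of
the piece of a successor is glued to the corresponding top side by `q ↦ (q.1, 3/2)` on the left and
by `q ↦ (3/2, q.2)` on the right, a similarity of ratio `1/√2`, so the position is `q.1` for the
left arm, `q.2` for the right one. -/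
def strip (r : T → T → Prop) (z x : T) (q : ℝ × ℝ) (ε : ℝ) : Set (ℝ × ℝ) :=
  {p | (∃ y ≤ x, IsLeft r z y ∧ p ∈ leftArm ∧ |p.1 - q.1| < ε) ∨
    (∃ y ≤ x, IsRight r z y ∧ p ∈ rightArm ∧ |p.2 - q.2| < ε)}

theorem strip_mono (r : T → T → Prop) (z x : T) (q : ℝ × ℝ) {δ ε : ℝ} (h : δ ≤ ε) :
    strip r z x q δ ⊆ strip r z x q ε := by
  rintro p (⟨y, hy, hl, hp, hd⟩ | ⟨y, hy, hl, hp, hd⟩)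
  · exact Or.inl ⟨y, hy, hl, hp, hd.trans_le h⟩
  · exact Or.inr ⟨y, hy, hl, hp, hd.trans_le h⟩

/-- The topology of `M_T`. On each piece (with its collar, for the root) it is induced by the plane.
A neighbourhood of a point `m` of the bottom side of the piece of `x` contains moreover:
if `x` is an immediate successor of `z`, the part within `ε` of the top side of the strip of
half-width `ε` in the piece of `z` towards `m`; if `x` is at a limit level, for some `z < x`
and `ε > 0`, the strips of half-width `ε` towards `m` in the pieces of all the points
between `z` and `x`. -/
instance [IsSetTree T] (r : T → T → Prop) : TopologicalSpace (Fattening T r) where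
  IsOpen U :=
    (∀ x, ∃ V : Set (ℝ × ℝ), IsOpen V ∧ ∀ m : Fattening T r, m.base = x → (m ∈ U ↔ m.pt ∈ V)) ∧
    (∀ m ∈ U, m.pt.1 + m.pt.2 = 1 → ∀ z, z ⋖ m.base →
      ∃ ε > (0 : ℝ), ∀ p : Fattening T r, p.base = z → p.pt ∈ strip r z m.base m.pt ε →
        3 / 2 - ε < max p.pt.1 p.pt.2 → p ∈ U) ∧
    (∀ m ∈ U, m.pt.1 + m.pt.2 = 1 → Order.IsSuccLimit m.base →
      ∃ z < m.base, ∃ ε > (0 : ℝ), ∀ p : Fattening T r, z < p.base → p.base < m.base →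
        p.pt ∈ strip r p.base m.base m.pt ε → p ∈ U)
  isOpen_univ := by
    refine ⟨fun _ => ⟨univ, isOpen_univ, by simp⟩, fun _ _ _ _ _ => ⟨1, one_pos, by simp⟩,
      fun m _ _ hx => ?_⟩
    obtain ⟨z, hz⟩ := not_isMin_iff.1 hx.1
    exact ⟨z, hz, 1, one_pos, by simp⟩
  isOpen_inter := by
    rintro U V ⟨hU₁, hU₂, hU₃⟩ ⟨hV₁, hV₂, hV₃⟩
    refine ⟨fun x => ?_, ?_, ?_⟩
    · obtain ⟨A, hA, h⟩ := hU₁ x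
      obtain ⟨B, hB, h'⟩ := hV₁ x
      exact ⟨A ∩ B, hA.inter hB, fun m hm => and_congr (h m hm) (h' m hm)⟩
    · rintro m ⟨hm, hm'⟩ hb z hz
      obtain ⟨δ, hδ, h⟩ := hU₂ m hm hb z hz
      obtain ⟨ε, hε, h'⟩ := hV₂ m hm' hb z hz
      refine ⟨min δ ε, lt_min hδ hε, fun p hp hs ht =>
        ⟨h p hp (strip_mono r _ _ _ (min_le_left _ _) hs) ?_,
          h' p hp (strip_mono r _ _ _ (min_le_right _ _) hs) ?_⟩⟩
      · linarith [min_le_left δ ε]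
      · linarith [min_le_right δ ε]
    · rintro m ⟨hm, hm'⟩ hb hlim
      obtain ⟨z, hz, δ, hδ, h⟩ := hU₃ m hm hb hlim
      obtain ⟨z', hz', ε, hε, h'⟩ := hV₃ m hm' hb hlim
      obtain ⟨y, hy, hzy, hzy'⟩ := IsSetTree.exists_common hz hz'
      exact ⟨y, hy, min δ ε, lt_min hδ hε, fun p hp hpx hs =>
        ⟨h p (hzy.trans_lt hp) hpx (strip_mono r _ _ _ (min_le_left _ _) hs),
          h' p (hzy'.trans_lt hp) hpx (strip_mono r _ _ _ (min_le_right _ _) hs)⟩⟩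
  isOpen_sUnion := by
    intro s hs
    refine ⟨fun x => ?_, ?_, ?_⟩
    · choose! A hA h using fun U (hU : U ∈ s) => (hs U hU).1 x
      refine ⟨⋃ U ∈ s, A U, isOpen_biUnion hA, fun m hm => ?_⟩
      simp only [mem_sUnion, mem_iUnion, exists_prop]
      exact exists_congr fun U => and_congr_right fun hU => h U hU m hm
    · rintro m ⟨U, hU, hm⟩ hb z hz
      obtain ⟨ε, hε, h⟩ := (hs U hU).2.1 m hm hb z hz
      exact ⟨ε, hε, fun p hp hs' ht => ⟨U, hU, h p hp hs' ht⟩⟩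
    · rintro m ⟨U, hU, hm⟩ hb hlim
      obtain ⟨z, hz, ε, hε, h⟩ := (hs U hU).2.2 m hm hb hlim
      exact ⟨z, hz, ε, hε, fun p hp hp' hs' => ⟨U, hU, h p hp hp' hs'⟩⟩

open Classical in
/-- The inclusion of the road space of `T` in its fattening. The point `x` of `T` is sent to the
midpoint of the bottom side of the piece of `x`, and the interval from `x` to an immediate successor
`y` runs from there, in the piece of `x` and perpendicularly to the top side to which the piece
of `y` is glued, to the midpoint of this top side. -/
noncomputable def inclusion (r : T → T → Prop) : RoadSpace T → Fattening T r
  | .node x => ⟨x, (1 / 2, 1 / 2), by norm_num [piece, leftArm]⟩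
  | .road x y _ t =>
    if IsLeft r x y then
      ⟨x, (1 / 2, 1 / 2 + t), by
        obtain ⟨t, h₀, h₁⟩ := t
        refine Or.inl (Or.inl ⟨?_, ?_, ?_, ?_⟩) <;> norm_num <;> linarith⟩
    else
      ⟨x, (1 / 2 + t, 1 / 2), by
        obtain ⟨t, h₀, h₁⟩ := t
        refine Or.inl (Or.inr ⟨?_, ?_, ?_, ?_⟩) <;> norm_num <;> linarith⟩

end Fattening

/-! A strictly increasing real function on `T` can be corrected to a `TreeHeight`: values in `[0,
1]`, continuity at limit levels, one common value on the two successors of a point. Interpolating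
inside each piece by `relHeight`, and going down linearly in the collar, gives a continuous real
function `height` on `M_T`. For a tree point `y` above the root, the collar and the arms on the
branch below `y` stack up to a vertical strip, `column y`, and the pair (transversal position,
`height`) maps it homeomorphically onto an open rectangle (`isOpenEmbedding_chart`).

The columns cover `M_T`, so local questions are settled in charts. The decisive lemma is
`eventually_mem_of_localNhd`: the conditions that the topology imposes at one single point are
already detected by the chart. Hence these conditions characterise neighbourhoods and not only open
sets (`mem_nhds_iff_localNhd`), which gives both continuity of the inverse charts and the embedding
of `R_T`.

Points without a common column are separated by the sets `upper` over incomparable successors. The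
parts of `M_T` below a countable level have closures covered by countably many columns, which gives
Type I. If `M_T` were metrizable it would be separable, being connected and locally separable; then
countably many columns would cover it and the tree would have countable height.

Since `height` is real-valued and bounded, `R_T` contracts to the root in unit time by capping the
height at a falling level (`exists_below`, `contractibleSpace_roadSpace`). The homotopy `squeeze`
narrows all arms towards their axes and ends inside `R_T`, so `M_T` is contractible as well, and a
continuous map between contractible spaces is a homotopy equivalence.

The tree is built from subsets of `ℚ ×ₗ ℕ` under end extension. The invariant `exists_gt_mem_lev`
says that every node extends to every higher countable level while its rational coordinate stays
below any prescribed larger rational. At limit levels an ideal meeting countably many cofinal sets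
provides the new nodes. -/

set_option linter.unusedSectionVars false

/-! ### Branches, heights and branching in set-theoretic trees -/

namespace IsSetTree

section Basic

variable {T : Type u} [PartialOrder T] [IsSetTree T]

instance wellFoundedLT : WellFoundedLT T := by
  refine ⟨⟨fun x => Acc.intro x fun y hy => ?_⟩⟩
  have := IsSetTree.wellOrdered_Iio x
  have key : ∀ z : Iio x, Acc (· < ·) (z : T) := fun z => by
    induction z using (IsWellFounded.wf (r := fun a b : Iio x => a < b)).induction with
    | _ z ih => exact Acc.intro _ fun w hw => ih ⟨w, hw.trans z.2⟩ hw
  exact key ⟨y, hy⟩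

theorem lt_trichotomy_of_lt {x a b : T} (ha : a < x) (hb : b < x) : a < b ∨ a = b ∨ b < a := by
  have := IsSetTree.wellOrdered_Iio x
  rcases trichotomous_of (α := Iio x) (· < ·) ⟨a, ha⟩ ⟨b, hb⟩ with h | h | h
  · exact Or.inl h
  · exact Or.inr (Or.inl (congrArg Subtype.val h))
  · exact Or.inr (Or.inr h)

theorem lt_trichotomy_of_le {x a b : T} (ha : a ≤ x) (hb : b ≤ x) : a < b ∨ a = b ∨ b < a := by
  rcases ha.eq_or_lt with rfl | ha
  · rcases hb.eq_or_lt with rfl | hb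
    · exact Or.inr (Or.inl rfl)
    · exact Or.inr (Or.inr hb)
  · rcases hb.eq_or_lt with rfl | hb
    · exact Or.inl ha
    · exact lt_trichotomy_of_lt ha hb

theorem le_or_lt_of_le {x a b : T} (ha : a ≤ x) (hb : b ≤ x) : a ≤ b ∨ b < a := by
  rcases lt_trichotomy_of_le ha hb with h | h | h
  · exact Or.inl h.le
  · exact Or.inl h.le
  · exact Or.inr h

theorem exists_covBy_le {z x : T} (h : z < x) : ∃ y, z ⋖ y ∧ y ≤ x := by
  obtain ⟨y, ⟨hzy, hyx⟩, hmin⟩ := WellFounded.has_min (wellFounded_lt (α := T)) {y | z < y ∧ y ≤ x}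
    ⟨x, h, le_rfl⟩
  exact ⟨y, ⟨hzy, fun w hw hwy => hmin w ⟨hw, hwy.le.trans hyx⟩ hwy⟩, hyx⟩

theorem eq_of_covBy_of_le {z x y y' : T} (h : z ⋖ y) (h' : z ⋖ y') (hy : y ≤ x) (hy' : y' ≤ x) :
    y = y' := by
  rcases lt_trichotomy_of_le hy hy' with h1 | h1 | h1
  · exact (h'.2 h.lt h1).elim
  · exact h1
  · exact (h.2 h'.lt h1).elim

theorem le_of_lt_of_covBy {z w x : T} (h : z < x) (hw : w ⋖ x) : z ≤ w := by
  rcases lt_trichotomy_of_lt h hw.lt with h1 | h1 | h1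
  · exact h1.le
  · exact h1.le
  · exact (hw.2 h1 h).elim

theorem eq_of_covBy {z w x : T} (h : z ⋖ x) (hw : w ⋖ x) : z = w :=
  le_antisymm (le_of_lt_of_covBy h.lt hw) (le_of_lt_of_covBy hw.lt h)

theorem isMin_or_covBy_or_isSuccLimit (x : T) :
    IsMin x ∨ (∃ z, z ⋖ x) ∨ Order.IsSuccLimit x := by
  by_cases h : IsMin x
  · exact Or.inl h
  · by_cases h' : ∃ z, z ⋖ x
    · exact Or.inr (Or.inl h')
    · exact Or.inr (Or.inr ⟨h, fun b hb => h' ⟨b, hb⟩⟩)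

theorem exists_between_of_isSuccLimit {z x : T} (hx : Order.IsSuccLimit x) (h : z < x) :
    ∃ w, z < w ∧ w < x := by
  obtain ⟨y, hy, hyx⟩ := exists_covBy_le h
  refine ⟨y, hy.lt, hyx.lt_of_ne ?_⟩
  rintro rfl
  exact hx.2 z hy

theorem ht_eq_typein {x z : T} (h : z < x) :
    ht z = haveI := IsSetTree.wellOrdered_Iio x
      Ordinal.typein (fun a b : Iio x => a < b) ⟨z, h⟩ := by
  have := IsSetTree.wellOrdered_Iio x
  have := IsSetTree.wellOrdered_Iio z
  rw [← Ordinal.type_subrel]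
  refine RelIso.ordinalType_congr ⟨⟨fun a => ⟨⟨a.1, a.2.trans h⟩, a.2⟩,
    fun a => ⟨a.1.1, a.2⟩, fun a => rfl, fun a => rfl⟩, ?_⟩
  intro a b
  rfl

theorem ht_strictMono : StrictMono (ht : T → Ordinal.{u}) := by
  intro z x h
  have := IsSetTree.wellOrdered_Iio x
  rw [ht_eq_typein h]
  exact Ordinal.typein_lt_type _ _

theorem exists_lt_ht_eq {x : T} {β : Ordinal.{u}} (h : β < ht x) : ∃ z < x, ht z = β := by
  have := IsSetTree.wellOrdered_Iio x
  obtain ⟨⟨z, hz⟩, rfl⟩ := Ordinal.typein_surj _ h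
  exact ⟨z, hz, ht_eq_typein hz⟩

theorem isSuccLimit_ht {x : T} (h : Order.IsSuccLimit x) : Order.IsSuccLimit (ht x) := by
  constructor
  · intro hmin
    obtain ⟨z, hz⟩ := not_isMin_iff.1 h.1
    exact (hmin.not_lt) (ht_strictMono hz)
  · intro β hβ
    obtain ⟨z, hz, rfl⟩ := exists_lt_ht_eq hβ.lt
    obtain ⟨w, hzw, hw⟩ := exists_between_of_isSuccLimit h hz
    exact hβ.2 (ht_strictMono hzw) (ht_strictMono hw)

theorem ht_lt_omega_one (hT : IsOmegaOneTree T) (x : T) : ht x < ω₁ := by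
  by_contra! h
  have hne : {α : Ordinal.{u} | level T α = ∅}.Nonempty := by
    -- Since `sInf ∅ = 0`, a tree without empty levels would formally have height `0`.
    by_contra! hne
    have := hT.1
    rw [height, hne, Ordinal.sInf_empty] at this
    exact (Ordinal.omega_pos 1).ne this
  have hmem : level T (ω₁ : Ordinal.{u}) = ∅ := by
    have := csInf_mem hne
    rwa [show sInf _ = _ from hT.1] at this
  rcases h.eq_or_lt with h | h
  · exact (hmem ▸ (show x ∈ level T ω₁ from h.symm) : x ∈ (∅ : Set T))
  · obtain ⟨z, -, hz⟩ := exists_lt_ht_eq h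
    exact (hmem ▸ (show z ∈ level T ω₁ from hz) : z ∈ (∅ : Set T))

theorem exists_ht_eq (hT : IsOmegaOneTree T) {α : Ordinal.{u}} (h : α < ω₁) :
    ∃ x : T, ht x = α := by
  by_contra! hne
  have : level T α = ∅ := eq_empty_of_forall_notMem fun x hx => hne x hx
  have := csInf_le' (s := {α : Ordinal.{u} | level T α = ∅}) this
  rw [show sInf _ = _ from hT.1] at this
  exact this.not_gt h

theorem root_le (hT : IsRooted T) {o : T} (ho : IsMin o) (x : T) : o ≤ x := by
  obtain ⟨y, hy, hmin⟩ := WellFounded.has_min (wellFounded_lt (α := T)) {y | y ≤ x} ⟨x, le_rfl⟩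
  have : IsMin y := isMin_iff_forall_not_lt.2 fun z hz => hmin z (hz.le.trans hy) hz
  rw [hT.unique ho this]
  exact hy

/-- Incomparable points of a Hausdorff rooted tree lie above incomparable successors. -/
theorem exists_incomparable_succ (hR : IsRooted T) (hH : IsHausdorff T) {x x' : T}
    (h : ¬ x ≤ x') (h' : ¬ x' ≤ x) :
    ∃ z y z' y', z ⋖ y ∧ y ≤ x ∧ z' ⋖ y' ∧ y' ≤ x' ∧ ¬ y ≤ y' ∧ ¬ y' ≤ y := by
  -- Where the branch of `a` first leaves that of `b`, the predecessors are exactly the common lower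
  -- bounds. This set is symmetric in `a` and `b`, so both exit points have the same predecessors.
  have key : ∀ a b : T, ¬ a ≤ b → ∃ y ≤ a, ¬ y ≤ b ∧ Iio y = Iic a ∩ Iic b := by
    intro a b hab
    obtain ⟨y, ⟨hya, hyb⟩, hmin⟩ := WellFounded.has_min (wellFounded_lt (α := T))
      {y | y ≤ a ∧ ¬ y ≤ b} ⟨a, le_rfl, hab⟩
    refine ⟨y, hya, hyb, ?_⟩
    ext w
    constructor
    · intro (hw : w < y)
      refine ⟨hw.le.trans hya, ?_⟩
      by_contra hwb
      exact hmin w ⟨hw.le.trans hya, hwb⟩ hw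
    · rintro ⟨hwa, hwb⟩
      rcases le_or_lt_of_le hya hwa with h1 | h1
      · exact (hyb (h1.trans hwb)).elim
      · exact h1
  obtain ⟨y, hyx, hyx', hIy⟩ := key x x' h
  obtain ⟨y', hyx1, hyx1', hIy'⟩ := key x' x h'
  have hI : Iio y = Iio y' := by rw [hIy, hIy', inter_comm]
  have hny : ¬ y ≤ y' := fun hh => hyx' (hh.trans hyx1)
  have hny' : ¬ y' ≤ y := fun hh => hyx1' (hh.trans hyx)
  have hmin : ∀ {a b : T}, ¬ a ≤ b → ¬ IsMin a := fun {a b} hab ha => hab (root_le hR ha b)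
  have hlim : ∀ {a b : T}, Iio a = Iio b → ¬ IsMin b → Order.IsSuccLimit a →
      Order.IsSuccLimit b := by
    intro a b hab hb ha
    refine ⟨hb, fun c hc => ?_⟩
    have hca : c < a := by
      have : c ∈ Iio b := hc.lt
      rwa [← hab] at this
    obtain ⟨w, hcw, hw⟩ := exists_between_of_isSuccLimit ha hca
    have : w ∈ Iio b := hab ▸ hw
    exact hc.2 hcw this
  -- An exit point is not the root, which lies below everything, and not at a limit level, where
  -- equal predecessors would force the two exit points to coincide.
  have hnl : ∀ {a b : T}, ¬ a ≤ b → ¬ b ≤ a → Iio a = Iio b → ∃ z, z ⋖ a := by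
    intro a b hab hba hI
    rcases isMin_or_covBy_or_isSuccLimit a with h1 | h1 | h1
    · exact (hmin hab h1).elim
    · exact h1
    · exact (hab (hH a b (isSuccLimit_ht h1)
        (isSuccLimit_ht (hlim hI (hmin hba) h1)) hI).le).elim
  obtain ⟨z, hz⟩ := hnl hny hny' hI
  obtain ⟨z', hz'⟩ := hnl hny' hny hI.symm
  exact ⟨z, y, z', y', hz, hyx, hz', hyx1, hny, hny'⟩

end Basic

end IsSetTree

/-! ### Normalised height functions -/

open IsSetTree

/-- A strictly increasing real function on a tree with values in `[0, 1]`, continuous at limit points,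
and taking the same value at any two immediate successors of a point. -/
structure TreeHeight (T : Type u) [PartialOrder T] where
  /-- the value at a point -/
  val : T → ℝ
  /-- the value at the immediate successors of a point -/
  next : T → ℝ
  strictMono : StrictMono val
  val_covBy : ∀ {x y}, x ⋖ y → val y = next x
  lt_next : ∀ x, val x < next x
  exists_lt : ∀ {x}, Order.IsSuccLimit x → ∀ {c}, c < val x → ∃ z < x, c < val z
  nonneg : ∀ x, 0 ≤ val x
  next_le_one : ∀ x, next x ≤ 1

namespace TreeHeight

variable {T : Type u} [PartialOrder T] [IsSetTree T]

theorem next_le (G : TreeHeight T) {x y : T} (h : x < y) : G.next x ≤ G.val y := by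
  obtain ⟨w, hw, hwy⟩ := exists_covBy_le h
  rw [← G.val_covBy hw]
  exact G.strictMono.monotone hwy

/-- Along a branch the intervals `[val, next)` are disjoint and ordered like their points. -/
theorem le_of_lt_next (G : TreeHeight T) {x z w : T} (hz : z ≤ x) (hw : w ≤ x)
    (h : G.val z < G.next w) : z ≤ w := by
  rcases le_or_lt_of_le hz hw with h1 | h1
  · exact h1
  · exact ((G.next_le h1).not_gt h).elim

/-- Below a point `y`, every real number between the values at the root and at `y` is located in the
interval above exactly one point. -/
theorem exists_val_le_lt_next (G : TreeHeight T) {o y : T} (ho : IsMin o) (hR : IsRooted T) {c : ℝ}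
    (h0 : G.val o ≤ c) (hc : c < G.val y) :
    ∃ w w', w ⋖ w' ∧ w' ≤ y ∧ G.val w ≤ c ∧ c < G.next w := by
  -- The first point of the branch with value above `c` cannot be at a limit level, by continuity
  -- there; its predecessor is the required `w`.
  obtain ⟨w', ⟨hw', hcw⟩, hmin⟩ := WellFounded.has_min (wellFounded_lt (α := T))
    {w | w ≤ y ∧ c < G.val w} ⟨y, le_rfl, hc⟩
  have hle : ∀ z < w', G.val z ≤ c := fun z hz => by
    by_contra! hlt
    exact hmin z ⟨hz.le.trans hw', hlt⟩ hz
  rcases isMin_or_covBy_or_isSuccLimit w' with h | ⟨w, h⟩ | h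
  · rw [hR.unique h ho] at hcw
    exact (h0.not_gt hcw).elim
  · exact ⟨w, w', h, hw', hle w h.lt, G.val_covBy h ▸ hcw⟩
  · obtain ⟨z, hz, hcz⟩ := G.exists_lt h hcw
    exact ((hle z hz).not_gt hcz).elim

/-- After `arctan` has moved `f` into `(0, 1)`, `g` replaces the values at limit levels by suprema,
and `G` gives both successors of a point the smaller of their `g`-values. Values only decrease, but
never to `f z` or below for any `z < x`; hence `G z ≤ f z < G x`. Continuity at a limit level
survives because the new values still interleave with those of `f`. -/
theorem exists_of_isRealSpecial (hB : IsBinary T) (hf : IsRealSpecial T) :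
    Nonempty (TreeHeight T) := by
  classical
  obtain ⟨f₀, hf₀⟩ := hf
  obtain ⟨f, hf, hfpos, hflt⟩ : ∃ f : T → ℝ, StrictMono f ∧ (∀ x, 0 < f x) ∧ ∀ x, f x < 1 := by
    refine ⟨fun x => Real.arctan (f₀ x) / Real.pi + 1 / 2, fun x y h => ?_, fun x => ?_, fun x => ?_⟩
    · have := div_lt_div_of_pos_right (Real.arctan_strictMono (hf₀ h)) Real.pi_pos
      simpa using this
    · have := div_lt_div_of_pos_right (Real.neg_pi_div_two_lt_arctan (f₀ x)) Real.pi_pos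
      have h2 : -(Real.pi / 2) / Real.pi = -(1 / 2) := by field_simp
      linarith
    · have := div_lt_div_of_pos_right (Real.arctan_lt_pi_div_two (f₀ x)) Real.pi_pos
      have h2 : (Real.pi / 2) / Real.pi = (1 / 2) := by field_simp
      linarith
  let g : T → ℝ := fun x => if Order.IsSuccLimit x then sSup (f '' Iio x) else f x
  have hbdd : ∀ x, BddAbove (f '' Iio x) := fun x => ⟨f x, by
    rintro _ ⟨z, hz, rfl⟩
    exact (hf hz).le⟩
  have hg_le : ∀ x, g x ≤ f x := fun x => by
    by_cases h : Order.IsSuccLimit x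
    · simp only [g, h, if_true]
      obtain ⟨z, hz⟩ := not_isMin_iff.1 h.1
      refine csSup_le ⟨_, z, hz, rfl⟩ ?_
      rintro _ ⟨z, hz, rfl⟩
      exact (hf hz).le
    · simp [g, h]
  have hf_lt_g : ∀ {z x}, z < x → f z < g x := fun {z x} hzx => by
    by_cases h : Order.IsSuccLimit x
    · simp only [g, h, if_true]
      obtain ⟨w, hzw, hw⟩ := exists_between_of_isSuccLimit h hzx
      exact (hf hzw).trans_le (le_csSup (hbdd x) ⟨w, hw, rfl⟩)
    · simpa [g, h] using hf hzx
  have hfin : ∀ x, {y | x ⋖ y}.Finite := fun x =>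
    finite_of_ncard_ne_zero (by rw [hB x]; norm_num)
  have hne : ∀ x, {y : T | x ⋖ y}.Nonempty := fun x => by
    rw [nonempty_iff_ne_empty]
    intro h
    have := hB x
    rw [h] at this
    simp at this
  let next : T → ℝ := fun x => sInf (g '' {y | x ⋖ y})
  have hnext_mem : ∀ x, ∃ y, x ⋖ y ∧ g y = next x := fun x =>
    ((hne x).image g).csInf_mem ((hfin x).image g)
  have hnext_le : ∀ {x y}, x ⋖ y → next x ≤ g y := fun {x y} h =>
    csInf_le ((hfin x).image g).bddBelow ⟨y, h, rfl⟩
  have hf_lt_next : ∀ x, f x < next x := fun x => by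
    obtain ⟨y, hy, h⟩ := hnext_mem x
    exact h ▸ hf_lt_g hy.lt
  let G : T → ℝ := fun x => if h : ∃ z, z ⋖ x then next h.choose else g x
  have hG_cov : ∀ {x y}, x ⋖ y → G y = next x := fun {x y} h => by
    have h' : ∃ z, z ⋖ y := ⟨x, h⟩
    simp only [G, h', dif_pos]
    rw [eq_of_covBy h'.choose_spec h]
  have hG_le : ∀ x, G x ≤ g x := fun x => by
    by_cases h : ∃ z, z ⋖ x
    · obtain ⟨z, hz⟩ := h
      rw [hG_cov hz]
      exact hnext_le hz
    · simp [G, h]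
  have hf_lt_G : ∀ {z x}, z < x → f z < G x := fun {z x} hzx => by
    by_cases h : ∃ w, w ⋖ x
    · obtain ⟨w, hw⟩ := h
      rw [hG_cov hw]
      exact (hf.monotone (le_of_lt_of_covBy hzx hw)).trans_lt (hf_lt_next w)
    · simpa [G, h] using hf_lt_g hzx
  refine ⟨⟨G, next, fun z x h => ((hG_le z).trans (hg_le z)).trans_lt (hf_lt_G h), hG_cov,
    fun x => ((hG_le x).trans (hg_le x)).trans_lt (hf_lt_next x), ?_, fun x => ?_, fun x => ?_⟩⟩
  · intro x hx c hc
    have hno : ¬ ∃ z, z ⋖ x := fun ⟨z, hz⟩ => hx.2 z hz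
    simp only [G, hno, dif_neg, not_false_eq_true, g, hx, if_true] at hc
    obtain ⟨z₀, hz₀⟩ := not_isMin_iff.1 hx.1
    obtain ⟨_, ⟨z, hz, rfl⟩, hcz⟩ := exists_lt_of_lt_csSup ⟨f z₀, mem_image_of_mem f hz₀⟩ hc
    obtain ⟨w, hzw, hw⟩ := exists_between_of_isSuccLimit hx hz
    exact ⟨w, hw, hcz.trans (hf_lt_G hzw)⟩
  · rcases isMin_or_covBy_or_isSuccLimit x with h | ⟨z, h⟩ | h
    · have h1 : ¬ ∃ z, z ⋖ x := fun ⟨z, hz⟩ => h.not_lt hz.lt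
      have h2 : ¬ Order.IsSuccLimit x := fun h' => h'.1 h
      simp only [G, h1, dif_neg, not_false_eq_true, g, h2, if_false]
      exact (hfpos x).le
    · exact ((hfpos z).trans (hf_lt_G h.lt)).le
    · obtain ⟨z, hz⟩ := not_isMin_iff.1 h.1
      exact ((hfpos z).trans (hf_lt_G hz)).le
  · obtain ⟨y, hy, h⟩ := hnext_mem x
    rw [← h]
    exact ((hg_le y).trans_lt (hflt y)).le

end TreeHeight

/-! ### Left and right turns along a branch -/

namespace Fattening

section Turns

variable {T : Type u} [PartialOrder T] [IsSetTree T] (r : T → T → Prop)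

/-- The branch from `z` to `x` leaves `z` through its left immediate successor. -/
def TurnsLeft (z x : T) : Prop := ∃ y ≤ x, IsLeft r z y

/-- The branch from `z` to `x` leaves `z` through its right immediate successor. -/
def TurnsRight (z x : T) : Prop := ∃ y ≤ x, IsRight r z y

variable {r}

theorem exists_children [IsStrictTotalOrder T r] (hB : IsBinary T) (x : T) :
    ∃ a b, r a b ∧ {y | x ⋖ y} = {a, b} := by
  obtain ⟨a, b, hab, h⟩ := ncard_eq_two.1 (hB x)
  rcases trichotomous_of r a b with h' | h' | h'
  · exact ⟨a, b, h', h⟩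
  · exact (hab h').elim
  · exact ⟨b, a, h', by rw [h, pair_comm]⟩

theorem isLeft_or_isRight [IsStrictTotalOrder T r] (hB : IsBinary T) {x y : T} (h : x ⋖ y) :
    IsLeft r x y ∨ IsRight r x y := by
  obtain ⟨a, b, hab, hs⟩ := exists_children (r := r) hB x
  have ha : x ⋖ a := by
    have : a ∈ ({a, b} : Set T) := by simp
    rwa [← hs] at this
  have hb : x ⋖ b := by
    have : b ∈ ({a, b} : Set T) := by simp
    rwa [← hs] at this
  have : y ∈ ({a, b} : Set T) := hs ▸ h
  rcases this with rfl | rfl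
  · exact Or.inl ⟨h, b, hb, hab⟩
  · exact Or.inr ⟨h, a, ha, hab⟩

theorem not_isRight_of_isLeft [IsStrictTotalOrder T r] (hB : IsBinary T) {x y : T}
    (h : IsLeft r x y) : ¬ IsRight r x y := by
  rintro ⟨-, y'', h'', hr'⟩
  obtain ⟨h, y', h', hr⟩ := h
  obtain ⟨a, b, hab, hs⟩ := exists_children (r := r) hB x
  have m1 : y ∈ ({a, b} : Set T) := hs ▸ h
  have m2 : y' ∈ ({a, b} : Set T) := hs ▸ h'
  have m3 : y'' ∈ ({a, b} : Set T) := hs ▸ h''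
  have irr : ∀ c, ¬ r c c := irrefl_of r
  have asy : ∀ c d, r c d → ¬ r d c := fun c d => asymm_of r
  simp only [mem_insert_iff, mem_singleton_iff] at m1 m2 m3
  rcases m1 with rfl | rfl <;> rcases m2 with rfl | rfl <;> rcases m3 with rfl | rfl <;>
    first
    | exact irr _ hr
    | exact irr _ hr'
    | exact asy _ _ hr hr'

theorem exists_isLeft [IsStrictTotalOrder T r] (hB : IsBinary T) (x : T) : ∃ y, IsLeft r x y := by
  obtain ⟨a, b, hab, hs⟩ := exists_children (r := r) hB x
  have ha : a ∈ {y | x ⋖ y} := by simp [hs]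
  have hb : b ∈ {y | x ⋖ y} := by simp [hs]
  exact ⟨a, ha, b, hb, hab⟩

theorem exists_isRight [IsStrictTotalOrder T r] (hB : IsBinary T) (x : T) : ∃ y, IsRight r x y := by
  obtain ⟨a, b, hab, hs⟩ := exists_children (r := r) hB x
  have ha : a ∈ {y | x ⋖ y} := by simp [hs]
  have hb : b ∈ {y | x ⋖ y} := by simp [hs]
  exact ⟨b, hb, a, ha, hab⟩

theorem TurnsLeft.lt {z x : T} (h : TurnsLeft r z x) : z < x := by
  obtain ⟨y, hy, h, -⟩ := h
  exact h.lt.trans_le hy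

theorem TurnsRight.lt {z x : T} (h : TurnsRight r z x) : z < x := by
  obtain ⟨y, hy, h, -⟩ := h
  exact h.lt.trans_le hy

theorem turnsLeft_or_turnsRight [IsStrictTotalOrder T r] (hB : IsBinary T) {z x : T} (h : z < x) :
    TurnsLeft r z x ∨ TurnsRight r z x := by
  obtain ⟨y, hy, hyx⟩ := exists_covBy_le h
  exact (isLeft_or_isRight hB hy).imp (fun h => ⟨y, hyx, h⟩) fun h => ⟨y, hyx, h⟩

theorem TurnsLeft.not_turnsRight [IsStrictTotalOrder T r] (hB : IsBinary T) {z x : T}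
    (h : TurnsLeft r z x) : ¬ TurnsRight r z x := by
  rintro ⟨y', hy', h'⟩
  obtain ⟨y, hy, h⟩ := h
  obtain rfl := eq_of_covBy_of_le h.1 h'.1 hy hy'
  exact not_isRight_of_isLeft hB h h'

theorem TurnsLeft.mono {z x y : T} (h : TurnsLeft r z x) (hxy : x ≤ y) : TurnsLeft r z y := by
  obtain ⟨w, hw, h⟩ := h
  exact ⟨w, hw.trans hxy, h⟩

theorem TurnsRight.mono {z x y : T} (h : TurnsRight r z x) (hxy : x ≤ y) : TurnsRight r z y := by
  obtain ⟨w, hw, h⟩ := h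
  exact ⟨w, hw.trans hxy, h⟩

theorem mem_strip_iff {z x : T} {q p : ℝ × ℝ} {ε : ℝ} :
    p ∈ strip r z x q ε ↔ (TurnsLeft r z x ∧ p ∈ leftArm ∧ |p.1 - q.1| < ε) ∨
      (TurnsRight r z x ∧ p ∈ rightArm ∧ |p.2 - q.2| < ε) := by
  simp only [strip, TurnsLeft, TurnsRight, mem_ofPred_eq]
  constructor
  · rintro (⟨y, hy, h1, h2, h3⟩ | ⟨y, hy, h1, h2, h3⟩)
    · exact Or.inl ⟨⟨y, hy, h1⟩, h2, h3⟩
    · exact Or.inr ⟨⟨y, hy, h1⟩, h2, h3⟩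
  · rintro (⟨⟨y, hy, h1⟩, h2, h3⟩ | ⟨⟨y, hy, h1⟩, h2, h3⟩)
    · exact Or.inl ⟨y, hy, h1, h2, h3⟩
    · exact Or.inr ⟨y, hy, h1, h2, h3⟩

end Turns

end Fattening

/-! ### Plane geometry of the model piece -/

/-- The transversal coordinate of the left arm, extended to the collar. -/
noncomputable def posL (p : ℝ × ℝ) : ℝ := p.1 + max 0 (1 - p.1 - p.2) / 2

/-- The transversal coordinate of the right arm, extended to the collar. -/
noncomputable def posR (p : ℝ × ℝ) : ℝ := 1 - p.2 - max 0 (1 - p.1 - p.2) / 2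

/-- The relative height in the model piece: `0` on the bottom side, `1` on the top sides. -/
noncomputable def relHeight (p : ℝ × ℝ) : ℝ :=
  max 0 (p.1 + p.2 - 1) / (1 / 2 + max 0 (min p.1 p.2))

/-- The point of the left arm with given transversal coordinate and relative height. -/
noncomputable def armPoint (c e : ℝ) : ℝ × ℝ :=
  (c, min (e * (1 / 2 + c) + 1 - c) ((1 - c + e / 2) / (1 - e)))

theorem continuous_posL : Continuous posL := by unfold posL; fun_prop

theorem continuous_posR : Continuous posR := by unfold posR; fun_prop

theorem relHeight_denom_pos (p : ℝ × ℝ) : 0 < 1 / 2 + max 0 (min p.1 p.2) := by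
  have := le_max_left 0 (min p.1 p.2)
  linarith

theorem continuous_relHeight : Continuous relHeight := by
  unfold relHeight
  exact Continuous.div (by fun_prop) (by fun_prop) fun p => (relHeight_denom_pos p).ne'

theorem relHeight_nonneg (p : ℝ × ℝ) : 0 ≤ relHeight p :=
  div_nonneg (le_max_left _ _) (relHeight_denom_pos p).le

theorem relHeight_eq_zero {p : ℝ × ℝ} (h : p.1 + p.2 ≤ 1) : relHeight p = 0 := by
  rw [relHeight, max_eq_left (by linarith), zero_div]

theorem relHeight_pos {p : ℝ × ℝ} (h : 1 < p.1 + p.2) : 0 < relHeight p := by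
  rw [relHeight, max_eq_right (by linarith)]
  exact div_pos (by linarith) (relHeight_denom_pos p)

theorem piece_bounds {p : ℝ × ℝ} (h : p ∈ piece) :
    0 < p.1 ∧ 0 < p.2 ∧ 1 ≤ p.1 + p.2 ∧ p.1 < 3 / 2 ∧ p.2 < 3 / 2 ∧ min p.1 p.2 < 1 := by
  rcases h with ⟨h1, h2, h3, h4⟩ | ⟨h1, h2, h3, h4⟩
  · exact ⟨h1, by linarith, h3, by linarith, h4, min_lt_of_left_lt h2⟩
  · exact ⟨by linarith, h1, h3, h4, by linarith, min_lt_of_right_lt h2⟩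

/-- The distance to the top is proportional to the defect of the relative height. -/
theorem one_sub_relHeight {p : ℝ × ℝ} (h1 : 0 ≤ p.1) (h2 : 0 ≤ p.2) (h3 : 1 ≤ p.1 + p.2) :
    3 / 2 - max p.1 p.2 = (1 - relHeight p) * (1 / 2 + min p.1 p.2) := by
  have h0 : 0 ≤ min p.1 p.2 := le_min h1 h2
  rw [relHeight, max_eq_right (a := 0) (by linarith), max_eq_right h0]
  have : 0 < 1 / 2 + min p.1 p.2 := by linarith
  field_simp
  have := min_add_max p.1 p.2
  linarith

theorem relHeight_lt_one {p : ℝ × ℝ} (h : p ∈ piece) : relHeight p < 1 := by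
  obtain ⟨h1, h2, h3, h4, h5, h6⟩ := piece_bounds h
  have h0 : 0 < min p.1 p.2 := lt_min h1 h2
  have := one_sub_relHeight h1.le h2.le h3
  have hmax : max p.1 p.2 < 3 / 2 := max_lt h4 h5
  by_contra! hle
  nlinarith

theorem relHeight_swap (p : ℝ × ℝ) : relHeight p.swap = relHeight p := by
  simp only [relHeight, Prod.fst_swap, Prod.snd_swap]
  rw [min_comm, add_comm p.2]

theorem posL_of_le {p : ℝ × ℝ} (h : 1 ≤ p.1 + p.2) : posL p = p.1 := by
  rw [posL, max_eq_left (by linarith)]; ring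

theorem posR_of_le {p : ℝ × ℝ} (h : 1 ≤ p.1 + p.2) : posR p = 1 - p.2 := by
  rw [posR, max_eq_left (by linarith)]; ring

theorem posL_of_ge {p : ℝ × ℝ} (h : p.1 + p.2 ≤ 1) : posL p = (1 + p.1 - p.2) / 2 := by
  rw [posL, max_eq_right (by linarith)]; ring

theorem posR_of_ge {p : ℝ × ℝ} (h : p.1 + p.2 ≤ 1) : posR p = (1 + p.1 - p.2) / 2 := by
  rw [posR, max_eq_right (by linarith)]; ring

theorem mem_leftArm_iff {p : ℝ × ℝ} (h : p ∈ piece) : p ∈ leftArm ↔ 0 < p.1 ∧ p.1 < 1 := by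
  refine ⟨fun h' => ⟨h'.1, h'.2.1⟩, fun h' => ?_⟩
  obtain ⟨h1, h2, h3, h4, h5, h6⟩ := piece_bounds h
  exact ⟨h'.1, h'.2, h3, h5⟩

theorem mem_rightArm_iff {p : ℝ × ℝ} (h : p ∈ piece) : p ∈ rightArm ↔ 0 < p.2 ∧ p.2 < 1 := by
  refine ⟨fun h' => ⟨h'.1, h'.2.1⟩, fun h' => ?_⟩
  obtain ⟨h1, h2, h3, h4, h5, h6⟩ := piece_bounds h
  exact ⟨h'.1, h'.2, h3, h4⟩

/-- For fixed first coordinate, the equation for the relative height is linear in the second one,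
with a different formula on each side of the diagonal. The formula valid on the given side is the
smaller of the two, whence the `min` in `armPoint`. -/
theorem armPoint_relHeight {p : ℝ × ℝ} (h : p ∈ piece) : armPoint p.1 (relHeight p) = p := by
  obtain ⟨h1, h2, h3, h4, h5, h6⟩ := piece_bounds h
  have hlt := relHeight_lt_one h
  have h0 : 0 < min p.1 p.2 := lt_min h1 h2
  have he := one_sub_relHeight h1.le h2.le h3
  have hnn := relHeight_nonneg p
  refine Prod.ext rfl ?_
  simp only [armPoint]
  set e := relHeight p
  have hpos : 0 < 1 - e := by linarith
  rcases le_total p.1 p.2 with hle | hle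
  · rw [max_eq_right hle, min_eq_left hle] at he
    have e1 : e * (1 / 2 + p.1) + 1 - p.1 = p.2 := by linarith
    rw [e1, min_eq_left]
    rw [le_div_iff₀ hpos]
    nlinarith
  · rw [max_eq_left hle, min_eq_right hle] at he
    have e1 : (1 - p.1 + e / 2) / (1 - e) = p.2 := by
      rw [div_eq_iff hpos.ne']
      linarith
    rw [e1, min_eq_right]
    nlinarith

theorem relHeight_armPoint {c e : ℝ} (hc : 0 < c) (hc' : c < 1) (he : 0 ≤ e) (he' : e < 1) :
    armPoint c e ∈ leftArm ∧ relHeight (armPoint c e) = e := by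
  have hpos : 0 < 1 - e := by linarith
  set a := e * (1 / 2 + c) + 1 - c with ha
  set b := (1 - c + e / 2) / (1 - e) with hb
  have hbe : b * (1 - e) = 1 - c + e / 2 := by rw [hb, div_mul_cancel₀ _ hpos.ne']
  -- Both candidates lie on the same side of the diagonal, `a` being the nearer one: so `a ≤ b`
  -- above the diagonal and `b ≤ a` below it.
  have hab : a - c = (1 - e) * (b - c) := by rw [ha]; linear_combination -hbe
  have ha1 : 1 - c ≤ a := by rw [ha]; nlinarith
  have hb1 : 1 - c ≤ b := by rw [hb, le_div_iff₀ hpos]; nlinarith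
  have ha2 : a < 3 / 2 := by rw [ha]; nlinarith
  have hmem : armPoint c e ∈ leftArm :=
    ⟨hc, hc', by show 1 ≤ c + min a b; rw [← min_add_add_left]; exact le_min (by linarith) (by linarith),
      (min_le_left _ _).trans_lt ha2⟩
  refine ⟨hmem, ?_⟩
  obtain ⟨h1, h2, h3, h4, h5, h6⟩ := piece_bounds (Or.inl hmem)
  have h0 := one_sub_relHeight h1.le h2.le h3
  have e1 : (armPoint c e).1 = c := rfl
  have e2 : (armPoint c e).2 = min a b := rfl
  set η := relHeight (armPoint c e)
  rw [e1, e2] at h0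
  rw [e2] at h2
  rcases le_total c a with hle | hle
  · have hcb : 0 ≤ b - c := by
      by_contra! hneg
      nlinarith
    have : a ≤ b := by nlinarith
    rw [min_eq_left this, max_eq_right hle, min_eq_left hle] at h0
    have : (e - η) * (1 / 2 + c) = 0 := by rw [ha] at h0; linear_combination -h0
    rcases mul_eq_zero.1 this with h | h
    · linarith
    · linarith
  · have hcb : b - c ≤ 0 := by
      by_contra! hneg
      nlinarith
    have hba : b ≤ a := by nlinarith
    rw [min_eq_right hba, max_eq_left (by linarith), min_eq_right (by linarith)] at h0
    rw [min_eq_right hba] at h2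
    have : (e - η) * (1 / 2 + b) = 0 := by linear_combination -h0 - hbe
    rcases mul_eq_zero.1 this with h | h
    · linarith
    · linarith

theorem continuousAt_armPoint {q : ℝ × ℝ} (h : q.2 < 1) :
    ContinuousAt (fun q : ℝ × ℝ => armPoint q.1 q.2) q := by
  unfold armPoint
  refine ContinuousAt.prodMk continuousAt_fst (Filter.Tendsto.min
    (Continuous.continuousAt (by fun_prop)) ?_)
  exact ContinuousAt.div (by fun_prop) (by fun_prop) (by linarith)

/-! ### Local form of the topology and continuity of the charts -/

namespace Fattening

variable {T : Type u} [PartialOrder T] [IsSetTree T] {r : T → T → Prop}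

theorem one_le_iff (m : Fattening T r) : 1 ≤ m.pt.1 + m.pt.2 ↔ m.pt ∈ piece := by
  refine ⟨fun h => ?_, fun h => (piece_bounds h).2.2.1⟩
  rcases m.mem with h' | ⟨-, -, -, h'⟩
  · exact h'
  · linarith

theorem isMin_of_lt_one {m : Fattening T r} (h : m.pt.1 + m.pt.2 < 1) :
    IsMin m.base ∧ m.pt ∈ collar := by
  rcases m.mem with h' | h'
  · have := (piece_bounds h').2.2.1
    linarith
  · exact h'

theorem sum_pos (m : Fattening T r) : 0 < m.pt.1 + m.pt.2 := by
  rcases m.mem with h' | ⟨-, -, h', -⟩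
  · have := (piece_bounds h').2.2.1
    linarith
  · exact h'

/-- The conditions that the definition of the topology puts, at the point `m`, on the neighbourhoods
of `m`. -/
def LocalNhd (S : Set (Fattening T r)) (m : Fattening T r) : Prop :=
  (∃ V ∈ 𝓝 m.pt, ∀ m' : Fattening T r, m'.base = m.base → m'.pt ∈ V → m' ∈ S) ∧
  (m.pt.1 + m.pt.2 = 1 → ∀ z, z ⋖ m.base → ∃ ε > (0 : ℝ), ∀ p : Fattening T r, p.base = z →
    p.pt ∈ strip r z m.base m.pt ε → 3 / 2 - ε < max p.pt.1 p.pt.2 → p ∈ S) ∧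
  (m.pt.1 + m.pt.2 = 1 → Order.IsSuccLimit m.base → ∃ z < m.base, ∃ ε > (0 : ℝ),
    ∀ p : Fattening T r, z < p.base → p.base < m.base →
      p.pt ∈ strip r p.base m.base m.pt ε → p ∈ S)

theorem LocalNhd.mono {S S' : Set (Fattening T r)} {m : Fattening T r} (h : LocalNhd S m)
    (hS : S ⊆ S') : LocalNhd S' m := by
  obtain ⟨⟨V, hV, h1⟩, h2, h3⟩ := h
  refine ⟨⟨V, hV, fun m' hm hm' => hS (h1 m' hm hm')⟩, fun hb z hz => ?_, fun hb hl => ?_⟩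
  · obtain ⟨ε, hε, h⟩ := h2 hb z hz
    exact ⟨ε, hε, fun p hp hp' hp'' => hS (h p hp hp' hp'')⟩
  · obtain ⟨z, hz, ε, hε, h⟩ := h3 hb hl
    exact ⟨z, hz, ε, hε, fun p hp hp' hp'' => hS (h p hp hp' hp'')⟩

/-- Of the three clauses only the one about traces on pieces is global; it is recovered by taking
the union of all plane-open sets whose trace lies in `U`. -/
theorem isOpen_iff_localNhd {U : Set (Fattening T r)} : IsOpen U ↔ ∀ m ∈ U, LocalNhd U m := by
  constructor
  · rintro ⟨h1, h2, h3⟩ m hm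
    refine ⟨?_, h2 m hm, h3 m hm⟩
    obtain ⟨V, hV, h⟩ := h1 m.base
    exact ⟨V, hV.mem_nhds ((h m rfl).1 hm), fun m' hm' hv => (h m' hm').2 hv⟩
  · intro h
    refine ⟨fun x => ?_, fun m hm => (h m hm).2.1, fun m hm => (h m hm).2.2⟩
    refine ⟨⋃₀ {W | IsOpen W ∧ ∀ m' : Fattening T r, m'.base = x → m'.pt ∈ W → m' ∈ U},
      isOpen_sUnion fun W hW => hW.1, fun m hm => ⟨fun hmU => ?_, ?_⟩⟩
    · obtain ⟨V, hV, hV'⟩ := (h m hmU).1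
      obtain ⟨W, hWV, hW, hmW⟩ := mem_nhds_iff.1 hV
      exact ⟨W, ⟨hW, fun m' hm' hm'' => hV' m' (hm'.trans hm.symm) (hWV hm'')⟩, hmW⟩
    · rintro ⟨W, ⟨-, hW⟩, hmW⟩
      exact hW m hm hmW

open Classical in
/-- The transversal coordinate along the branch of `y`. -/
noncomputable def pos (y : T) (m : Fattening T r) : ℝ :=
  if TurnsLeft r m.base y then posL m.pt else posR m.pt

theorem pos_of_turnsLeft {y : T} {m : Fattening T r} (h : TurnsLeft r m.base y) :
    pos y m = posL m.pt := if_pos h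

theorem pos_of_turnsRight [IsStrictTotalOrder T r] (hB : IsBinary T) {y : T} {m : Fattening T r}
    (h : TurnsRight r m.base y) : pos y m = posR m.pt :=
  if_neg fun h' => h'.not_turnsRight hB h

/-- On the bottom side and in the collar the left and right positions agree, so there the coordinate
does not depend on the branch. -/
theorem pos_of_ge {y : T} {m : Fattening T r} (h : m.pt.1 + m.pt.2 ≤ 1) :
    pos y m = (1 + m.pt.1 - m.pt.2) / 2 := by
  unfold pos
  split_ifs
  · exact posL_of_ge h
  · exact posR_of_ge h

theorem pos_of_eq {y : T} {m : Fattening T r} (h : m.pt.1 + m.pt.2 = 1) : pos y m = m.pt.1 := by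
  rw [pos_of_ge h.le]; linarith

/-- The points of `M_T` below `y` on the branch of `y`: an open vertical strip. -/
def column (y : T) : Set (Fattening T r) := {m | m.base < y ∧ 0 < pos y m ∧ pos y m < 1}

theorem mem_leftArm_of_mem_column {y : T} {m : Fattening T r} (hm : m ∈ column y)
    (h : TurnsLeft r m.base y) (h1 : 1 ≤ m.pt.1 + m.pt.2) : m.pt ∈ leftArm := by
  have h2 := hm.2
  rw [pos_of_turnsLeft h, posL_of_le h1] at h2
  exact (mem_leftArm_iff ((one_le_iff m).1 h1)).2 h2

theorem mem_rightArm_of_mem_column [IsStrictTotalOrder T r] (hB : IsBinary T) {y : T}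
    {m : Fattening T r} (hm : m ∈ column y)
    (h : TurnsRight r m.base y) (h1 : 1 ≤ m.pt.1 + m.pt.2) : m.pt ∈ rightArm := by
  have h2 := hm.2
  rw [pos_of_turnsRight hB h, posR_of_le h1] at h2
  exact (mem_rightArm_iff ((one_le_iff m).1 h1)).2 ⟨by linarith, by linarith⟩

theorem mem_column_of_leftArm {y : T} {m : Fattening T r} (h : TurnsLeft r m.base y)
    (h1 : m.pt ∈ leftArm) : m ∈ column y := by
  refine ⟨h.lt, ?_⟩
  rw [pos_of_turnsLeft h, posL_of_le h1.2.2.1]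
  exact ⟨h1.1, h1.2.1⟩

theorem mem_column_of_rightArm [IsStrictTotalOrder T r] (hB : IsBinary T) {y : T}
    {m : Fattening T r} (h : TurnsRight r m.base y) (h1 : m.pt ∈ rightArm) : m ∈ column y := by
  refine ⟨h.lt, ?_⟩
  rw [pos_of_turnsRight hB h, posR_of_le h1.2.2.1]
  exact ⟨by linarith [h1.2.1], by linarith [h1.1]⟩

theorem mem_column_of_lt_one {y : T} {m : Fattening T r} (h : m.base < y)
    (h1 : m.pt.1 + m.pt.2 < 1) : m ∈ column y := by
  refine ⟨h, ?_⟩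
  rw [pos_of_ge h1.le]
  obtain ⟨h2, h3⟩ := abs_lt.1 (isMin_of_lt_one h1).2.1
  exact ⟨by linarith, by linarith⟩

theorem mem_column_of_eq_one {y : T} {m : Fattening T r} (h : m.base < y)
    (h1 : m.pt.1 + m.pt.2 = 1) : m ∈ column y := by
  refine ⟨h, ?_⟩
  rw [pos_of_eq h1]
  obtain ⟨h2, h3, -⟩ := piece_bounds ((one_le_iff m).1 h1.ge)
  exact ⟨h2, by linarith⟩

/-- Each arm lies in the column of the successor above it, and the collar in both of these columns.
-/
theorem exists_mem_column [IsStrictTotalOrder T r] (hB : IsBinary T) (m : Fattening T r) :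
    ∃ y, m.base ⋖ y ∧ m ∈ column y := by
  rcases lt_or_ge (m.pt.1 + m.pt.2) 1 with h | h
  · obtain ⟨y, hy⟩ := exists_isLeft (r := r) hB m.base
    exact ⟨y, hy.1, mem_column_of_lt_one hy.1.lt h⟩
  · rcases (one_le_iff m).1 h with h | h
    · obtain ⟨y, hy⟩ := exists_isLeft (r := r) hB m.base
      exact ⟨y, hy.1, mem_column_of_leftArm ⟨y, le_rfl, hy⟩ h⟩
    · obtain ⟨y, hy⟩ := exists_isRight (r := r) hB m.base
      exact ⟨y, hy.1, mem_column_of_rightArm hB ⟨y, le_rfl, hy⟩ h⟩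

variable (G : TreeHeight T)

/-- The height of a point of `M_T`. -/
noncomputable def height (m : Fattening T r) : ℝ :=
  G.val m.base + (G.next m.base - G.val m.base) * relHeight m.pt + min 0 (m.pt.1 + m.pt.2 - 1)

variable {G}

theorem height_of_le {m : Fattening T r} (h : 1 ≤ m.pt.1 + m.pt.2) :
    height G m = G.val m.base + (G.next m.base - G.val m.base) * relHeight m.pt := by
  rw [height, min_eq_left (by linarith), add_zero]

theorem height_of_ge {m : Fattening T r} (h : m.pt.1 + m.pt.2 ≤ 1) :
    height G m = G.val m.base + (m.pt.1 + m.pt.2 - 1) := by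
  rw [height, min_eq_right (by linarith), relHeight_eq_zero h]
  ring

theorem height_bounds {m : Fattening T r} (h : 1 ≤ m.pt.1 + m.pt.2) :
    G.val m.base ≤ height G m ∧ height G m < G.next m.base := by
  rw [height_of_le h]
  have h1 := relHeight_nonneg m.pt
  have h2 := relHeight_lt_one ((one_le_iff m).1 h)
  have h3 := G.lt_next m.base
  constructor <;> nlinarith

theorem height_lt_next (m : Fattening T r) : height G m < G.next m.base := by
  rcases le_total 1 (m.pt.1 + m.pt.2) with h | h
  · exact (height_bounds h).2
  · rw [height_of_ge h]
    linarith [G.lt_next m.base]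

theorem lt_one_of_height_lt (hR : IsRooted T) {o : T} (ho : IsMin o) {m : Fattening T r}
    (h : height G m < G.val o) : m.pt.1 + m.pt.2 < 1 := by
  by_contra! h1
  have h2 := (height_bounds (G := G) h1).1
  have h3 := G.strictMono.monotone (root_le hR ho m.base)
  linarith

/-- The heights in the piece of `x` lie in `[val x, next x)`, and on one branch these intervals are
disjoint: on a column the height determines the piece. -/
theorem base_eq_of_height {x y : T} {m : Fattening T r} (hm : m.base < y) (hx : x < y)
    (h1 : 1 ≤ m.pt.1 + m.pt.2)
    (h : G.val x ≤ height G m) (h' : height G m < G.next x) : m.base = x := by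
  have hb := height_bounds (G := G) h1
  exact le_antisymm (G.le_of_lt_next hm.le hx.le (hb.1.trans_lt h'))
    (G.le_of_lt_next hx.le hm.le (h.trans_lt hb.2))

variable (G)

/-- The chart of `M_T` around the points below `y`. -/
noncomputable def chart (y : T) (m : Fattening T r) : ℝ × ℝ := (pos y m, height G m)

/-- Continuity of the chart, clause by clause. On a piece it is an explicit continuous formula.
Across a top side, the relative height tends to `1` and the height to `next z`, the value at the
successor. Below a limit level, the heights are squeezed between `val z` and the value at the limit,
which are close by continuity of `val`. -/
theorem localNhd_chart [IsStrictTotalOrder T r] (hB : IsBinary T) {y : T} {m : Fattening T r}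
    (hm : m.base < y) {O : Set (ℝ × ℝ)} (hO : O ∈ 𝓝 (chart G y m)) :
    LocalNhd {m' | m'.base < y ∧ chart G y m' ∈ O} m := by
  obtain ⟨δ, hδ, hball⟩ := Metric.mem_nhds_iff.1 hO
  have close : ∀ m' : Fattening T r, |pos y m' - pos y m| < δ → |height G m' - height G m| < δ →
      chart G y m' ∈ O := fun m' h1 h2 => hball (by
    rw [Metric.mem_ball, Prod.dist_eq]
    exact max_lt h1 h2)
  have hstrip : ∀ {ε : ℝ}, ε ≤ δ → m.pt.1 + m.pt.2 = 1 → ∀ p : Fattening T r,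
      p.pt ∈ strip r p.base m.base m.pt ε → |pos y p - pos y m| < δ ∧ p.pt ∈ piece := by
    intro ε hεδ hb p hp
    rw [pos_of_eq hb]
    rcases mem_strip_iff.1 hp with ⟨h1, h2, h3⟩ | ⟨h1, h2, h3⟩
    · rw [pos_of_turnsLeft (h1.mono hm.le), posL_of_le h2.2.2.1]
      exact ⟨h3.trans_le hεδ, Or.inl h2⟩
    · rw [pos_of_turnsRight hB (h1.mono hm.le), posR_of_le h2.2.2.1]
      refine ⟨?_, Or.inr h2⟩
      have : 1 - p.pt.2 - m.pt.1 = -(p.pt.2 - m.pt.2) := by linarith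
      rw [this, abs_neg]
      exact h3.trans_le hεδ
  refine ⟨?_, fun hb z hz => ?_, fun hb hlim => ?_⟩
  · obtain ⟨f, hf, hpos⟩ : ∃ f : ℝ × ℝ → ℝ, Continuous f ∧
        ∀ m' : Fattening T r, m'.base = m.base → pos y m' = f m'.pt := by
      by_cases h : TurnsLeft r m.base y
      · exact ⟨posL, continuous_posL, fun m' hm' => if_pos (hm' ▸ h)⟩
      · exact ⟨posR, continuous_posR, fun m' hm' => if_neg (hm' ▸ h)⟩
    let K : ℝ × ℝ → ℝ × ℝ := fun q => (f q,
      G.val m.base + (G.next m.base - G.val m.base) * relHeight q + min 0 (q.1 + q.2 - 1))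
    have hK : Continuous K := by
      have := continuous_relHeight
      fun_prop
    have hKm : ∀ m' : Fattening T r, m'.base = m.base → chart G y m' = K m'.pt := fun m' h => by
      simp only [chart, hpos m' h, height, K, h]
    refine ⟨K ⁻¹' O, hK.continuousAt.preimage_mem_nhds (hKm m rfl ▸ hO), fun m' h1 h2 => ⟨h1 ▸ hm, ?_⟩⟩
    rw [hKm m' h1]
    exact h2
  · refine ⟨min (1 / 2) (δ / 3), by positivity, fun p hp hp1 hp2 => ⟨hp ▸ hz.lt.trans hm, ?_⟩⟩
    subst hp
    have hε1 := min_le_left (1 / 2) (δ / 3)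
    have hε2 := min_le_right (1 / 2) (δ / 3)
    obtain ⟨h1, h2⟩ := hstrip (by linarith) hb p hp1
    refine close p h1 ?_
    obtain ⟨b1, b2, b3, b4, b5, b6⟩ := piece_bounds h2
    rw [height_of_le b3, height_of_ge hb.le, hb, G.val_covBy hz]
    have e1 := one_sub_relHeight b1.le b2.le b3
    have e2 := relHeight_lt_one h2
    have e3 : 0 < min p.pt.1 p.pt.2 := lt_min b1 b2
    have g1 := G.lt_next p.base
    have g2 := G.next_le_one p.base
    have g3 := G.nonneg p.base
    have e4 : 1 - relHeight p.pt < 2 * min (1 / 2) (δ / 3) := by nlinarith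
    rw [abs_sub_comm, abs_of_nonneg (by nlinarith)]
    have : (G.next p.base - G.val p.base) * (1 - relHeight p.pt) ≤ 1 - relHeight p.pt := by nlinarith
    linarith
  · have hlt : G.val m.base - δ < G.val m.base := by linarith
    obtain ⟨z, hz, hzv⟩ := G.exists_lt hlim hlt
    refine ⟨z, hz, δ, hδ, fun p hzp hpm hp => ⟨hpm.trans hm, ?_⟩⟩
    obtain ⟨h1, h2⟩ := hstrip le_rfl hb p hp
    refine close p h1 ?_
    have h3 := height_bounds (G := G) ((one_le_iff p).2 h2)
    have h4 := G.next_le hpm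
    have h5 := G.strictMono hzp
    rw [height_of_ge hb.le, hb]
    rw [abs_lt]
    constructor <;> linarith

theorem isOpen_chart_preimage [IsStrictTotalOrder T r] (hB : IsBinary T) (y : T) {O : Set (ℝ × ℝ)}
    (hO : IsOpen O) : IsOpen {m : Fattening T r | m.base < y ∧ chart G y m ∈ O} :=
  isOpen_iff_localNhd.2 fun _ hm => localNhd_chart G hB hm.1 (hO.mem_nhds hm.2)

theorem continuousAt_chart [IsStrictTotalOrder T r] (hB : IsBinary T) {y : T} {m : Fattening T r}
    (hm : m.base < y) : ContinuousAt (chart G y) m := by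
  intro O hO
  obtain ⟨W, hWO, hW, hmW⟩ := mem_nhds_iff.1 hO
  have h := (isOpen_chart_preimage G hB y hW).mem_nhds
    (show m ∈ {m : Fattening T r | m.base < y ∧ chart G y m ∈ W} from ⟨hm, hmW⟩)
  exact Filter.mem_map.2 (Filter.mem_of_superset h fun m' hm' => hWO hm'.2)

end Fattening

/-! ### The charts as homeomorphisms onto open rectangles -/

namespace Fattening

variable {T : Type u} [PartialOrder T] [IsSetTree T] {r : T → T → Prop}

open Classical in
/-- The point of the model piece with given transversal coordinate and relative height, in the arm
of the piece of `x` that lies on the branch of `y`. -/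
noncomputable def branchPoint (r : T → T → Prop) (x y : T) (q : ℝ × ℝ) : ℝ × ℝ :=
  if TurnsLeft r x y then armPoint q.1 q.2 else (armPoint (1 - q.1) q.2).swap

theorem continuousAt_branchPoint (x y : T) {q : ℝ × ℝ} (h : q.2 < 1) :
    ContinuousAt (branchPoint r x y) q := by
  unfold branchPoint
  split_ifs
  · exact continuousAt_armPoint h
  · have h1 : ContinuousAt (fun q : ℝ × ℝ => armPoint q.1 q.2) (1 - q.1, q.2) :=
      continuousAt_armPoint h
    have h2 : ContinuousAt (fun q : ℝ × ℝ => (1 - q.1, q.2)) q := by fun_prop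
    exact continuous_swap.continuousAt.comp (ContinuousAt.comp (f := fun q : ℝ × ℝ => (1 - q.1, q.2)) (x := q)
      (g := fun q : ℝ × ℝ => armPoint q.1 q.2) h1 h2)

theorem branchPoint_eq [IsStrictTotalOrder T r] (hB : IsBinary T) {y : T} {m : Fattening T r}
    (hm : m ∈ column y) (h : 1 ≤ m.pt.1 + m.pt.2) :
    branchPoint r m.base y (pos y m, relHeight m.pt) = m.pt := by
  have hp := (one_le_iff m).1 h
  by_cases ht : TurnsLeft r m.base y
  · rw [branchPoint, if_pos ht]
    simp only
    rw [pos_of_turnsLeft ht, posL_of_le h, armPoint_relHeight hp]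
  · have ht' := (turnsLeft_or_turnsRight hB hm.1).resolve_left ht
    rw [branchPoint, if_neg ht]
    simp only
    rw [pos_of_turnsRight hB ht', posR_of_le h]
    have hs : m.pt.swap ∈ piece := by
      rcases hp with ⟨a, b, c, d⟩ | ⟨a, b, c, d⟩
      · exact Or.inr ⟨a, b, by rw [Prod.fst_swap, Prod.snd_swap]; linarith, d⟩
      · exact Or.inl ⟨a, b, by rw [Prod.fst_swap, Prod.snd_swap]; linarith, d⟩
    have := armPoint_relHeight hs
    rw [relHeight_swap, Prod.fst_swap] at this
    rw [sub_sub_cancel, this, Prod.swap_swap]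

theorem pos_branchPoint [IsStrictTotalOrder T r] (hB : IsBinary T) {x y : T} (hxy : x < y)
    {c e : ℝ} (hc : 0 < c) (hc' : c < 1) (he : 0 ≤ e) (he' : e < 1) :
    ∃ m : Fattening T r, m.base = x ∧ m ∈ column y ∧ pos y m = c ∧ relHeight m.pt = e ∧
      1 ≤ m.pt.1 + m.pt.2 := by
  rcases turnsLeft_or_turnsRight (r := r) hB hxy with h | h
  · obtain ⟨h1, h2⟩ := relHeight_armPoint hc hc' he he'
    refine ⟨⟨x, armPoint c e, Or.inl (Or.inl h1)⟩, rfl, mem_column_of_leftArm h h1, ?_, h2, h1.2.2.1⟩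
    rw [pos_of_turnsLeft h, posL_of_le h1.2.2.1]
    rfl
  · obtain ⟨h1, h2⟩ := relHeight_armPoint (c := 1 - c) (by linarith) (by linarith) he he'
    have h3 : (armPoint (1 - c) e).swap ∈ rightArm :=
      ⟨h1.1, h1.2.1, by rw [Prod.fst_swap, Prod.snd_swap, add_comm]; exact h1.2.2.1, h1.2.2.2⟩
    refine ⟨⟨x, (armPoint (1 - c) e).swap, Or.inl (Or.inr h3)⟩, rfl,
      mem_column_of_rightArm hB h h3, ?_, by rw [relHeight_swap, h2], h3.2.2.1⟩
    rw [pos_of_turnsRight hB h, posR_of_le h3.2.2.1]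
    simp [armPoint]

variable (G : TreeHeight T)

theorem relHeight_eq_div {m : Fattening T r} (h : 1 ≤ m.pt.1 + m.pt.2) :
    relHeight m.pt = (height G m - G.val m.base) / (G.next m.base - G.val m.base) := by
  rw [height_of_le h, add_sub_cancel_left, mul_div_cancel_left₀]
  linarith [G.lt_next m.base]

variable {G} in
theorem one_le_of_val_le_height (hR : IsRooted T) {x : T} {m : Fattening T r}
    (h : G.val x ≤ height G m) : 1 ≤ m.pt.1 + m.pt.2 := by
  by_contra! h1
  have h2 := h
  rw [height_of_ge h1.le] at h2
  have h3 := G.strictMono.monotone (root_le hR (isMin_of_lt_one h1).1 x)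
  linarith

theorem pt_eq_branchPoint [IsStrictTotalOrder T r] (hB : IsBinary T) {y : T} {m : Fattening T r}
    (hm : m ∈ column y) (h : 1 ≤ m.pt.1 + m.pt.2) :
    m.pt = branchPoint r m.base y
      (pos y m, (height G m - G.val m.base) / (G.next m.base - G.val m.base)) := by
  rw [← relHeight_eq_div G h, branchPoint_eq hB hm h]

theorem pt_eq_of_sum_le {y : T} {m : Fattening T r} (h : m.pt.1 + m.pt.2 ≤ 1) :
    m.pt = ((2 * pos y m + height G m - G.val m.base) / 2,
      (height G m - G.val m.base + 2 - 2 * pos y m) / 2) := by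
  rw [height_of_ge h, pos_of_ge h]
  refine Prod.ext ?_ ?_ <;> simp only <;> ring

/-- Within one piece the chart has continuous inverses: `branchPoint` on and above the bottom side,
an affine map on and below it; on the bottom side itself both are needed. The statement quantifies
over points of the plane because continuity of the inverse chart is not yet available. -/
theorem eventually_pt_mem [IsStrictTotalOrder T r] (hB : IsBinary T) {y : T} {m : Fattening T r}
    (hm : m ∈ column y) {V : Set (ℝ × ℝ)} (hV : V ∈ 𝓝 m.pt) :
    ∀ᶠ q in 𝓝 (chart G y m), ∀ m' ∈ (column y : Set (Fattening T r)), chart G y m' = q →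
      m'.base = m.base → m'.pt ∈ V := by
  have hup : 1 ≤ m.pt.1 + m.pt.2 →
      ∀ᶠ q in 𝓝 (chart G y m), ∀ m' ∈ (column y : Set (Fattening T r)), chart G y m' = q →
      m'.base = m.base → 1 ≤ m'.pt.1 + m'.pt.2 → m'.pt ∈ V := by
    intro h
    let Q : ℝ × ℝ → ℝ × ℝ := fun q => branchPoint r m.base y
      (q.1, (q.2 - G.val m.base) / (G.next m.base - G.val m.base))
    have hQm : Q (chart G y m) = m.pt := (pt_eq_branchPoint G hB hm h).symm
    have hQ : ContinuousAt Q (chart G y m) := by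
      have h1 : ContinuousAt (fun q : ℝ × ℝ => (q.1, (q.2 - G.val m.base) /
          (G.next m.base - G.val m.base))) (chart G y m) := by fun_prop
      refine ContinuousAt.comp (g := branchPoint r m.base y) (continuousAt_branchPoint _ _ ?_) h1
      show (height G m - G.val m.base) / (G.next m.base - G.val m.base) < 1
      rw [← relHeight_eq_div G h]
      exact relHeight_lt_one ((one_le_iff m).1 h)
    filter_upwards [hQ.preimage_mem_nhds (hQm ▸ hV)] with q hq m' hm' hc hb h'
    rw [pt_eq_branchPoint G hB hm' h', hb]
    rw [← hc] at hq
    exact hq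
  have hdown : m.pt.1 + m.pt.2 ≤ 1 →
      ∀ᶠ q in 𝓝 (chart G y m), ∀ m' ∈ (column y : Set (Fattening T r)), chart G y m' = q →
      m'.base = m.base → m'.pt.1 + m'.pt.2 ≤ 1 → m'.pt ∈ V := by
    intro h
    let Q : ℝ × ℝ → ℝ × ℝ := fun q => ((2 * q.1 + q.2 - G.val m.base) / 2,
      (q.2 - G.val m.base + 2 - 2 * q.1) / 2)
    have hQm : Q (chart G y m) = m.pt := (pt_eq_of_sum_le G h).symm
    have hQ : ContinuousAt Q (chart G y m) := by fun_prop
    filter_upwards [hQ.preimage_mem_nhds (hQm ▸ hV)] with q hq m' hm' hc hb h'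
    rw [pt_eq_of_sum_le G (y := y) h', hb]
    rw [← hc] at hq
    exact hq
  rcases lt_trichotomy (m.pt.1 + m.pt.2) 1 with h | h | h
  · have hlt : (chart G y m).2 < G.val m.base := by
      show height G m < _
      rw [height_of_ge h.le]; linarith
    filter_upwards [hdown h.le, continuousAt_snd.eventually_lt_const hlt] with q hq hq2 m' hm' hc hb
    refine hq m' hm' hc hb ?_
    by_contra! hc'
    have := (height_bounds (G := G) hc'.le).1
    rw [← hc] at hq2
    have hq2 : height G m' < G.val m.base := hq2
    rw [hb] at this
    linarith
  · filter_upwards [hup h.ge, hdown h.le] with q hq hq' m' hm' hc hb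
    rcases le_total 1 (m'.pt.1 + m'.pt.2) with h' | h'
    · exact hq m' hm' hc hb h'
    · exact hq' m' hm' hc hb h'
  · have hlt : G.val m.base < (chart G y m).2 := by
      show _ < height G m
      rw [height_of_le h.le]
      nlinarith [relHeight_pos h, G.lt_next m.base]
    filter_upwards [hup h.le, continuousAt_snd.eventually_const_lt hlt] with q hq hq2 m' hm' hc hb
    refine hq m' hm' hc hb ?_
    by_contra! hc'
    rw [← hc] at hq2
    have hq2 : G.val m.base < height G m' := hq2
    rw [height_of_ge hc'.le, hb] at hq2
    linarith

/-- The chart detects the neighbourhoods of a point. -/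
theorem eventually_mem_of_localNhd [IsStrictTotalOrder T r] (hB : IsBinary T) (hR : IsRooted T)
    {y : T} {m : Fattening T r}
    (hm : m ∈ column y) {S : Set (Fattening T r)} (hS : LocalNhd S m) :
    ∀ᶠ q in 𝓝 (chart G y m), ∀ m' ∈ (column y : Set (Fattening T r)), chart G y m' = q → m' ∈ S := by
  obtain ⟨⟨V, hV, h1⟩, h2, h3⟩ := hS
  have hbase := eventually_pt_mem G hB hm hV
  have hnext : ∀ᶠ q in 𝓝 (chart G y m), q.2 < G.next m.base :=
    continuousAt_snd.eventually_lt_const (height_lt_next m)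
  rcases lt_trichotomy (m.pt.1 + m.pt.2) 1 with h | h | h
  · have hlt : (chart G y m).2 < G.val m.base := by
      show height G m < _
      rw [height_of_ge h.le]; linarith
    filter_upwards [hbase, continuousAt_snd.eventually_lt_const hlt] with q hq hq2 m' hm' hc
    have ho := (isMin_of_lt_one h).1
    rw [← hc] at hq2
    have h' := lt_one_of_height_lt (G := G) (m := m') hR ho hq2
    have hb := hR.unique (isMin_of_lt_one h').1 ho
    exact h1 m' hb (hq m' hm' hc hb)
  · have hval : (chart G y m).2 = G.val m.base := by
      show height G m = _
      rw [height_of_ge h.le]; linarith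
    have hup : ∀ᶠ q in 𝓝 (chart G y m), ∀ m' ∈ (column y : Set (Fattening T r)), chart G y m' = q →
        G.val m.base ≤ q.2 → m' ∈ S := by
      filter_upwards [hbase, hnext] with q hq hq' m' hm' hc hle
      have hb : m'.base = m.base := by
        rw [← hc] at hq' hle
        exact base_eq_of_height hm'.1 hm.1 (one_le_of_val_le_height hR hle) hle hq'
      exact h1 m' hb (hq m' hm' hc hb)
    suffices hdown : ∀ᶠ q in 𝓝 (chart G y m), ∀ m' ∈ (column y : Set (Fattening T r)), chart G y m' = q →
        q.2 < G.val m.base → m' ∈ S by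
      filter_upwards [hup, hdown] with q hq hq' m' hm' hc
      rcases le_or_gt (G.val m.base) q.2 with hle | hlt
      · exact hq m' hm' hc hle
      · exact hq' m' hm' hc hlt
    have hpos : ∀ {ε : ℝ}, 0 < ε → ∀ᶠ q in 𝓝 (chart G y m), |q.1 - m.pt.1| < ε := by
      intro ε hε
      have : Filter.Tendsto (fun q : ℝ × ℝ => |q.1 - m.pt.1|) (𝓝 (chart G y m)) (𝓝 0) := by
        have : ContinuousAt (fun q : ℝ × ℝ => |q.1 - m.pt.1|) (chart G y m) := by fun_prop
        have h0 : |(chart G y m).1 - m.pt.1| = 0 := by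
          show |pos y m - m.pt.1| = 0
          rw [pos_of_eq h, sub_self, abs_zero]
        rw [ContinuousAt, h0] at this
        exact this
      exact this.eventually_lt_const hε
    have hstrip : ∀ {ε : ℝ} {m' : Fattening T r}, m' ∈ column y → m'.base < m.base →
        1 ≤ m'.pt.1 + m'.pt.2 → |pos y m' - m.pt.1| < ε →
        m'.pt ∈ strip r m'.base m.base m.pt ε := by
      intro ε m' hm' hlt hs hc
      rw [mem_strip_iff]
      rcases turnsLeft_or_turnsRight (r := r) hB hlt with ht | ht
      · have ht' := ht.mono hm.1.le
        refine Or.inl ⟨ht, mem_leftArm_of_mem_column hm' ht' hs, ?_⟩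
        rwa [pos_of_turnsLeft ht', posL_of_le hs] at hc
      · have ht' := ht.mono hm.1.le
        refine Or.inr ⟨ht, mem_rightArm_of_mem_column hB hm' ht' hs, ?_⟩
        rw [pos_of_turnsRight hB ht', posR_of_le hs] at hc
        have : m'.pt.2 - m.pt.2 = -(1 - m'.pt.2 - m.pt.1) := by linarith
        rwa [this, abs_neg]
    -- What lies in the column just below the bottom side: the collar, the top of the preceding
    -- piece, or a final part of the pieces of the branch. This matches the clauses of `LocalNhd`.
    rcases isMin_or_covBy_or_isSuccLimit m.base with ho | ⟨z, hz⟩ | hlim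
    · filter_upwards [hbase] with q hq m' hm' hc hlt
      rw [← hc] at hlt
      have h' := lt_one_of_height_lt (G := G) (m := m') hR ho hlt
      have hb := hR.unique (isMin_of_lt_one h').1 ho
      exact h1 m' hb (hq m' hm' hc hb)
    · obtain ⟨ε, hε, h2⟩ := h2 h z hz
      have hgap : 0 < G.next z - G.val z := by linarith [G.lt_next z]
      -- The `1` keeps the point in the piece of `z`. The `ε / 2` bounds the defect of the relative
      -- height, and the distance to the top is that defect times a factor below `3 / 2`, hence less
      -- than `ε`.
      have hlow : G.next z - (G.next z - G.val z) * min 1 (ε / 2) < (chart G y m).2 := by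
        rw [hval, G.val_covBy hz]
        have : 0 < (G.next z - G.val z) * min 1 (ε / 2) := by positivity
        linarith
      filter_upwards [hpos hε, continuousAt_snd.eventually_const_lt hlow] with q hq hq2 m' hm' hc hlt
      rw [← hc] at hq hq2 hlt
      have hq : |pos y m' - m.pt.1| < ε := hq
      have hq2 : G.next z - (G.next z - G.val z) * min 1 (ε / 2) < height G m' := hq2
      have hlt : height G m' < G.val m.base := hlt
      rw [G.val_covBy hz] at hlt
      have hzle : G.val z ≤ height G m' := by
        have : (G.next z - G.val z) * min 1 (ε / 2) ≤ (G.next z - G.val z) * 1 :=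
          mul_le_mul_of_nonneg_left (min_le_left _ _) hgap.le
        linarith
      have hs := one_le_of_val_le_height hR hzle
      have hb : m'.base = z := base_eq_of_height hm'.1 (hz.lt.trans hm.1) hs hzle hlt
      refine h2 m' hb (hb ▸ hstrip hm' (hb ▸ hz.lt) hs hq) ?_
      obtain ⟨b1, b2, b3, b4, b5, b6⟩ := piece_bounds ((one_le_iff m').1 hs)
      have e1 := one_sub_relHeight b1.le b2.le b3
      have e2 := relHeight_lt_one ((one_le_iff m').1 hs)
      rw [height_of_le hs, hb] at hq2
      have e3 : 1 - relHeight m'.pt < min 1 (ε / 2) := by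
        have : (G.next z - G.val z) * (1 - relHeight m'.pt) <
          (G.next z - G.val z) * min 1 (ε / 2) := by linarith
        exact lt_of_mul_lt_mul_left this hgap.le
      have e4 : 1 - relHeight m'.pt < ε / 2 := e3.trans_le (min_le_right _ _)
      nlinarith
    · obtain ⟨z, hz, ε, hε, h3⟩ := h3 h hlim
      -- A height above `val w` only yields `w ≤ m'.base`; passing from `z` to `w` restores the
      -- strict inequality.
      obtain ⟨w, hzw, hw⟩ := exists_between_of_isSuccLimit hlim hz
      have hlow : G.val w < (chart G y m).2 := by
        rw [hval]
        exact G.strictMono hw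
      filter_upwards [hpos hε, continuousAt_snd.eventually_const_lt hlow] with q hq hq2 m' hm' hc hlt
      rw [← hc] at hq hq2 hlt
      have hq : |pos y m' - m.pt.1| < ε := hq
      have hq2 : G.val w < height G m' := hq2
      have hlt : height G m' < G.val m.base := hlt
      have hs := one_le_of_val_le_height hR hq2.le
      have hb1 := height_bounds (G := G) hs
      have hwb : w ≤ m'.base := G.le_of_lt_next (hw.trans hm.1).le hm'.1.le (hq2.trans hb1.2)
      have hbm : m'.base < m.base := by
        rcases lt_trichotomy_of_lt hm'.1 hm.1 with h' | h' | h'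
        · exact h'
        · rw [h'] at hb1; linarith
        · have := G.strictMono h'; linarith
      exact h3 m' (hzw.trans_le hwb) hbm (hstrip hm' hbm hs hq)
  · have hlt : G.val m.base < (chart G y m).2 := by
      show _ < height G m
      rw [height_of_le h.le]
      nlinarith [relHeight_pos h, G.lt_next m.base]
    filter_upwards [hbase, hnext, continuousAt_snd.eventually_const_lt hlt] with q hq hq1 hq2 m' hm' hc
    rw [← hc] at hq1 hq2
    have hb : m'.base = m.base :=
      base_eq_of_height hm'.1 hm.1 (one_le_of_val_le_height hR (le_of_lt hq2)) (le_of_lt hq2) hq1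
    exact h1 m' hb (hq m' hm' hc hb)

theorem isOpen_column [IsStrictTotalOrder T r] (hG : Nonempty (TreeHeight T)) (hB : IsBinary T)
    (y : T) : IsOpen (column y : Set (Fattening T r)) := by
  obtain ⟨G⟩ := hG
  have h : IsOpen (Ioo (0 : ℝ) 1 ×ˢ (univ : Set ℝ)) := isOpen_Ioo.prod isOpen_univ
  convert isOpen_chart_preimage (r := r) G hB y h using 1
  ext m
  simp [column, chart]

variable {G} in
/-- A neighbourhood of a point is a set that satisfies, at this point, the conditions in the definition
of the topology. -/
theorem mem_nhds_iff_localNhd [IsStrictTotalOrder T r] (hB : IsBinary T) (hR : IsRooted T)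
    (hG : Nonempty (TreeHeight T)) {S : Set (Fattening T r)} {m : Fattening T r} :
    S ∈ 𝓝 m ↔ LocalNhd S m := by
  constructor
  · intro h
    obtain ⟨U, hUS, hU, hm⟩ := mem_nhds_iff.1 h
    exact (isOpen_iff_localNhd.1 hU m hm).mono hUS
  · intro h
    obtain ⟨y, -, hy⟩ := exists_mem_column hB m
    obtain ⟨G⟩ := hG
    have h1 := (continuousAt_chart G hB hy.1).eventually (eventually_mem_of_localNhd G hB hR hy h)
    filter_upwards [h1, (isOpen_column ⟨G⟩ hB y).mem_nhds hy] with m' h' h''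
    exact h' m' h'' rfl

/-- Convergence to a point of `M_T` can be checked in the charts. -/
theorem tendsto_of_chart [IsStrictTotalOrder T r] (hB : IsBinary T) (hR : IsRooted T)
    {ι : Type*} {l : Filter ι} {F : ι → Fattening T r} {y : T} {m : Fattening T r} (hm : m ∈ column y)
    (h1 : ∀ᶠ i in l, F i ∈ column y) (h2 : Filter.Tendsto (fun i => pos y (F i)) l (𝓝 (pos y m)))
    (h3 : Filter.Tendsto (fun i => height G (F i)) l (𝓝 (height G m))) :
    Filter.Tendsto F l (𝓝 m) := by
  intro S hS
  have h4 := eventually_mem_of_localNhd G hB hR hm ((mem_nhds_iff_localNhd hB hR ⟨G⟩).1 hS)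
  have h5 : Filter.Tendsto (fun i => chart G y (F i)) l (𝓝 (chart G y m)) := h2.prodMk_nhds h3
  refine Filter.mem_map.2 ?_
  filter_upwards [h1, h5.eventually h4] with i hi hi'
  exact hi' (F i) hi rfl

theorem continuous_height [IsStrictTotalOrder T r] (hB : IsBinary T) :
    Continuous (height G : Fattening T r → ℝ) := by
  rw [continuous_iff_continuousAt]
  intro m
  obtain ⟨y, -, hy⟩ := exists_mem_column hB m
  exact continuousAt_snd.comp (continuousAt_chart G hB hy.1)

theorem continuousAt_pos [IsStrictTotalOrder T r] (hB : IsBinary T) (hG : Nonempty (TreeHeight T))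
    {y : T} {m : Fattening T r} (hm : m ∈ column y) : ContinuousAt (pos y) m := by
  obtain ⟨G⟩ := hG
  exact continuousAt_fst.comp (continuousAt_chart G hB hm.1)

/-- The height determines the piece, and the inverse formulas then recover the point in it. -/
theorem eq_of_chart_eq [IsStrictTotalOrder T r] (hB : IsBinary T) (hR : IsRooted T) {y : T}
    {m m' : Fattening T r} (hm : m ∈ column y) (hm' : m' ∈ column y)
    (h1 : pos y m = pos y m') (h2 : height G m = height G m') : m = m' := by
  rcases lt_or_ge (m.pt.1 + m.pt.2) 1 with h | h
  · have ho := (isMin_of_lt_one h).1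
    have hlt : height G m < G.val m.base := by rw [height_of_ge h.le]; linarith
    have h' := lt_one_of_height_lt (G := G) (m := m') hR ho (h2 ▸ hlt)
    have hb := hR.unique ho (isMin_of_lt_one h').1
    refine Fattening.ext hb ?_
    rw [pt_eq_of_sum_le G (y := y) h.le, pt_eq_of_sum_le G (y := y) h'.le, h1, h2, hb]
  · have hb := height_bounds (G := G) h
    have h' : 1 ≤ m'.pt.1 + m'.pt.2 := one_le_of_val_le_height hR (h2 ▸ hb.1)
    have hbase : m'.base = m.base := base_eq_of_height hm'.1 hm.1 h' (h2 ▸ hb.1) (h2 ▸ hb.2)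
    refine Fattening.ext hbase.symm ?_
    rw [pt_eq_branchPoint G hB hm h, pt_eq_branchPoint G hB hm' h', h1, h2, hbase]

theorem exists_chart_eq [IsStrictTotalOrder T r] (hB : IsBinary T) (hR : IsRooted T) {o y : T}
    (ho : IsMin o) (hy : o < y) {c e : ℝ} (hc : 0 < c) (hc' : c < 1) (he : G.val o - 1 < e)
    (he' : e < G.val y) : ∃ m : Fattening T r, m ∈ column y ∧ pos y m = c ∧ height G m = e := by
  rcases lt_or_ge e (G.val o) with h | h
  · have hmem : (((2 * c + e - G.val o) / 2, (e - G.val o + 2 - 2 * c) / 2) : ℝ × ℝ) ∈ collar := by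
      refine ⟨abs_lt.2 ⟨?_, ?_⟩, ?_, ?_⟩ <;> simp only <;> linarith
    have hlt := hmem.2.2
    refine ⟨⟨o, _, Or.inr ⟨ho, hmem⟩⟩, mem_column_of_lt_one hy hlt, ?_, ?_⟩
    · rw [pos_of_ge hlt.le]
      simp only
      ring
    · rw [height_of_ge hlt.le]
      simp only
      ring
  · obtain ⟨w, w', hw, hw', h1, h2⟩ := G.exists_val_le_lt_next ho hR h he'
    have hgap : 0 < G.next w - G.val w := by linarith [G.lt_next w]
    obtain ⟨m, hm1, hm2, hm3, hm4, hm5⟩ := pos_branchPoint (r := r) hB (hw.lt.trans_le hw') hc hc'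
      (e := (e - G.val w) / (G.next w - G.val w)) (div_nonneg (by linarith) hgap.le)
      ((div_lt_one hgap).2 (by linarith))
    refine ⟨m, hm2, hm3, ?_⟩
    rw [height_of_le hm5, hm4, hm1, mul_div_cancel₀ _ hgap.ne']
    ring

theorem val_sub_one_lt_height (hR : IsRooted T) {o : T} (ho : IsMin o) (m : Fattening T r) :
    G.val o - 1 < height G m := by
  rcases le_total 1 (m.pt.1 + m.pt.2) with h | h
  · have := (height_bounds (G := G) h).1
    have := G.strictMono.monotone (root_le hR ho m.base)
    linarith
  · have := G.strictMono.monotone (root_le hR ho m.base)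
    rw [height_of_ge h]
    linarith [sum_pos m]

theorem height_lt_of_mem_column {y : T} {m : Fattening T r} (hm : m ∈ column y) :
    height G m < G.val y :=
  (height_lt_next m).trans_le (G.next_le hm.1)

theorem isOpenEmbedding_chart [IsStrictTotalOrder T r] (hB : IsBinary T) (hR : IsRooted T) (y : T) :
    IsOpenEmbedding (fun m : (column y : Set (Fattening T r)) => chart G y m.1) := by
  have hcont : Continuous (fun m : (column y : Set (Fattening T r)) => chart G y m.1) := by
    rw [continuous_iff_continuousAt]
    intro m
    exact (continuousAt_chart G hB m.2.1).comp continuousAt_subtype_val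
  have hemb : IsEmbedding (fun m : (column y : Set (Fattening T r)) => chart G y m.1) := by
    refine ⟨isInducing_iff_nhds.2 fun m => le_antisymm (hcont.tendsto m).le_comap ?_, ?_⟩
    · have : Filter.Tendsto (fun m' : (column y : Set (Fattening T r)) => m'.1)
          (Filter.comap (fun m' : (column y : Set (Fattening T r)) => chart G y m'.1)
            (𝓝 (chart G y m.1))) (𝓝 m.1) := by
        refine tendsto_of_chart G hB hR m.2 (Filter.Eventually.of_forall fun m' => m'.2) ?_ ?_
        · exact (continuousAt_fst (p := chart G y m.1)).tendsto.comp Filter.tendsto_comap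
        · exact (continuousAt_snd (p := chart G y m.1)).tendsto.comp Filter.tendsto_comap
      rw [nhds_subtype_eq_comap]
      exact this.le_comap
    · intro m m' h
      exact Subtype.ext (eq_of_chart_eq G hB hR m.2 m'.2 (congrArg Prod.fst h) (congrArg Prod.snd h))
  refine ⟨hemb, ?_⟩
  obtain ⟨o, ho, -⟩ := id hR
  by_cases h : o < y
  · have himage : range (fun m : (column y : Set (Fattening T r)) => chart G y m.1) =
        Ioo 0 1 ×ˢ Ioo (G.val o - 1) (G.val y) := by
      ext ⟨c, e⟩
      constructor
      · rintro ⟨m, hm⟩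
        rw [← hm]
        exact ⟨m.2.2, val_sub_one_lt_height G hR ho m.1, height_lt_of_mem_column G m.2⟩
      · rintro ⟨⟨h1, h2⟩, h3, h4⟩
        obtain ⟨m, hm, hm1, hm2⟩ := exists_chart_eq (r := r) G hB hR ho h h1 h2 h3 h4
        exact ⟨⟨m, hm⟩, Prod.ext hm1 hm2⟩
    rw [himage]
    exact isOpen_Ioo.prod isOpen_Ioo
  -- Here `y` is the root, which has nothing below it.
  · have : IsEmpty (column y : Set (Fattening T r)) :=
      ⟨fun m => h ((root_le hR ho m.1.base).trans_lt m.2.1)⟩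
    rw [range_eq_empty]
    exact isOpen_empty

end Fattening

/-! ### General topology and ordinals -/

theorem countable_Iio_of_lt_omega_one {α : Ordinal.{u}} (h : α < ω₁) : (Iio α).Countable := by
  rw [← Cardinal.ord_aleph, Cardinal.lt_ord, ← Cardinal.succ_aleph0, Order.lt_succ_iff] at h
  rw [← Cardinal.le_aleph0_iff_set_countable, Cardinal.mk_Iio_ordinal, Cardinal.lift_le_aleph0]
  exact h

theorem isSuccLimit_omega_one : Order.IsSuccLimit (ω₁ : Ordinal.{u}) := by
  rw [← Cardinal.ord_aleph]
  exact Cardinal.isSuccLimit_ord (Cardinal.aleph0_le_aleph 1)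

/-- A Euclidean ball inside the range of the chart is itself homeomorphic to the whole plane. -/
theorem exists_isOpen_homeomorph_of_isOpenEmbedding {X : Type*} [TopologicalSpace X] {D : Set X}
    (hD : IsOpen D) {φ : D → ℝ × ℝ} (hφ : IsOpenEmbedding φ) (x : D) :
    ∃ U : Set X, IsOpen U ∧ x.1 ∈ U ∧ Nonempty (U ≃ₜ EuclideanSpace ℝ (Fin 2)) := by
  let ι : ℝ × ℝ ≃ₜ EuclideanSpace ℝ (Fin 2) :=
    ((EuclideanSpace.equiv (Fin 2) ℝ).toHomeomorph.trans Homeomorph.finTwoArrow).symm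
  have hψ : IsOpenEmbedding (ι ∘ φ) := ι.isOpenEmbedding.comp hφ
  obtain ⟨ε, hε, hball⟩ := Metric.isOpen_iff.1 hψ.isOpen_range (ι (φ x)) ⟨x, rfl⟩
  let g := OpenPartialHomeomorph.univBall (ι (φ x)) ε
  have hg : IsOpenEmbedding g := g.isOpenEmbedding (OpenPartialHomeomorph.univBall_source _ _)
  have hgr : ∀ v, g v ∈ range (ι ∘ φ) := fun v => hball (by
    rw [← OpenPartialHomeomorph.univBall_target _ hε]
    exact g.map_source (by rw [OpenPartialHomeomorph.univBall_source]; trivial))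
  choose k hk using hgr
  have hk' : IsOpenEmbedding k := by
    refine IsOpenEmbedding.of_comp k hψ ?_
    rwa [show (ι ∘ φ) ∘ k = g from funext hk]
  have hk'' : IsOpenEmbedding (fun v => (k v).1) := hD.isOpenEmbedding_subtypeVal.comp hk'
  refine ⟨range fun v => (k v).1, hk''.isOpen_range, ⟨0, ?_⟩, ⟨hk''.isEmbedding.toHomeomorph.symm⟩⟩
  have : k 0 = x := hψ.injective (by
    rw [hk 0]
    exact OpenPartialHomeomorph.univBall_apply_zero _ _)
  simp only [this]

open Classical in
/-- A connected, locally separable metric space is separable. -/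
theorem isSeparable_univ_of_locally {X : Type*} [MetricSpace X] [ConnectedSpace X]
    (h : ∀ x : X, ∃ U ∈ 𝓝 x, TopologicalSpace.IsSeparable U) :
    TopologicalSpace.IsSeparable (univ : Set X) := by
  obtain ⟨x₀⟩ := (inferInstance : Nonempty X)
  -- One enlargement step: add the balls `B(p, ε)` with `p ∈ S` for which `B(p, 4ε)` is separable.
  -- The factor `4` leaves room to cover them by separable balls with centres in a countable dense
  -- set and rational radii.
  let N : Set X → Set X := fun S =>
    ⋃ p ∈ S, ⋃ ε ∈ {ε : ℝ | TopologicalSpace.IsSeparable (Metric.ball p (4 * ε))}, Metric.ball p ε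
  have hN : ∀ S, TopologicalSpace.IsSeparable S → TopologicalSpace.IsSeparable (N S) := by
    rintro S ⟨D, hD, hSD⟩
    have : TopologicalSpace.IsSeparable (⋃ d ∈ D, ⋃ q : ℚ,
        if TopologicalSpace.IsSeparable (Metric.ball d (q : ℝ)) then Metric.ball d (q : ℝ) else ∅) := by
      have := hD.to_subtype
      rw [biUnion_eq_iUnion]
      refine .iUnion fun d => .iUnion fun q => ?_
      split_ifs with hs
      · exact hs
      · exact countable_empty.isSeparable
    refine this.mono ?_
    simp only [N, iUnion_subset_iff]
    intro p hp ε hε x hx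
    have hε0 : 0 < ε := Metric.pos_of_mem_ball hx
    obtain ⟨d, hd, hpd⟩ := Metric.mem_closure_iff.1 (hSD hp) (ε / 2) (by positivity)
    obtain ⟨q, hq1, hq2⟩ := exists_rat_btwn (show 3 * ε / 2 < 2 * ε by linarith)
    have hsub : Metric.ball d (q : ℝ) ⊆ Metric.ball p (4 * ε) :=
      Metric.ball_subset_ball' (by rw [dist_comm]; linarith)
    refine mem_biUnion hd (mem_iUnion.2 ⟨q, ?_⟩)
    rw [if_pos (TopologicalSpace.IsSeparable.mono hε hsub)]
    rw [Metric.mem_ball] at hx ⊢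
    linarith [dist_triangle x p d]
  let S : ℕ → Set X := fun n => N^[n] {x₀}
  have hS : ∀ n, TopologicalSpace.IsSeparable (S n) := by
    intro n
    induction n with
    | zero => exact (countable_singleton x₀).isSeparable
    | succ n ih =>
      simp only [S, Function.iterate_succ_apply']
      exact hN _ ih
  have hmem : ∀ {n p ε x}, p ∈ S n → TopologicalSpace.IsSeparable (Metric.ball p (4 * ε)) →
      x ∈ Metric.ball p ε → x ∈ ⋃ n, S n := by
    intro n p ε x hp hε hx
    refine mem_iUnion.2 ⟨n + 1, ?_⟩
    simp only [S, Function.iterate_succ_apply']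
    exact mem_biUnion hp (mem_biUnion hε hx)
  have hloc : ∀ x : X, ∃ ε > 0, TopologicalSpace.IsSeparable (Metric.ball x (8 * ε)) := fun x => by
    obtain ⟨U, hU, hUs⟩ := h x
    obtain ⟨ε, hε, hball⟩ := Metric.mem_nhds_iff.1 hU
    exact ⟨ε / 8, by positivity, hUs.mono (by rwa [mul_div_cancel₀ _ (by norm_num)])⟩
  -- If `B(q, 8ε)` is separable and `p` is a point of the union within `ε` of `q`, then `B(p, 4ε)`
  -- is separable too, so the next enlargement contains `q`.
  have hclopen : IsClopen (⋃ n, S n) := by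
    constructor
    · rw [← closure_subset_iff_isClosed]
      intro q hq
      obtain ⟨ε, hε, hs⟩ := hloc q
      obtain ⟨p, hp, hqp⟩ := Metric.mem_closure_iff.1 hq ε hε
      obtain ⟨n, hp⟩ := mem_iUnion.1 hp
      refine hmem hp (hs.mono (Metric.ball_subset_ball' ?_)) hqp
      rw [dist_comm]
      linarith
    · rw [Metric.isOpen_iff]
      intro p hp
      obtain ⟨n, hp⟩ := mem_iUnion.1 hp
      obtain ⟨ε, hε, hs⟩ := hloc p
      exact ⟨ε, hε, fun x hx =>
        hmem hp (hs.mono (Metric.ball_subset_ball (by linarith))) hx⟩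
  rw [← hclopen.eq_univ ⟨x₀, mem_iUnion.2 ⟨0, rfl⟩⟩]
  exact .iUnion hS

/-! ### Countable initial parts of an `ω₁`-tree -/

namespace IsSetTree

variable {T : Type u} [PartialOrder T] [IsSetTree T]

theorem ht_covBy {x y : T} (h : x ⋖ y) : ht y ≤ ht x + 1 := by
  by_contra! hlt
  obtain ⟨z, hz, hzx⟩ := exists_lt_ht_eq hlt
  have h1 := ht_strictMono.monotone (le_of_lt_of_covBy hz h)
  rw [hzx] at h1
  exact (lt_add_one (ht x)).not_ge h1

theorem countable_ht_le (hT : IsOmegaOneTree T) {α : Ordinal.{u}} (h : α < ω₁) :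
    {x : T | ht x ≤ α}.Countable := by
  have : {x : T | ht x ≤ α} = ⋃ β ∈ Iio (α + 1), level T β := by
    ext x
    simp [level, Order.lt_add_one_iff]
  rw [this]
  exact (countable_Iio_of_lt_omega_one
    (isSuccLimit_omega_one.add_one_lt h)).biUnion fun β _ => hT.2 β

end IsSetTree

namespace Fattening

variable {T : Type u} [PartialOrder T] [IsSetTree T] {r : T → T → Prop}

/-! ### The fattening is a Hausdorff locally Euclidean space -/

theorem IsLeft.eq [IsStrictTotalOrder T r] (hB : IsBinary T) {x y y' : T} (h : IsLeft r x y)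
    (h' : IsLeft r x y') : y = y' := by
  obtain ⟨a, b, hab, hs⟩ := exists_children (r := r) hB x
  have key : ∀ {c}, IsLeft r x c → c = a := by
    rintro c ⟨hc, d, hd, hr⟩
    have m1 : c ∈ ({a, b} : Set T) := hs ▸ hc
    have m2 : d ∈ ({a, b} : Set T) := hs ▸ hd
    rcases m1 with rfl | rfl
    · rfl
    · rcases m2 with rfl | rfl
      · exact (asymm_of r hr hab).elim
      · exact (irrefl_of r _ hr).elim
  rw [key h, key h']

theorem IsRight.eq [IsStrictTotalOrder T r] (hB : IsBinary T) {x y y' : T} (h : IsRight r x y)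
    (h' : IsRight r x y') : y = y' := by
  obtain ⟨a, b, hab, hs⟩ := exists_children (r := r) hB x
  have key : ∀ {c}, IsRight r x c → c = b := by
    rintro c ⟨hc, d, hd, hr⟩
    have m1 : c ∈ ({a, b} : Set T) := hs ▸ hc
    have m2 : d ∈ ({a, b} : Set T) := hs ▸ hd
    rcases m1 with rfl | rfl
    · rcases m2 with rfl | rfl
      · exact (irrefl_of r _ hr).elim
      · exact (asymm_of r hr hab).elim
    · rfl
  rw [key h, key h']

theorem not_le_of_covBy {x y y' : T} (h : x ⋖ y) (h' : x ⋖ y') (hne : y ≠ y') : ¬ y ≤ y' :=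
  fun hle => hne (hle.eq_or_lt.resolve_right fun hlt => h'.2 h.lt hlt)

/-- The part of `M_T` above an immediate successor `y` of `z`, with an open half of the triangle
of `z` on the side of `y`. -/
def upper (r : T → T → Prop) (z y : T) : Set (Fattening T r) :=
  {m | y ≤ m.base ∨ m.base = z ∧ 1 < m.pt.1 + m.pt.2 ∧
    (IsLeft r z y ∧ m.pt.1 < m.pt.2 ∨ IsRight r z y ∧ m.pt.2 < m.pt.1)}

/-- The half triangle is what makes the bottom side of the piece of `y` interior: in the arm towards
`y`, a point within `1 / 2` of the top has its longitudinal coordinate above `1` and its transversal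
one below `1`, so it is strictly on the side of `y` of the diagonal. -/
theorem isOpen_upper {z y : T} (h : z ⋖ y) : IsOpen (upper r z y) := by
  rw [isOpen_iff_localNhd]
  rintro m (hm | ⟨hm, hs, hlr⟩)
  · refine ⟨⟨univ, Filter.univ_mem, fun m' hm' _ => Or.inl (hm' ▸ hm)⟩, fun hb w hw => ?_,
      fun hb hlim => ?_⟩
    · refine ⟨1 / 2, by norm_num, fun p hp hp' hmax => ?_⟩
      rcases hm.eq_or_lt with heq | hlt
      · obtain rfl : w = z := eq_of_covBy hw (heq ▸ h)
        subst hp heq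
        rcases mem_strip_iff.1 hp' with ⟨⟨y', hy', h1⟩, h2, -⟩ | ⟨⟨y', hy', h1⟩, h2, -⟩
        · obtain rfl := eq_of_covBy_of_le h1.1 h hy' le_rfl
          have : 1 < p.pt.2 := by
            rcases lt_max_iff.1 hmax with h3 | h3
            · linarith [h2.2.1]
            · linarith
          exact Or.inr ⟨rfl, by linarith [h2.1], Or.inl ⟨h1, by linarith [h2.2.1]⟩⟩
        · obtain rfl := eq_of_covBy_of_le h1.1 h hy' le_rfl
          have : 1 < p.pt.1 := by
            rcases lt_max_iff.1 hmax with h3 | h3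
            · linarith
            · linarith [h2.2.1]
          exact Or.inr ⟨rfl, by linarith [h2.1], Or.inr ⟨h1, by linarith [h2.2.1]⟩⟩
      · exact Or.inl (hp ▸ le_of_lt_of_covBy hlt hw)
    · have hlt : y < m.base := hm.lt_of_ne fun heq => hlim.2 z (heq ▸ h)
      exact ⟨y, hlt, 1, one_pos, fun p hp _ _ => Or.inl hp.le⟩
  · refine ⟨?_, fun hb => by linarith, fun hb => by linarith⟩
    refine ⟨{q | 1 < q.1 + q.2 ∧
      (IsLeft r z y ∧ q.1 < q.2 ∨ IsRight r z y ∧ q.2 < q.1)}, ?_, fun m' hm' hq =>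
        Or.inr ⟨hm'.trans hm, hq⟩⟩
    have h1 : ∀ᶠ q : ℝ × ℝ in 𝓝 m.pt, 1 < q.1 + q.2 :=
      (continuous_fst.add continuous_snd).continuousAt.eventually_const_lt hs
    rcases hlr with ⟨hl, h2⟩ | ⟨hl, h2⟩
    · filter_upwards [h1, continuousAt_fst.eventually_lt continuousAt_snd h2] with q hq hq'
      exact ⟨hq, Or.inl ⟨hl, hq'⟩⟩
    · filter_upwards [h1, continuousAt_snd.eventually_lt continuousAt_fst h2] with q hq hq'
      exact ⟨hq, Or.inr ⟨hl, hq'⟩⟩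

theorem disjoint_upper [IsStrictTotalOrder T r] (hB : IsBinary T) {z y z' y' : T} (h : z ⋖ y)
    (h' : z' ⋖ y') (h1 : ¬ y ≤ y') (h2 : ¬ y' ≤ y) : Disjoint (upper r z y) (upper r z' y') := by
  rw [disjoint_left]
  rintro m (hm | ⟨hm, hs, hlr⟩) (hm' | ⟨hm', hs', hlr'⟩)
  · rcases le_or_lt_of_le hm hm' with h3 | h3
    · exact h1 h3
    · exact h2 h3.le
  · exact h1 ((hm.trans_eq hm').trans h'.lt.le)
  · exact h2 ((hm'.trans_eq hm).trans h.lt.le)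
  · obtain rfl : z = z' := hm.symm.trans hm'
    rcases hlr with ⟨hl, h3⟩ | ⟨hl, h3⟩ <;> rcases hlr' with ⟨hl', h4⟩ | ⟨hl', h4⟩
    · exact h1 (IsLeft.eq hB hl hl').le
    · linarith
    · linarith
    · exact h1 (IsRight.eq hB hl hl').le

/-- The branch of `q` passes through the piece of `p`, yet `p` is not in the arm that it uses. So
`p` lies in the rectangle of the opposite arm and is caught by `upper` of the other successor. -/
theorem exists_separation_of_lt [IsStrictTotalOrder T r] (hB : IsBinary T) {p q : Fattening T r}
    (hlt : p.base < q.base) (hpq : ∀ y, p ∈ column y → q ∈ column y → False) :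
    ∃ z y z' y', z ⋖ y ∧ z' ⋖ y' ∧ ¬ y ≤ y' ∧ ¬ y' ≤ y ∧ p ∈ upper r z y ∧ q ∈ upper r z' y' := by
  obtain ⟨y₁, hy₁, hq⟩ := exists_mem_column hB q
  have hp : p ∉ column y₁ := fun hp => hpq y₁ hp hq
  have hpy : p.base < y₁ := hlt.trans hy₁.lt
  have hs : 1 < p.pt.1 + p.pt.2 := by
    by_contra! hle
    rcases hle.eq_or_lt with h | h
    · exact hp (mem_column_of_eq_one hpy h)
    · exact hp (mem_column_of_lt_one hpy h)
  have hpiece := (one_le_iff p).1 hs.le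
  obtain ⟨b1, b2, b3, b4, b5, b6⟩ := piece_bounds hpiece
  obtain ⟨y, hy, hyq⟩ := exists_covBy_le hlt
  rcases isLeft_or_isRight (r := r) hB hy with hl | hl
  · obtain ⟨y', hy'⟩ := exists_isRight (r := r) hB p.base
    have hne : y' ≠ y := fun h => not_isRight_of_isLeft hB hl (h ▸ hy')
    have h1 : p.pt ∉ leftArm := fun h =>
      hp (mem_column_of_leftArm ⟨y, hyq.trans hy₁.lt.le, hl⟩ h)
    rw [mem_leftArm_iff hpiece, not_and, not_lt] at h1
    have h2 := h1 b1
    have h3 : p.pt.2 < 1 := (min_lt_iff.1 b6).resolve_left h2.not_gt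
    exact ⟨p.base, y', p.base, y, hy'.1, hy, not_le_of_covBy hy'.1 hy hne,
      not_le_of_covBy hy hy'.1 hne.symm, Or.inr ⟨rfl, hs, Or.inr ⟨hy', by linarith⟩⟩, Or.inl hyq⟩
  · obtain ⟨y', hy'⟩ := exists_isLeft (r := r) hB p.base
    have hne : y' ≠ y := fun h => not_isRight_of_isLeft hB hy' (h ▸ hl)
    have h1 : p.pt ∉ rightArm := fun h =>
      hp (mem_column_of_rightArm hB ⟨y, hyq.trans hy₁.lt.le, hl⟩ h)
    rw [mem_rightArm_iff hpiece, not_and, not_lt] at h1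
    have h2 := h1 b2
    have h3 : p.pt.1 < 1 := (min_lt_iff.1 b6).resolve_right h2.not_gt
    exact ⟨p.base, y', p.base, y, hy'.1, hy, not_le_of_covBy hy'.1 hy hne,
      not_le_of_covBy hy hy'.1 hne.symm, Or.inr ⟨rfl, hs, Or.inl ⟨hy', by linarith⟩⟩, Or.inl hyq⟩

/-- A point of the piece missing one arm lies in the rectangle of the other, strictly on one side of
the diagonal. -/
theorem exists_separation_of_eq [IsStrictTotalOrder T r] (hB : IsBinary T) {p q : Fattening T r}
    (heq : p.base = q.base) (hp : p.pt ∉ leftArm) (hq : q.pt ∉ rightArm)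
    (hpp : 1 ≤ p.pt.1 + p.pt.2) (hqq : 1 ≤ q.pt.1 + q.pt.2) :
    ∃ z y z' y', z ⋖ y ∧ z' ⋖ y' ∧ ¬ y ≤ y' ∧ ¬ y' ≤ y ∧ p ∈ upper r z y ∧ q ∈ upper r z' y' := by
  obtain ⟨y, hy⟩ := exists_isRight (r := r) hB p.base
  obtain ⟨y', hy'⟩ := exists_isLeft (r := r) hB p.base
  have hne : y ≠ y' := fun h => not_isRight_of_isLeft hB hy' (h ▸ hy)
  rw [one_le_iff] at hpp hqq
  obtain ⟨b1, b2, b3, b4, b5, b6⟩ := piece_bounds hpp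
  obtain ⟨c1, c2, c3, c4, c5, c6⟩ := piece_bounds hqq
  rw [mem_leftArm_iff hpp, not_and, not_lt] at hp
  rw [mem_rightArm_iff hqq, not_and, not_lt] at hq
  have h2 := hp b1
  have h3 : p.pt.2 < 1 := (min_lt_iff.1 b6).resolve_left h2.not_gt
  have h4 := hq c2
  have h5 : q.pt.1 < 1 := (min_lt_iff.1 c6).resolve_right h4.not_gt
  exact ⟨p.base, y, p.base, y', hy.1, hy'.1, not_le_of_covBy hy.1 hy'.1 hne,
    not_le_of_covBy hy'.1 hy.1 hne.symm, Or.inr ⟨rfl, by linarith, Or.inr ⟨hy, by linarith⟩⟩,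
    Or.inr ⟨heq.symm, by linarith, Or.inl ⟨hy', by linarith⟩⟩⟩

/-- In a common column the chart separates. Otherwise, comparable bases force the points into
different arms of a piece, while incomparable bases lie above incomparable successors because the
tree is Hausdorff. -/
theorem t2Space [IsStrictTotalOrder T r] (hG : Nonempty (TreeHeight T)) (hB : IsBinary T)
    (hR : IsRooted T) (hH : IsHausdorff T) : T2Space (Fattening T r) := by
  refine ⟨fun p q hpq => ?_⟩
  have fin : (∃ z y z' y', z ⋖ y ∧ z' ⋖ y' ∧ ¬ y ≤ y' ∧ ¬ y' ≤ y ∧ p ∈ upper r z y ∧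
      q ∈ upper r z' y') → ∃ u v : Set (Fattening T r), IsOpen u ∧ IsOpen v ∧ p ∈ u ∧ q ∈ v ∧
        Disjoint u v := by
    rintro ⟨z, y, z', y', h1, h2, h3, h4, h5, h6⟩
    exact ⟨_, _, isOpen_upper h1, isOpen_upper h2, h5, h6, disjoint_upper hB h1 h2 h3 h4⟩
  by_cases hc : ∃ y, p ∈ column y ∧ q ∈ column y
  · obtain ⟨G⟩ := hG
    obtain ⟨y, hp, hq⟩ := hc
    have hne : chart G y p ≠ chart G y q := fun h =>
      hpq (eq_of_chart_eq G hB hR hp hq (congrArg Prod.fst h) (congrArg Prod.snd h))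
    obtain ⟨u, v, hu, hv, hpu, hqv, huv⟩ := t2_separation hne
    refine ⟨_, _, isOpen_chart_preimage G hB y hu, isOpen_chart_preimage G hB y hv,
      ⟨hp.1, hpu⟩, ⟨hq.1, hqv⟩, ?_⟩
    rw [disjoint_left] at huv ⊢
    exact fun m hm hm' => huv hm.2 hm'.2
  · have hc' : ∀ y, p ∈ column y → q ∈ column y → False := fun y h1 h2 => hc ⟨y, h1, h2⟩
    apply fin
    by_cases h1 : p.base ≤ q.base
    · rcases h1.eq_or_lt with heq | hlt
      · obtain ⟨y₁, hy₁⟩ := exists_isLeft (r := r) hB p.base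
        obtain ⟨y₂, hy₂⟩ := exists_isRight (r := r) hB p.base
        obtain ⟨y₃, hy₃, hq₃⟩ := exists_mem_column hB q
        obtain ⟨y₄, hy₄, hp₄⟩ := exists_mem_column hB p
        have hp : 1 ≤ p.pt.1 + p.pt.2 := by
          by_contra! h
          exact hc' y₃ (mem_column_of_lt_one (heq ▸ hy₃.lt) h) hq₃
        have hq : 1 ≤ q.pt.1 + q.pt.2 := by
          by_contra! h
          exact hc' y₄ hp₄ (mem_column_of_lt_one (heq ▸ hy₄.lt) h)
        by_cases h2 : p.pt ∈ leftArm
        · have h3 : q.pt ∉ leftArm := fun h3 => hc' y₁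
            (mem_column_of_leftArm ⟨y₁, le_rfl, hy₁⟩ h2)
            (mem_column_of_leftArm ⟨y₁, le_rfl, heq ▸ hy₁⟩ h3)
          have h4 : p.pt ∉ rightArm := fun h4 => hc' y₂
            (mem_column_of_rightArm hB ⟨y₂, le_rfl, hy₂⟩ h4)
            (mem_column_of_rightArm hB ⟨y₂, le_rfl, heq ▸ hy₂⟩
              (((one_le_iff q).1 hq).resolve_left h3))
          obtain ⟨z, y, z', y', k1, k2, k3, k4, k5, k6⟩ :=
            exists_separation_of_eq (r := r) hB heq.symm h3 h4 hq hp
          exact ⟨z', y', z, y, k2, k1, k4, k3, k6, k5⟩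
        · have h3 : q.pt ∉ rightArm := fun h4 => hc' y₂
            (mem_column_of_rightArm hB ⟨y₂, le_rfl, hy₂⟩ (((one_le_iff p).1 hp).resolve_left h2))
            (mem_column_of_rightArm hB ⟨y₂, le_rfl, heq ▸ hy₂⟩ h4)
          exact exists_separation_of_eq hB heq h2 h3 hp hq
      · exact exists_separation_of_lt hB hlt hc'
    · by_cases h2 : q.base ≤ p.base
      · have hlt : q.base < p.base := h2.lt_of_not_ge h1
        obtain ⟨z, y, z', y', k1, k2, k3, k4, k5, k6⟩ :=
          exists_separation_of_lt hB hlt fun y h3 h4 => hc' y h4 h3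
        exact ⟨z', y', z, y, k2, k1, k4, k3, k6, k5⟩
      · obtain ⟨z, y, z', y', k1, k2, k3, k4, k5, k6⟩ := exists_incomparable_succ hR hH h1 h2
        exact ⟨z, y, z', y', k1, k3, k5, k6, Or.inl k2, Or.inl k4⟩

/-! ### Size -/

theorem secondCountable_column [IsStrictTotalOrder T r] (hG : Nonempty (TreeHeight T))
    (hB : IsBinary T) (hR : IsRooted T) (y : T) :
    SecondCountableTopology (column y : Set (Fattening T r)) := by
  obtain ⟨G⟩ := hG
  exact (isOpenEmbedding_chart (r := r) G hB hR y).isEmbedding.secondCountableTopology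

theorem isOpen_ht_lt (α : Ordinal.{u}) : IsOpen {m : Fattening T r | ht m.base < α} := by
  rw [isOpen_iff_localNhd]
  intro m hm
  have hm : ht m.base < α := hm
  refine ⟨⟨univ, Filter.univ_mem, fun m' hm' _ => ?_⟩, fun hb z hz => ⟨1, one_pos, fun p hp _ _ => ?_⟩,
    fun hb hlim => ?_⟩
  · show ht m'.base < α
    rwa [hm']
  · show ht p.base < α
    rw [hp]
    exact (ht_strictMono hz.lt).trans hm
  · obtain ⟨z, hz⟩ := not_isMin_iff.1 hlim.1
    exact ⟨z, hz, 1, one_pos, fun p _ hp _ => (ht_strictMono hp).trans hm⟩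

/-- The only possible new limit points are on bottom sides of pieces at height `α`: all other points
of height at least `α` form the open set `B`. -/
theorem closure_ht_lt_subset (α : Ordinal.{u}) :
    closure {m : Fattening T r | ht m.base < α} ⊆ {m | ht m.base < α + 1} := by
  let B : Set (Fattening T r) := {m | α < ht m.base ∨ α = ht m.base ∧ 1 < m.pt.1 + m.pt.2 ∨
    α = ht m.base ∧ m.pt.1 + m.pt.2 < 1}
  have hB : IsOpen B := by
    rw [isOpen_iff_localNhd]
    intro m hm
    by_cases hα : α < ht m.base
    · refine ⟨⟨univ, Filter.univ_mem, fun m' hm' _ => Or.inl (hm' ▸ hα)⟩, fun hb z hz => ?_,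
        fun hb hlim => ?_⟩
      · refine ⟨1 / 2, by norm_num, fun p hp hp' hmax => ?_⟩
        obtain ⟨w, hw, rfl⟩ := exists_lt_ht_eq hα
        have h1 := ht_strictMono.monotone (le_of_lt_of_covBy hw hz)
        rw [← hp] at h1
        rcases h1.eq_or_lt with h1 | h1
        · refine Or.inr (Or.inl ⟨h1, ?_⟩)
          have hpp : p.pt ∈ piece := by
            rcases mem_strip_iff.1 hp' with ⟨-, h2, -⟩ | ⟨-, h2, -⟩
            · exact Or.inl h2
            · exact Or.inr h2
          obtain ⟨b1, b2, b3, b4, b5, b6⟩ := piece_bounds hpp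
          rcases lt_max_iff.1 hmax with h3 | h3 <;> linarith
        · exact Or.inl h1
      · obtain ⟨w, hw, rfl⟩ := exists_lt_ht_eq hα
        exact ⟨w, hw, 1, one_pos, fun p hp _ _ => Or.inl (ht_strictMono hp)⟩
    · have hne : α = ht m.base ∧ m.pt.1 + m.pt.2 ≠ 1 := by
        rcases hm with h | h | h
        · exact (hα h).elim
        · exact ⟨h.1, h.2.ne'⟩
        · exact ⟨h.1, h.2.ne⟩
      refine ⟨⟨{q | q.1 + q.2 ≠ 1}, ?_, fun m' hm' hq => ?_⟩, fun hb => (hne.2 hb).elim,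
        fun hb => (hne.2 hb).elim⟩
      · exact (continuous_fst.add continuous_snd).continuousAt.eventually_ne hne.2
      · rcases lt_or_gt_of_ne hq with h | h
        · exact Or.inr (Or.inr ⟨hm' ▸ hne.1, h⟩)
        · exact Or.inr (Or.inl ⟨hm' ▸ hne.1, h⟩)
  have hsub : closure {m : Fattening T r | ht m.base < α} ⊆ Bᶜ := by
    refine closure_minimal (fun m hm hm' => ?_) hB.isClosed_compl
    have hm : ht m.base < α := hm
    rcases hm' with h | h | h
    · exact hm.not_gt h
    · exact hm.ne' h.1
    · exact hm.ne' h.1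
  intro m hm
  have h := hsub hm
  show ht m.base < α + 1
  rw [Order.lt_add_one_iff]
  by_contra! hlt
  exact h (Or.inl hlt)

/-- A point of the closure lies in the column of a successor of its base, at height at most `α + 1`.
There are countably many such columns, all second countable. -/
theorem isTypeI [IsStrictTotalOrder T r] (hT : IsOmegaOneTree T) (hG : Nonempty (TreeHeight T))
    (hB : IsBinary T) (hR : IsRooted T) : IsTypeI (Fattening T r) := by
  refine ⟨fun α => {m | ht m.base < α}, ?_, fun α hα => ⟨isOpen_ht_lt α, ?_⟩, fun α β hαβ hβ => ?_⟩
  · refine eq_univ_of_forall fun m => ?_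
    exact mem_biUnion (isSuccLimit_omega_one.add_one_lt (ht_lt_omega_one hT m.base))
      (lt_add_one (ht m.base))
  · have hα' : α + 1 < ω₁ := isSuccLimit_omega_one.add_one_lt hα
    have hcov : closure {m : Fattening T r | ht m.base < α} =
        ⋃ y ∈ {y : T | ht y ≤ α + 1}, closure {m : Fattening T r | ht m.base < α} ∩ column y := by
      ext m
      constructor
      · intro hm
        obtain ⟨y, hy, hmy⟩ := exists_mem_column hB m
        refine mem_biUnion (show ht y ≤ α + 1 from ?_) ⟨hm, hmy⟩
        have h1 : ht m.base < α + 1 := closure_ht_lt_subset α hm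
        exact (ht_covBy hy).trans (Order.add_one_le_of_lt h1)
      · simp only [mem_iUnion]
        rintro ⟨y, -, hm, -⟩
        exact hm
    rw [hcov]
    refine (countable_ht_le hT hα').isLindelof_biUnion fun y _ => ?_
    have := secondCountable_column (r := r) hG hB hR y
    rw [inter_comm, ← Subtype.image_preimage_val]
    exact (HereditarilyLindelofSpace.isLindelof _).image continuous_subtype_val
  · refine (closure_ht_lt_subset α).trans fun m hm => ?_
    have hm : ht m.base < α + 1 := hm
    exact hm.trans_le (Order.add_one_le_of_lt hαβ)

theorem not_metrizableSpace [IsStrictTotalOrder T r] [ConnectedSpace (Fattening T r)]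
    (hT : IsOmegaOneTree T) (hG : Nonempty (TreeHeight T)) (hB : IsBinary T) (hR : IsRooted T) :
    ¬ TopologicalSpace.MetrizableSpace (Fattening T r) := by
  intro hM
  let _ := TopologicalSpace.metrizableSpaceMetric (Fattening T r)
  have hsep : TopologicalSpace.IsSeparable (univ : Set (Fattening T r)) := by
    refine isSeparable_univ_of_locally fun m => ?_
    obtain ⟨y, -, hy⟩ := exists_mem_column hB m
    have := secondCountable_column (r := r) hG hB hR y
    exact ⟨column y, (isOpen_column hG hB y).mem_nhds hy, .of_subtype _⟩
  have : TopologicalSpace.SeparableSpace (Fattening T r) :=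
    TopologicalSpace.isSeparable_univ_iff.1 hsep
  have : SecondCountableTopology (Fattening T r) := UniformSpace.secondCountable_of_separable _
  obtain ⟨Y, hY, hcov⟩ := TopologicalSpace.isOpen_iUnion_countable
    (fun y : T => (column y : Set (Fattening T r))) fun y => isOpen_column hG hB y
  have := hY.to_subtype
  -- A countable supremum of countable ordinals is countable. A tree point at this height is below
  -- no member of `Y`, so its piece misses all the chosen columns.
  have hsup : ⨆ y : Y, ht y.1 < ω₁ := Ordinal.iSup_lt_omega_one fun y => ht_lt_omega_one hT y.1
  obtain ⟨x, hx⟩ := exists_ht_eq hT hsup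
  let m : Fattening T r := ⟨x, (1 / 2, 1 / 2), by norm_num [piece, leftArm]⟩
  obtain ⟨y, -, hy⟩ := exists_mem_column hB m
  have hm : m ∈ ⋃ y ∈ Y, (column y : Set (Fattening T r)) := by
    rw [hcov]
    exact mem_iUnion.2 ⟨y, hy⟩
  simp only [mem_iUnion] at hm
  obtain ⟨w, hw, hmw⟩ := hm
  have h1 : ht x < ht w := ht_strictMono hmw.1
  have h2 : ht w ≤ ⨆ y : Y, ht y.1 := Ordinal.le_iSup (fun y : Y => ht y.1) ⟨w, hw⟩
  rw [hx] at h1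
  exact h1.not_ge h2

end Fattening

namespace Fattening

variable {T : Type u} [PartialOrder T] [IsSetTree T] {r : T → T → Prop}

open RoadSpace

/-! ### The inclusion of the road space is an embedding -/

theorem inclusion_node_base (x : T) : (inclusion r (node x)).base = x := rfl

theorem inclusion_node_pt (x : T) : (inclusion r (node x)).pt = (1 / 2, 1 / 2) := rfl

theorem inclusion_road_base {x y : T} (h : x ⋖ y) (t : Ioo (0 : ℝ) 1) :
    (inclusion r (road x y h t)).base = x := by
  unfold inclusion
  simp only
  split_ifs <;> rfl

theorem inclusion_road_pt_left {x y : T} (h : x ⋖ y) (t : Ioo (0 : ℝ) 1) (hl : IsLeft r x y) :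
    (inclusion r (road x y h t)).pt = (1 / 2, 1 / 2 + (t : ℝ)) := by
  simp only [inclusion, hl, if_true]

theorem inclusion_road_pt_right {x y : T} (h : x ⋖ y) (t : Ioo (0 : ℝ) 1) (hl : ¬ IsLeft r x y) :
    (inclusion r (road x y h t)).pt = (1 / 2 + (t : ℝ), 1 / 2) := by
  simp only [inclusion, hl, if_false]

theorem inclusion_road_pt {x y : T} (h : x ⋖ y) (t : Ioo (0 : ℝ) 1) :
    (IsLeft r x y ∧ (inclusion r (road x y h t)).pt = (1 / 2, 1 / 2 + (t : ℝ))) ∨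
    (¬ IsLeft r x y ∧ (inclusion r (road x y h t)).pt = (1 / 2 + (t : ℝ), 1 / 2)) := by
  by_cases hl : IsLeft r x y
  · exact Or.inl ⟨hl, inclusion_road_pt_left h t hl⟩
  · exact Or.inr ⟨hl, inclusion_road_pt_right h t hl⟩

theorem inclusion_road_sum {x y : T} (h : x ⋖ y) (t : Ioo (0 : ℝ) 1) :
    (inclusion r (road x y h t)).pt.1 + (inclusion r (road x y h t)).pt.2 = 1 + t := by
  rcases inclusion_road_pt (r := r) h t with ⟨-, h⟩ | ⟨-, h⟩ <;> rw [h] <;> simp only <;> ring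

theorem inclusion_injective [IsStrictTotalOrder T r] (hB : IsBinary T) :
    Function.Injective (inclusion r : RoadSpace T → Fattening T r) := by
  have hnr : ∀ (x' x y : T) (h : x ⋖ y) (t : Ioo (0 : ℝ) 1),
      inclusion r (node x') ≠ inclusion r (road x y h t) := by
    intro x' x y h t heq
    have h1 := inclusion_road_sum (r := r) h t
    rw [← heq, inclusion_node_pt] at h1
    have := t.2.1
    norm_num at h1
    linarith
  rintro (x | ⟨x, y, h, t⟩) (x' | ⟨x', y', h', t'⟩) heq
  · exact congrArg node (congrArg base heq)
  · exact (hnr _ _ _ _ _ heq).elim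
  · exact (hnr _ _ _ _ _ heq.symm).elim
  · have h1 := congrArg base heq
    rw [inclusion_road_base, inclusion_road_base] at h1
    subst h1
    have h2 := congrArg (fun m : Fattening T r => m.pt.1 + m.pt.2) heq
    simp only [inclusion_road_sum] at h2
    have h3 : t = t' := Subtype.ext (by linarith)
    subst h3
    have h4 := congrArg pt heq
    have ht := t.2.1
    have hne : ((1 / 2, 1 / 2 + (t : ℝ)) : ℝ × ℝ) ≠ (1 / 2 + (t : ℝ), 1 / 2) := fun h5 => by
      have := congrArg Prod.fst h5
      simp only at this
      linarith
    rcases inclusion_road_pt (r := r) h t with ⟨h5, h6⟩ | ⟨h5, h6⟩ <;>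
      rcases inclusion_road_pt (r := r) h' t with ⟨h7, h8⟩ | ⟨h7, h8⟩ <;> rw [h6, h8] at h4
    · obtain rfl := IsLeft.eq hB h5 h7
      rfl
    · exact (hne h4).elim
    · exact (hne h4.symm).elim
    · obtain rfl := IsRight.eq hB ((isLeft_or_isRight hB h).resolve_left h5)
        ((isLeft_or_isRight hB h').resolve_left h7)
      rfl

/-- A road on the branch towards `x` runs along the axis of the strip. The other road leaves the
axis at speed `1`, so it stays in the strip while `t < ε`, and in the triangle common to both arms
while `t < 1 / 2`. -/
theorem inclusion_road_mem_strip [IsStrictTotalOrder T r] (hB : IsBinary T) {a b x : T} (h : a ⋖ b)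
    (hx : a < x) (t : Ioo (0 : ℝ) 1) {ε : ℝ} (hε : 0 < ε) (hbt : b ≤ x ∨ (t : ℝ) < min ε (1 / 2)) :
    (inclusion r (road a b h t)).pt ∈ strip r a x (1 / 2, 1 / 2) ε := by
  have h0 := t.2.1
  have h1 := t.2.2
  have hsmall : (t : ℝ) < min ε (1 / 2) → (t : ℝ) < ε ∧ (t : ℝ) < 1 / 2 := lt_min_iff.1
  have habs : |(1 / 2 : ℝ) + t - 1 / 2| = t := by
    rw [add_sub_cancel_left, abs_of_pos h0]
  have hL : ((1 / 2, 1 / 2 + (t : ℝ)) : ℝ × ℝ) ∈ leftArm :=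
    ⟨by norm_num, by norm_num, by simp only; linarith, by simp only; linarith⟩
  have hR : ((1 / 2 + (t : ℝ), 1 / 2) : ℝ × ℝ) ∈ rightArm :=
    ⟨by norm_num, by norm_num, by simp only; linarith, by simp only; linarith⟩
  have hL' : (t : ℝ) < 1 / 2 → ((1 / 2, 1 / 2 + (t : ℝ)) : ℝ × ℝ) ∈ rightArm := fun ht =>
    ⟨by simp only; linarith, by simp only; linarith, hL.2.2.1, by norm_num⟩
  have hR' : (t : ℝ) < 1 / 2 → ((1 / 2 + (t : ℝ), 1 / 2) : ℝ × ℝ) ∈ leftArm := fun ht =>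
    ⟨by simp only; linarith, by simp only; linarith, hR.2.2.1, by norm_num⟩
  rw [mem_strip_iff]
  rcases inclusion_road_pt (r := r) h t with ⟨hl, hp⟩ | ⟨hl, hp⟩
  · rw [hp]
    rcases hbt with hb | ht
    · exact Or.inl ⟨⟨b, hb, hl⟩, hL, by simpa using hε⟩
    · obtain ⟨ht1, ht2⟩ := hsmall ht
      rcases turnsLeft_or_turnsRight (r := r) hB hx with h' | h'
      · exact Or.inl ⟨h', hL, by simpa using hε⟩
      · exact Or.inr ⟨h', hL' ht2, by simp only; rwa [habs]⟩
  · rw [hp]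
    rcases hbt with hb | ht
    · exact Or.inr ⟨⟨b, hb, (isLeft_or_isRight hB h).resolve_left hl⟩, hR, by simpa using hε⟩
    · obtain ⟨ht1, ht2⟩ := hsmall ht
      rcases turnsLeft_or_turnsRight (r := r) hB hx with h' | h'
      · exact Or.inl ⟨h', hR' ht2, by simp only; rwa [habs]⟩
      · exact Or.inr ⟨h', hR, by simpa using hε⟩

theorem continuous_inclusion [IsStrictTotalOrder T r] (hB : IsBinary T) :
    Continuous (inclusion r : RoadSpace T → Fattening T r) := by
  refine ⟨fun U hU => ?_⟩
  obtain ⟨h1, h2, h3⟩ := hU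
  refine ⟨fun x y h => ?_, fun x hx => ?_, fun z x h hx => ?_, fun x hlim hx => ?_⟩
  · obtain ⟨V, hV, hVU⟩ := h1 x
    have : {t | road x y h t ∈ inclusion r ⁻¹' U} =
        (fun t => (inclusion r (road x y h t)).pt) ⁻¹' V := by
      ext t
      exact hVU _ (inclusion_road_base h t)
    rw [this]
    refine hV.preimage ?_
    by_cases hl : IsLeft r x y
    · simp only [inclusion_road_pt_left h _ hl]
      fun_prop
    · simp only [inclusion_road_pt_right h _ hl]
      fun_prop
  · obtain ⟨V, hV, hVU⟩ := h1 x
    have hxV : ((1 / 2, 1 / 2) : ℝ × ℝ) ∈ V := (hVU _ (inclusion_node_base x)).1 hx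
    obtain ⟨δ, hδ, hball⟩ := Metric.isOpen_iff.1 hV _ hxV
    refine ⟨δ, hδ, ?_⟩
    rintro p (rfl | ⟨y, h, t, ht, rfl⟩)
    · exact hx
    · refine (hVU _ (inclusion_road_base h t)).2 (hball ?_)
      have h0 := t.2.1
      rcases inclusion_road_pt (r := r) h t with ⟨-, hp⟩ | ⟨-, hp⟩ <;>
      · rw [hp, Metric.mem_ball, Prod.dist_eq]
        simp [abs_of_pos h0, ht, hδ]
  · obtain ⟨ε, hε, hU⟩ := h2 (inclusion r (node x)) hx (by rw [inclusion_node_pt]; norm_num) z h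
    refine ⟨ε, hε, fun t ht => hU _ (inclusion_road_base h t)
      (inclusion_road_mem_strip hB h h.lt t hε (Or.inl le_rfl)) ?_⟩
    rcases inclusion_road_pt (r := r) h t with ⟨-, hp⟩ | ⟨-, hp⟩
    · rw [hp]
      exact lt_max_of_lt_right (by simp only; linarith)
    · rw [hp]
      exact lt_max_of_lt_left (by simp only; linarith)
  · obtain ⟨z, hz, ε, hε, hU⟩ :=
      h3 (inclusion r (node x)) hx (by rw [inclusion_node_pt]; norm_num) hlim
    have hz : z < x := hz
    -- `segment w x` contains roads starting at `w` itself, so `w` must be strictly above `z`.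
    obtain ⟨w, hzw, hw⟩ := exists_between_of_isSuccLimit hlim hz
    have hnode : ∀ v, z < v → v < x → node v ∈ inclusion r ⁻¹' U := fun v hzv hv => by
      refine hU (inclusion r (node v)) hzv hv ?_
      rw [mem_strip_iff]
      rcases turnsLeft_or_turnsRight (r := r) hB hv with h' | h'
      · exact Or.inl ⟨h', by norm_num [inclusion_node_pt, leftArm], by
          simpa [inclusion_node_pt] using hε⟩
      · exact Or.inr ⟨h', by norm_num [inclusion_node_pt, rightArm], by
          simpa [inclusion_node_pt] using hε⟩
    refine ⟨w, hw, min ε (1 / 2), by positivity, ?_, fun v hwv hv => ?_⟩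
    · rintro p (⟨v, hwv, hv, rfl⟩ | ⟨a, b, hab, t, ha, hb, rfl⟩)
      · exact hnode v (hzw.trans hwv) hv
      · have hax := hab.lt.trans_le hb
        refine hU (inclusion r (road a b hab t)) ?_ ?_ ?_ <;> rw [inclusion_road_base]
        · exact hzw.trans_le ha
        · exact hax
        · exact inclusion_road_mem_strip hB hab hax t hε (Or.inl hb)
    · rintro p (rfl | ⟨y, h, t, ht, rfl⟩)
      · exact hnode v (hzw.trans hwv) hv
      · refine hU (inclusion r (road v y h t)) ?_ ?_ ?_ <;> rw [inclusion_road_base]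
        · exact hzw.trans hwv
        · exact hv
        · exact inclusion_road_mem_strip hB h hv t hε (Or.inr ht)

/-- The points of `M_T` all of whose preimages lie in `U` satisfy the local conditions at the image
of `p`. By `mem_nhds_iff_localNhd` they form a neighbourhood, so every neighbourhood in `R_T` comes
from one in `M_T`. -/
theorem localNhd_inclusion [IsStrictTotalOrder T r] (hB : IsBinary T) {U : Set (RoadSpace T)}
    (hU : IsOpen U) {p : RoadSpace T} (hp : p ∈ U) :
    LocalNhd {m | ∀ q, inclusion r q = m → q ∈ U} (inclusion r p) := by
  obtain ⟨h1, h2, h3, h4⟩ := hU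
  rcases p with x | ⟨x, y, h, t⟩
  · refine ⟨?_, fun hb z hz => ?_, fun hb hlim => ?_⟩
    · obtain ⟨δ, hδ, hfan⟩ := h2 x hp
      refine ⟨Metric.ball (1 / 2, 1 / 2) δ, Metric.ball_mem_nhds _ hδ, ?_⟩
      rintro m hm hmV (x' | ⟨x', y', h', t'⟩) rfl
      · obtain rfl : x' = x := hm
        exact hp
      · rw [inclusion_road_base] at hm
        obtain rfl : x' = x := hm
        refine hfan (Or.inr ⟨y', h', t', ?_, rfl⟩)
        have h0 := t'.2.1
        rw [Metric.mem_ball, Prod.dist_eq] at hmV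
        rcases inclusion_road_pt (r := r) h' t' with ⟨-, hp'⟩ | ⟨-, hp'⟩
        · rw [hp'] at hmV
          simpa [Real.dist_eq, abs_of_pos h0] using (max_lt_iff.1 hmV).2
        · rw [hp'] at hmV
          simpa [Real.dist_eq, abs_of_pos h0] using (max_lt_iff.1 hmV).1
    · have hz : z ⋖ x := hz
      obtain ⟨δ, hδ, hδU⟩ := h3 z x hz hp
      have hε1 := min_le_left δ (1 / 2)
      have hε2 := min_le_right δ (1 / 2)
      -- Within `1 / 2` of the top there are no nodes, and a road to the other successor has already
      -- left the arm.
      refine ⟨min δ (1 / 2), by positivity, ?_⟩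
      rintro m hm hs hmax (x' | ⟨x', y', h', t'⟩) rfl
      · rw [inclusion_node_pt, max_self] at hmax
        linarith
      · rw [inclusion_road_base] at hm
        subst hm
        have h0 := t'.2.1
        have hleft : ∀ {v}, v ≤ x → IsLeft r x' v → v = x := fun hv hl =>
          eq_of_covBy_of_le hl.1 hz hv le_rfl
        have hright : ∀ {v}, v ≤ x → IsRight r x' v → v = x := fun hv hl =>
          eq_of_covBy_of_le hl.1 hz hv le_rfl
        have hs := mem_strip_iff.1 hs
        rcases inclusion_road_pt (r := r) h' t' with ⟨hl, hp'⟩ | ⟨hl, hp'⟩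
        · rw [hp'] at hs hmax
          rcases hs with ⟨⟨v, hv, hlv⟩, hs, -⟩ | ⟨-, ⟨-, hs, -, -⟩, -⟩
          · obtain rfl := hleft hv hlv
            obtain rfl := IsLeft.eq hB hl hlv
            refine hδU t' ?_
            rcases lt_max_iff.1 hmax with h5 | h5 <;> simp only at h5 <;> linarith
          · simp only at hs
            rcases lt_max_iff.1 hmax with h5 | h5 <;> simp only at h5 <;> linarith
        · rw [hp'] at hs hmax
          have hr := (isLeft_or_isRight hB h').resolve_left hl
          rcases hs with ⟨-, ⟨-, hs, -, -⟩, -⟩ | ⟨⟨v, hv, hlv⟩, hs, -⟩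
          · simp only at hs
            rcases lt_max_iff.1 hmax with h5 | h5 <;> simp only at h5 <;> linarith
          · obtain rfl := hright hv hlv
            obtain rfl := IsRight.eq hB hr hlv
            refine hδU t' ?_
            rcases lt_max_iff.1 hmax with h5 | h5 <;> simp only at h5 <;> linarith
    · have hlim : Order.IsSuccLimit x := hlim
      obtain ⟨z, hz, δ, hδ, hseg, hfan⟩ := h4 x hlim hp
      refine ⟨z, hz, δ, hδ, ?_⟩
      rintro m hzm hmx hs (x' | ⟨x', y', h', t'⟩) rfl
      · exact hseg (Or.inl ⟨x', hzm, hmx, rfl⟩)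
      · rw [inclusion_road_base] at hzm hmx hs
        have hmx : x' < x := hmx
        have h0 := t'.2.1
        have hs := mem_strip_iff.1 hs
        rcases inclusion_road_pt (r := r) h' t' with ⟨hl, hp'⟩ | ⟨hl, hp'⟩
        · rw [hp'] at hs
          rcases hs with ⟨⟨v, hv, hlv⟩, -, -⟩ | ⟨-, -, hs⟩
          · obtain rfl := IsLeft.eq hB hl hlv
            exact hseg (Or.inr ⟨x', y', h', t', hzm.le, hv, rfl⟩)
          · refine hfan x' hzm hmx (Or.inr ⟨y', h', t', ?_, rfl⟩)
            simpa [inclusion_node_pt, abs_of_pos h0] using hs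
        · rw [hp'] at hs
          rcases hs with ⟨-, -, hs⟩ | ⟨⟨v, hv, hlv⟩, -, -⟩
          · refine hfan x' hzm hmx (Or.inr ⟨y', h', t', ?_, rfl⟩)
            simpa [inclusion_node_pt, abs_of_pos h0] using hs
          · obtain rfl := IsRight.eq hB ((isLeft_or_isRight hB h').resolve_left hl) hlv
            exact hseg (Or.inr ⟨x', y', h', t', hzm.le, hv, rfl⟩)
  · have ht := t.2.1
    have hne : (inclusion r (road x y h t)).pt.1 + (inclusion r (road x y h t)).pt.2 ≠ 1 := by
      rw [inclusion_road_sum]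
      linarith
    refine ⟨?_, fun hb => (hne hb).elim, fun hb => (hne hb).elim⟩
    obtain ⟨δ, hδ, hball⟩ := Metric.isOpen_iff.1 (h1 x y h) t hp
    -- In the sup metric the node and all points of the other road of the piece are at distance at
    -- least `t`.
    refine ⟨Metric.ball _ (min δ t), Metric.ball_mem_nhds _ (lt_min hδ ht), ?_⟩
    rintro m hm hmV (x' | ⟨x', y', h', t'⟩) rfl
    · exfalso
      rw [Metric.mem_ball, Prod.dist_eq, inclusion_node_pt] at hmV
      rcases inclusion_road_pt (r := r) h t with ⟨-, hp'⟩ | ⟨-, hp'⟩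
      · rw [hp'] at hmV
        have := (max_lt_iff.1 hmV).2
        simp [abs_of_pos ht] at this
      · rw [hp'] at hmV
        have := (max_lt_iff.1 hmV).1
        simp [abs_of_pos ht] at this
    · rw [inclusion_road_base, inclusion_road_base] at hm
      subst hm
      have ht' := t'.2.1
      rw [Metric.mem_ball, Prod.dist_eq] at hmV
      rcases inclusion_road_pt (r := r) h t with ⟨hl, hp⟩ | ⟨hl, hp⟩ <;>
        rcases inclusion_road_pt (r := r) h' t' with ⟨hl', hp'⟩ | ⟨hl', hp'⟩ <;>
        rw [hp, hp', max_lt_iff, lt_min_iff, lt_min_iff] at hmV <;>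
        simp only [Real.dist_eq, add_sub_add_left_eq_sub, sub_add_cancel_left, abs_neg,
          add_sub_cancel_left, abs_of_pos ht, abs_of_pos ht'] at hmV
      · obtain rfl := IsLeft.eq hB hl hl'
        exact hball hmV.2.1
      · exact (lt_irrefl _ hmV.2.2).elim
      · exact (lt_irrefl _ hmV.1.2).elim
      · obtain rfl := IsRight.eq hB ((isLeft_or_isRight hB h).resolve_left hl)
          ((isLeft_or_isRight hB h').resolve_left hl')
        exact hball hmV.1.1

theorem isEmbedding_inclusion [IsStrictTotalOrder T r] (hB : IsBinary T) (hR : IsRooted T)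
    (hG : Nonempty (TreeHeight T)) :
    IsEmbedding (inclusion r : RoadSpace T → Fattening T r) := by
  refine ⟨isInducing_iff_nhds.2 fun p => le_antisymm
    ((continuous_inclusion hB).tendsto p).le_comap fun U hU => ?_, inclusion_injective hB⟩
  obtain ⟨W, hWU, hW, hpW⟩ := mem_nhds_iff.1 hU
  exact ⟨_, (mem_nhds_iff_localNhd hB hR hG).2 (localNhd_inclusion (r := r) hB hW hpW),
    fun q hq => hWU (hq q rfl)⟩

end Fattening

/-! ### A piecewise linear contraction of the model piece -/

/-- The piecewise linear homotopy of the interval `(0, 3/2)` which at time `t` contracts `(0, 1)`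
linearly towards `1/2` and stretches `[1, 3/2)` accordingly. -/
noncomputable def contractCoord (t a : ℝ) : ℝ :=
  (1 - t) * min a 1 + t / 2 + (1 + t) * max 0 (a - 1)

theorem contractCoord_of_le {t a : ℝ} (h : a ≤ 1) : contractCoord t a = (1 - t) * a + t / 2 := by
  rw [contractCoord, min_eq_left h, max_eq_left (by linarith)]
  ring

theorem contractCoord_of_ge {t a : ℝ} (h : 1 ≤ a) :
    contractCoord t a = 1 - t / 2 + (1 + t) * (a - 1) := by
  rw [contractCoord, min_eq_right h, max_eq_right (by linarith)]
  ring

/-- The affine lower bound maps the line `u + v = 1` to itself, so it suffices to keep images above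
the bottom side. -/
theorem contractCoord_ge {t : ℝ} (ht : 0 ≤ t) (a : ℝ) :
    (1 - t) * a + t / 2 ≤ contractCoord t a := by
  rcases le_total a 1 with h | h
  · rw [contractCoord_of_le h]
  · rw [contractCoord_of_ge h]
    nlinarith

theorem contractCoord_mem {t : ℝ} (ht : t ∈ Icc (0 : ℝ) 1) {a : ℝ} (h0 : 0 < a) (h1 : a < 1) :
    0 < contractCoord t a ∧ contractCoord t a < 1 := by
  obtain ⟨t0, t1⟩ := ht
  rw [contractCoord_of_le h1.le]
  constructor
  · rcases t0.eq_or_lt with rfl | t0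
    · linarith
    · nlinarith
  · rcases t0.eq_or_lt with rfl | t0
    · linarith
    · nlinarith

/-- The slope `1 + t` beyond `1` is the one for which `3 / 2` stays fixed, so that the top sides
match the bottom sides of the next pieces at all times. -/
theorem contractCoord_lt {t : ℝ} (ht : t ∈ Icc (0 : ℝ) 1) {a : ℝ} (h : a < 3 / 2) :
    contractCoord t a < 3 / 2 := by
  obtain ⟨t0, t1⟩ := ht
  rcases le_total a 1 with h1 | h1
  · rw [contractCoord_of_le h1]
    nlinarith
  · rw [contractCoord_of_ge h1]
    nlinarith

theorem continuous_contractCoord : Continuous fun q : ℝ × ℝ => contractCoord q.1 q.2 := by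
  unfold contractCoord
  fun_prop

/-- The homotopy of the plane that acts by `contractCoord` on both coordinates. -/
noncomputable def contractPlane (t : ℝ) (p : ℝ × ℝ) : ℝ × ℝ :=
  (contractCoord t p.1, contractCoord t p.2)

theorem one_le_contractPlane {t : ℝ} (ht : t ∈ Icc (0 : ℝ) 1) {p : ℝ × ℝ} (h : 1 ≤ p.1 + p.2) :
    1 ≤ (contractPlane t p).1 + (contractPlane t p).2 := by
  have h1 := contractCoord_ge ht.1 p.1
  have h2 := contractCoord_ge ht.1 p.2
  have : (1 - t) * 1 ≤ (1 - t) * (p.1 + p.2) := mul_le_mul_of_nonneg_left h (by linarith [ht.2])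
  simp only [contractPlane]
  linarith

theorem contractPlane_leftArm {t : ℝ} (ht : t ∈ Icc (0 : ℝ) 1) {p : ℝ × ℝ} (h : p ∈ leftArm) :
    contractPlane t p ∈ leftArm :=
  ⟨(contractCoord_mem ht h.1 h.2.1).1, (contractCoord_mem ht h.1 h.2.1).2,
    one_le_contractPlane ht h.2.2.1, contractCoord_lt ht h.2.2.2⟩

theorem contractPlane_rightArm {t : ℝ} (ht : t ∈ Icc (0 : ℝ) 1) {p : ℝ × ℝ} (h : p ∈ rightArm) :
    contractPlane t p ∈ rightArm :=
  ⟨(contractCoord_mem ht h.1 h.2.1).1, (contractCoord_mem ht h.1 h.2.1).2,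
    one_le_contractPlane ht h.2.2.1, contractCoord_lt ht h.2.2.2⟩

theorem collar_lt_one {p : ℝ × ℝ} (h : p ∈ collar) : p.1 < 1 ∧ p.2 < 1 := by
  obtain ⟨h1, h2, h3⟩ := h
  obtain ⟨h4, h5⟩ := abs_lt.1 h1
  constructor <;> linarith

theorem contractPlane_collar {t : ℝ} (ht : t ∈ Icc (0 : ℝ) 1) {p : ℝ × ℝ} (h : p ∈ collar) :
    contractPlane t p ∈ piece ∨ contractPlane t p ∈ collar := by
  obtain ⟨a1, a2⟩ := collar_lt_one h
  obtain ⟨h1, h2, h3⟩ := h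
  obtain ⟨h4, h5⟩ := abs_lt.1 h1
  obtain ⟨t0, t1⟩ := ht
  have hp : contractPlane t p = ((1 - t) * p.1 + t / 2, (1 - t) * p.2 + t / 2) := by
    rw [contractPlane, contractCoord_of_le a1.le, contractCoord_of_le a2.le]
  rw [hp]
  -- At time `1` the collar collapses to the midpoint of the bottom side, which belongs to the piece
  -- and no longer to the collar.
  rcases t1.eq_or_lt with rfl | t1
  · left
    norm_num [piece, leftArm]
  · right
    refine ⟨abs_lt.2 ⟨?_, ?_⟩, ?_, ?_⟩ <;> simp only <;> nlinarith

namespace Fattening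

variable {T : Type u} [PartialOrder T] [IsSetTree T] {r : T → T → Prop}

open RoadSpace

/-! ### Squeezing the fattening onto the road space -/

/-- The homotopy of `M_T` that acts by `contractPlane` on every piece. -/
noncomputable def squeeze (t : unitInterval) (m : Fattening T r) : Fattening T r where
  base := m.base
  pt := contractPlane t m.pt
  mem := by
    rcases m.mem with (h | h) | ⟨h, h'⟩
    · exact Or.inl (Or.inl (contractPlane_leftArm t.2 h))
    · exact Or.inl (Or.inr (contractPlane_rightArm t.2 h))
    · exact (contractPlane_collar t.2 h').imp_right fun h'' => ⟨h, h''⟩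

theorem sum_squeeze_of_le {t : unitInterval} {m : Fattening T r} (h : m.pt.1 + m.pt.2 ≤ 1) :
    (squeeze t m).pt = ((1 - t) * m.pt.1 + t / 2, (1 - t) * m.pt.2 + t / 2) := by
  have : m.pt.1 ≤ 1 ∧ m.pt.2 ≤ 1 := by
    rcases h.eq_or_lt with h | h
    · obtain ⟨b1, b2, -⟩ := piece_bounds ((one_le_iff m).1 h.ge)
      constructor <;> linarith
    · obtain ⟨b1, b2⟩ := collar_lt_one (isMin_of_lt_one h).2
      exact ⟨b1.le, b2.le⟩
  show contractPlane t m.pt = _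
  rw [contractPlane, contractCoord_of_le this.1, contractCoord_of_le this.2]

/-- In a column the transversal coordinate stays in `(0, 1)`, where `contractCoord` is affine; the
stretching acts only lengthwise. So the position moves linearly to `1 / 2`, by the same formula in
every piece. -/
theorem pos_squeeze [IsStrictTotalOrder T r] (hB : IsBinary T) {y : T} {m : Fattening T r}
    (hm : m ∈ column y) (t : unitInterval) :
    pos y (squeeze t m) = (1 - t) * pos y m + t / 2 := by
  have hbase : (squeeze t m).base = m.base := rfl
  rcases le_total (m.pt.1 + m.pt.2) 1 with h | h
  · have hp := sum_squeeze_of_le (t := t) h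
    rw [pos_of_ge h, pos_of_ge, hp]
    · simp only
      ring
    · rw [hp]
      simp only
      nlinarith [t.2.1, t.2.2]
  · have h1 : 1 ≤ (squeeze t m).pt.1 + (squeeze t m).pt.2 := one_le_contractPlane t.2 h
    rcases turnsLeft_or_turnsRight (r := r) hB hm.1 with h' | h'
    · have hl := mem_leftArm_of_mem_column hm h' h
      rw [pos_of_turnsLeft h', pos_of_turnsLeft (m := squeeze t m) h', posL_of_le h, posL_of_le h1]
      exact contractCoord_of_le hl.2.1.le
    · have hl := mem_rightArm_of_mem_column hB hm h' h
      rw [pos_of_turnsRight hB h', pos_of_turnsRight hB (m := squeeze t m) h', posR_of_le h,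
        posR_of_le h1]
      have : (squeeze t m).pt.2 = (1 - t) * m.pt.2 + t / 2 := contractCoord_of_le hl.2.1.le
      rw [this]
      ring

theorem squeeze_mem_column [IsStrictTotalOrder T r] (hB : IsBinary T) {y : T} {m : Fattening T r}
    (hm : m ∈ column y) (t : unitInterval) : squeeze t m ∈ column y := by
  refine ⟨hm.1, ?_⟩
  rw [pos_squeeze hB hm, ← contractCoord_of_le hm.2.2.le]
  exact contractCoord_mem t.2 hm.2.1 hm.2.2

variable (G : TreeHeight T)

theorem relHeight_top {c : ℝ} (h0 : 0 ≤ c) (h1 : c ≤ 3 / 2) :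
    relHeight (c, 3 / 2) = 1 := by
  have : min c (3 / 2) = c := min_eq_left h1
  simp only [relHeight]
  rw [this, max_eq_right h0, max_eq_right (by linarith)]
  have : (1 / 2 + c) ≠ 0 := by linarith
  field_simp
  ring

/-- In a fixed piece the squeezed height is a continuous formula `K` of time and position. At a
bottom side over a successor, `K` for the piece below extends continuously to the top side, with
value `next z` there. At a limit level, squeezing preserves the base, so the heights remain trapped
by the values along the branch. -/
theorem continuous_height_squeeze [IsStrictTotalOrder T r] (hB : IsBinary T) (hR : IsRooted T) :
    Continuous fun q : unitInterval × Fattening T r => height G (squeeze q.1 q.2) := by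
  rw [continuous_iff_continuousAt]
  rintro ⟨t₀, m₀⟩
  rw [ContinuousAt, Metric.tendsto_nhds]
  intro ε hε
  let K : T → ℝ × (ℝ × ℝ) → ℝ := fun x q =>
    G.val x + (G.next x - G.val x) * relHeight (contractPlane q.1 q.2) +
      min 0 ((contractPlane q.1 q.2).1 + (contractPlane q.1 q.2).2 - 1)
  have hK : ∀ x, Continuous (K x) := fun x => by
    have h1 := continuous_relHeight
    have h2 := continuous_contractCoord
    have h3 : Continuous fun q : ℝ × (ℝ × ℝ) => contractPlane q.1 q.2 := by
      unfold contractPlane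
      exact (h2.comp (continuous_fst.prodMk (continuous_fst.comp continuous_snd))).prodMk
        (h2.comp (continuous_fst.prodMk (continuous_snd.comp continuous_snd)))
    fun_prop
  have hKm : ∀ (t : unitInterval) (m : Fattening T r),
      height G (squeeze t m) = K m.base (t, m.pt) := fun t m => rfl
  set c := height G (squeeze t₀ m₀) with hc
  have hplane : ∀ (x : T) (p : ℝ × ℝ), K x (t₀, p) = c →
      ∃ A ∈ 𝓝 t₀, ∃ V ∈ 𝓝 p, ∀ t ∈ A, ∀ q ∈ V, dist (K x ((t : ℝ), q)) c < ε := by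
    intro x p hp
    have h1 : Continuous fun q : unitInterval × (ℝ × ℝ) => K x ((q.1 : ℝ), q.2) :=
      (hK x).comp (by fun_prop)
    have h2 := Metric.tendsto_nhds.1 (h1.tendsto (t₀, p)) ε hε
    rw [hp, nhds_prod_eq, Filter.eventually_prod_iff] at h2
    obtain ⟨pa, hpa, pb, hpb, h⟩ := h2
    exact ⟨_, hpa, _, hpb, fun t ht q hq => h ht hq⟩
  -- A time neighbourhood uniform in `m` reduces joint continuity to one `LocalNhd` condition at
  -- `m₀`.
  suffices h : ∃ A ∈ 𝓝 t₀, LocalNhd {m | ∀ t ∈ A, dist (height G (squeeze t m)) c < ε} m₀ by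
    obtain ⟨A, hA, hS⟩ := h
    rw [← mem_nhds_iff_localNhd hB hR ⟨G⟩] at hS
    filter_upwards [prod_mem_nhds hA hS] with q hq
    exact hq.2 q.1 hq.1
  obtain ⟨A₁, hA₁, V, hV, hAV⟩ := hplane m₀.base m₀.pt rfl
  have part1 : ∀ A ⊆ A₁, ∃ V ∈ 𝓝 m₀.pt, ∀ m' : Fattening T r, m'.base = m₀.base → m'.pt ∈ V →
      m' ∈ {m | ∀ t ∈ A, dist (height G (squeeze t m)) c < ε} := by
    refine fun A hA => ⟨V, hV, fun m' hm' hm'' t ht => ?_⟩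
    rw [hKm, hm']
    exact hAV t (hA ht) _ hm''
  have hbot : m₀.pt.1 + m₀.pt.2 = 1 → c = G.val m₀.base := fun h => by
    have h1 : (squeeze t₀ m₀).pt.1 + (squeeze t₀ m₀).pt.2 = 1 := by
      rw [sum_squeeze_of_le h.le]
      linear_combination (1 - (t₀ : ℝ)) * h
    rw [hc, height_of_ge h1.le, h1]
    simp [squeeze]
  rcases isMin_or_covBy_or_isSuccLimit m₀.base with ho | ⟨z, hz⟩ | hlim
  · exact ⟨A₁, hA₁, part1 A₁ subset_rfl, fun _ z hz => (ho.not_lt hz.lt).elim,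
      fun _ h => (h.1 ho).elim⟩
  · by_cases h : m₀.pt.1 + m₀.pt.2 = 1
    · have hcz : c = G.next z := by rw [hbot h, G.val_covBy hz]
      obtain ⟨b1, b2, -⟩ := piece_bounds ((one_le_iff m₀).1 h.ge)
      have htop : contractCoord t₀ (3 / 2) = 3 / 2 := by
        rw [contractCoord_of_ge (by norm_num)]
        ring
      have e1 : K z (t₀, (m₀.pt.1, 3 / 2)) = c := by
        obtain ⟨c1, c2⟩ := contractCoord_mem t₀.2 b1 (by linarith)
        have : contractPlane t₀ (m₀.pt.1, 3 / 2) = (contractCoord t₀ m₀.pt.1, 3 / 2) := by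
          rw [contractPlane, htop]
        simp only [K, this]
        rw [relHeight_top c1.le (by linarith), min_eq_left (by linarith), hcz]
        ring
      have e2 : K z (t₀, (3 / 2, m₀.pt.2)) = c := by
        obtain ⟨c1, c2⟩ := contractCoord_mem t₀.2 b2 (by linarith)
        have : contractPlane t₀ (3 / 2, m₀.pt.2) = (contractCoord t₀ m₀.pt.2, 3 / 2).swap := by
          rw [contractPlane, htop]
          rfl
        simp only [K, this]
        rw [relHeight_swap, relHeight_top c1.le (by linarith), min_eq_left (by
          simp only [Prod.fst_swap, Prod.snd_swap]; linarith), hcz]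
        ring
      obtain ⟨A₂, hA₂, V₂, hV₂, hAV₂⟩ := hplane z _ e1
      obtain ⟨A₃, hA₃, V₃, hV₃, hAV₃⟩ := hplane z _ e2
      refine ⟨A₁ ∩ (A₂ ∩ A₃), Filter.inter_mem hA₁ (Filter.inter_mem hA₂ hA₃),
        part1 _ inter_subset_left, fun _ w hw => ?_, fun _ hl => (hl.2 z hz).elim⟩
      obtain rfl := eq_of_covBy hw hz
      obtain ⟨δ₂, hδ₂, hb₂⟩ := Metric.mem_nhds_iff.1 hV₂
      obtain ⟨δ₃, hδ₃, hb₃⟩ := Metric.mem_nhds_iff.1 hV₃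
      have m1 := min_le_left (1 / 2) (min δ₂ δ₃)
      have m2 := (min_le_right (1 / 2) (min δ₂ δ₃)).trans (min_le_left _ _)
      have m3 := (min_le_right (1 / 2) (min δ₂ δ₃)).trans (min_le_right _ _)
      refine ⟨min (1 / 2) (min δ₂ δ₃), by positivity, fun p hp hps hmax t ht => ?_⟩
      rw [hKm, hp]
      rcases mem_strip_iff.1 hps with ⟨-, h2, h3⟩ | ⟨-, h2, h3⟩
      · refine hAV₂ t ht.2.1 _ (hb₂ ?_)
        have : 3 / 2 - min (1 / 2) (min δ₂ δ₃) < p.pt.2 := by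
          rcases lt_max_iff.1 hmax with h4 | h4
          · linarith [h2.2.1]
          · exact h4
        rw [Metric.mem_ball, Prod.dist_eq]
        refine max_lt (h3.trans_le m2) ?_
        rw [Real.dist_eq, abs_lt]
        constructor <;> simp only <;> linarith [h2.2.2.2]
      · refine hAV₃ t ht.2.2 _ (hb₃ ?_)
        have : 3 / 2 - min (1 / 2) (min δ₂ δ₃) < p.pt.1 := by
          rcases lt_max_iff.1 hmax with h4 | h4
          · exact h4
          · linarith [h2.2.1]
        rw [Metric.mem_ball, Prod.dist_eq]
        refine max_lt ?_ (h3.trans_le m3)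
        rw [Real.dist_eq, abs_lt]
        constructor <;> simp only <;> linarith [h2.2.2.2]
    · exact ⟨A₁, hA₁, part1 A₁ subset_rfl, fun h' => (h h').elim, fun h' => (h h').elim⟩
  · refine ⟨A₁, hA₁, part1 A₁ subset_rfl, fun _ z hz => (hlim.2 z hz).elim, fun hb _ => ?_⟩
    obtain ⟨z, hz, hzv⟩ := G.exists_lt hlim (show G.val m₀.base - ε < G.val m₀.base by linarith)
    -- Neither the width of the strip nor the time matters: the heights in pieces strictly between
    -- `z` and `m₀.base` are already within `ε`.
    refine ⟨z, hz, 1, one_pos, fun p hzp hpm hps t _ => ?_⟩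
    have hpp : p.pt ∈ piece := by
      rcases mem_strip_iff.1 hps with ⟨-, h2, -⟩ | ⟨-, h2, -⟩
      · exact Or.inl h2
      · exact Or.inr h2
    have h1 : 1 ≤ (squeeze t p).pt.1 + (squeeze t p).pt.2 :=
      one_le_contractPlane t.2 ((one_le_iff p).2 hpp)
    obtain ⟨h2, h3⟩ := height_bounds (G := G) h1
    have h2 : G.val p.base ≤ height G (squeeze t p) := h2
    have h3 : height G (squeeze t p) < G.next p.base := h3
    have h4 := G.next_le hpm
    have h5 := G.strictMono hzp
    rw [hbot hb, Real.dist_eq, abs_lt]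
    constructor <;> linarith

theorem continuous_squeeze [IsStrictTotalOrder T r] (hB : IsBinary T) (hR : IsRooted T)
    (hG : Nonempty (TreeHeight T)) :
    Continuous fun q : unitInterval × Fattening T r => squeeze q.1 q.2 := by
  obtain ⟨G⟩ := hG
  rw [continuous_iff_continuousAt]
  rintro ⟨t₀, m₀⟩
  obtain ⟨y, -, hy⟩ := exists_mem_column hB m₀
  have hcol : ∀ᶠ q in 𝓝 (t₀, m₀), q.2 ∈ column y :=
    continuousAt_snd.eventually ((isOpen_column ⟨G⟩ hB y).mem_nhds hy)
  refine tendsto_of_chart G hB hR (squeeze_mem_column hB hy t₀) ?_ ?_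
    ((continuous_height_squeeze G hB hR).tendsto (t₀, m₀))
  · filter_upwards [hcol] with q hq
    exact squeeze_mem_column hB hq q.1
  · rw [pos_squeeze hB hy]
    have h1 : ContinuousAt (fun q : unitInterval × Fattening T r => pos y q.2) (t₀, m₀) :=
      ContinuousAt.comp (x := (t₀, m₀)) (g := pos y) (f := Prod.snd) (continuousAt_pos hB ⟨G⟩ hy)
        continuousAt_snd
    have h2 : ContinuousAt (fun q : unitInterval × Fattening T r =>
        (1 - (q.1 : ℝ)) * pos y q.2 + q.1 / 2) (t₀, m₀) := by fun_prop
    refine h2.tendsto.congr' ?_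
    filter_upwards [hcol] with q hq
    rw [pos_squeeze hB hq]

theorem squeeze_zero (m : Fattening T r) : squeeze 0 m = m := by
  have key : ∀ a : ℝ, contractCoord 0 a = a := fun a => by
    rcases le_total a 1 with h | h
    · rw [contractCoord_of_le h]; ring
    · rw [contractCoord_of_ge h]; ring
  refine Fattening.ext rfl (Prod.ext (key _) (key _))

/-- At time `1` coordinates up to `1` collapse to `1 / 2`, and a coordinate `a ≥ 1` becomes `1 / 2 +
2 * (a - 1)`. Thus triangle and collar go to the node, and the rectangles onto the roads with
parameter `2 * (a - 1)`. -/
theorem exists_inclusion_eq_squeeze_one [IsStrictTotalOrder T r] (hB : IsBinary T)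
    (m : Fattening T r) : ∃ q, inclusion r q = squeeze 1 m := by
  have hle : ∀ {a : ℝ}, a ≤ 1 → contractCoord 1 a = 1 / 2 := fun h => by
    rw [contractCoord_of_le h]; ring
  have hge : ∀ {a : ℝ}, 1 ≤ a → contractCoord 1 a = 1 / 2 + 2 * (a - 1) := fun h => by
    rw [contractCoord_of_ge h]; ring
  have hlt : m.pt.1 < 3 / 2 ∧ m.pt.2 < 3 / 2 ∧ (m.pt.1 < 1 ∨ m.pt.2 < 1) := by
    rcases m.mem with h | ⟨-, h⟩
    · obtain ⟨b1, b2, b3, b4, b5, b6⟩ := piece_bounds h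
      exact ⟨b4, b5, min_lt_iff.1 b6⟩
    · obtain ⟨b1, b2⟩ := collar_lt_one h
      exact ⟨by linarith, by linarith, Or.inl b1⟩
  obtain ⟨h1, h2, h3⟩ := hlt
  rcases le_or_gt m.pt.1 1 with hu | hu
  · rcases le_or_gt m.pt.2 1 with hv | hv
    · exact ⟨node m.base, Fattening.ext rfl (Prod.ext (hle hu).symm (hle hv).symm)⟩
    · obtain ⟨y, hy⟩ := exists_isLeft (r := r) hB m.base
      refine ⟨road m.base y hy.1 ⟨2 * (m.pt.2 - 1), by linarith, by linarith⟩, ?_⟩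
      refine Fattening.ext (inclusion_road_base _ _) ?_
      rw [inclusion_road_pt_left _ _ hy]
      exact Prod.ext (hle hu).symm (hge hv.le).symm
  · have hv : m.pt.2 < 1 := h3.resolve_left (by linarith)
    obtain ⟨y, hy⟩ := exists_isRight (r := r) hB m.base
    refine ⟨road m.base y hy.1 ⟨2 * (m.pt.1 - 1), by linarith, by linarith⟩, ?_⟩
    refine Fattening.ext (inclusion_road_base _ _) ?_
    rw [inclusion_road_pt_right _ _ fun h => not_isRight_of_isLeft hB h hy]
    exact Prod.ext (hge hu.le).symm (hle hv.le).symm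

/-! ### The road space is contractible -/

theorem pos_inclusion_node (x y : T) : pos y (inclusion r (node x)) = 1 / 2 := by
  rw [pos_of_eq] <;> rw [inclusion_node_pt]
  norm_num

theorem inclusion_node_mem_column {x y : T} (h : x < y) : inclusion r (node x) ∈ column y :=
  ⟨h, by rw [pos_inclusion_node]; norm_num⟩

theorem height_inclusion_node (x : T) : height G (inclusion r (node x)) = G.val x := by
  rw [height_of_ge] <;> rw [inclusion_node_pt]
  · norm_num [inclusion_node_base]
  · norm_num

theorem height_inclusion_road {x y : T} (h : x ⋖ y) (t : Ioo (0 : ℝ) 1) :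
    height G (inclusion r (road x y h t)) = G.val x + (G.next x - G.val x) * t := by
  have h0 := t.2.1
  have hs := inclusion_road_sum (r := r) h t
  rw [height_of_le (by rw [hs]; linarith), inclusion_road_base]
  have hL : relHeight (1 / 2, 1 / 2 + (t : ℝ)) = t := by
    simp only [relHeight]
    rw [min_eq_left (by linarith), max_eq_right (b := 1 / 2 + (1 / 2 + (t : ℝ)) - 1) (by linarith),
      max_eq_right (by norm_num)]
    ring
  congr 2
  rcases inclusion_road_pt (r := r) h t with ⟨-, h⟩ | ⟨-, h⟩ <;> rw [h]
  · exact hL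
  · rw [← relHeight_swap]
    exact hL

/-- `σ` is `0` for a road along the axis of the column, and `1` or `-1` for a road turning away from
it to the right or to the left. -/
theorem pos_inclusion_road [IsStrictTotalOrder T r] (hB : IsBinary T) {x y₀ y : T} (h : x ⋖ y₀)
    (hxy : x < y) : ∃ σ : ℝ, (y₀ ≤ y → σ = 0) ∧
      ∀ t : Ioo (0 : ℝ) 1, pos y (inclusion r (road x y₀ h t)) = 1 / 2 + σ * t := by
  have hs : ∀ t : Ioo (0 : ℝ) 1, 1 ≤ (inclusion r (road x y₀ h t)).pt.1 +
      (inclusion r (road x y₀ h t)).pt.2 := fun t => by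
    rw [inclusion_road_sum]; linarith [t.2.1]
  have hbase : ∀ t, (inclusion r (road x y₀ h t)).base = x := inclusion_road_base h
  rcases turnsLeft_or_turnsRight (r := r) hB hxy with h' | h' <;> by_cases hl : IsLeft r x y₀
  · refine ⟨0, fun _ => rfl, fun t => ?_⟩
    rw [pos_of_turnsLeft (by rwa [hbase]), posL_of_le (hs t), inclusion_road_pt_left h t hl]
    simp
  · refine ⟨1, fun hy => ?_, fun t => ?_⟩
    · obtain ⟨w, hw, hlw⟩ := h'
      obtain rfl := eq_of_covBy_of_le hlw.1 h hw hy
      exact (hl hlw).elim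
    · rw [pos_of_turnsLeft (by rwa [hbase]), posL_of_le (hs t), inclusion_road_pt_right h t hl]
      simp
  · refine ⟨-1, fun hy => ?_, fun t => ?_⟩
    · exact (TurnsLeft.not_turnsRight hB ⟨y₀, hy, hl⟩ h').elim
    · rw [pos_of_turnsRight hB (by rwa [hbase]), posR_of_le (hs t), inclusion_road_pt_left h t hl]
      simp only
      ring
  · refine ⟨0, fun _ => rfl, fun t => ?_⟩
    rw [pos_of_turnsRight hB (by rwa [hbase]), posR_of_le (hs t), inclusion_road_pt_right h t hl]
    simp only
    ring

theorem exists_midline [IsStrictTotalOrder T r] (hB : IsBinary T) (p : RoadSpace T) :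
    ∃ y, inclusion r p ∈ column y ∧ pos y (inclusion r p) = 1 / 2 := by
  rcases p with x | ⟨x, y, h, t⟩
  · obtain ⟨y, hy⟩ := exists_isLeft (r := r) hB x
    exact ⟨y, inclusion_node_mem_column hy.1.lt, pos_inclusion_node x y⟩
  · obtain ⟨σ, h1, h2⟩ := pos_inclusion_road (r := r) hB h h.lt
    have h3 : pos y (inclusion r (road x y h t)) = 1 / 2 := by
      rw [h2, h1 le_rfl]; ring
    refine ⟨y, ⟨?_, ?_⟩, h3⟩
    · rw [inclusion_road_base]
      exact h.lt
    · rw [h3]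
      norm_num

/-- Below each point `p` of the road space there is a point at any prescribed smaller height, and it is
at most as far from the midline of any column as `p`. -/
theorem exists_below [IsStrictTotalOrder T r] (hB : IsBinary T) (hR : IsRooted T) {o : T}
    (ho : IsMin o) (p : RoadSpace T) {c : ℝ} (hc : G.val o ≤ c) :
    ∃ q, height G (inclusion r q) = min (height G (inclusion r p)) c ∧
      ∀ y, inclusion r p ∈ column y → inclusion r q ∈ column y ∧
        |pos y (inclusion r q) - 1 / 2| ≤ |pos y (inclusion r p) - 1 / 2| := by
  rcases le_or_gt (height G (inclusion r p)) c with hle | hlt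
  · exact ⟨p, (min_eq_left hle).symm, fun y hy => ⟨hy, le_rfl⟩⟩
  rw [min_eq_right hlt.le]
  -- Below the piece of `p`, the point at height `c` is on the branch and hence on the midline of
  -- every column through `p`. Inside the piece, `p` slides back along its own road and its offset
  -- `σ * t` shrinks.
  rcases lt_or_ge c (G.val (inclusion r p).base) with hcx | hcx
  · obtain ⟨w, w', hw, hw', h1, h2⟩ := G.exists_val_le_lt_next ho hR hc hcx
    have hgap : 0 < G.next w - G.val w := by linarith
    rcases h1.eq_or_lt with rfl | h1
    · refine ⟨node w, height_inclusion_node G w, fun y hy => ?_⟩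
      refine ⟨inclusion_node_mem_column (hw.lt.trans_le (hw'.trans hy.1.le)), ?_⟩
      rw [pos_inclusion_node, sub_self, abs_zero]
      exact abs_nonneg _
    · have hτ0 : 0 < (c - G.val w) / (G.next w - G.val w) := div_pos (by linarith) hgap
      have hτ1 : (c - G.val w) / (G.next w - G.val w) < 1 := (div_lt_one hgap).2 (by linarith)
      refine ⟨road w w' hw ⟨(c - G.val w) / (G.next w - G.val w), hτ0, hτ1⟩, ?_, fun y hy => ?_⟩
      · rw [height_inclusion_road]
        simp only
        rw [mul_div_cancel₀ _ hgap.ne']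
        ring
      · have hwy : w' ≤ y := hw'.trans hy.1.le
        obtain ⟨σ, h3, h4⟩ := pos_inclusion_road (r := r) hB hw (hw.lt.trans_le hwy)
        have h5 := h4 ⟨(c - G.val w) / (G.next w - G.val w), hτ0, hτ1⟩
        rw [h3 hwy, zero_mul, add_zero] at h5
        refine ⟨⟨?_, ?_⟩, ?_⟩
        · rw [inclusion_road_base]
          exact hw.lt.trans_le hwy
        · rw [h5]
          norm_num
        · rw [h5, sub_self, abs_zero]
          exact abs_nonneg _
  · rcases p with x | ⟨x, y₀, h, t⟩
    · rw [height_inclusion_node] at hlt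
      exact (hcx.not_gt hlt).elim
    · rw [inclusion_road_base] at hcx
      rw [height_inclusion_road] at hlt
      have hgap : 0 < G.next x - G.val x := by linarith [G.lt_next x]
      rcases hcx.eq_or_lt with rfl | hcx
      · refine ⟨node x, height_inclusion_node G x, fun y hy => ?_⟩
        have hxy := hy.1
        rw [inclusion_road_base] at hxy
        refine ⟨inclusion_node_mem_column hxy, ?_⟩
        rw [pos_inclusion_node, sub_self, abs_zero]
        exact abs_nonneg _
      · have hτ : (c - G.val x) / (G.next x - G.val x) < t := (div_lt_iff₀ hgap).2 (by linarith)
        have hτ0 : 0 < (c - G.val x) / (G.next x - G.val x) := div_pos (by linarith) hgap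
        refine ⟨road x y₀ h ⟨(c - G.val x) / (G.next x - G.val x), hτ0, hτ.trans t.2.2⟩, ?_,
          fun y hy => ?_⟩
        · rw [height_inclusion_road]
          simp only
          rw [mul_div_cancel₀ _ hgap.ne']
          ring
        · have hxy := hy.1
          rw [inclusion_road_base] at hxy
          obtain ⟨σ, h3, h4⟩ := pos_inclusion_road (r := r) hB h hxy
          have h5 := h4 ⟨(c - G.val x) / (G.next x - G.val x), hτ0, hτ.trans t.2.2⟩
          have h6 := h4 t
          have h7 : |pos y (inclusion r (road x y₀ h ⟨_, hτ0, hτ.trans t.2.2⟩)) - 1 / 2| ≤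
              |pos y (inclusion r (road x y₀ h t)) - 1 / 2| := by
            rw [h5, h6, add_sub_cancel_left, add_sub_cancel_left, abs_mul, abs_mul]
            refine mul_le_mul_of_nonneg_left ?_ (abs_nonneg σ)
            rw [abs_of_pos hτ0, abs_of_pos t.2.1]
            exact hτ.le
          refine ⟨⟨by rwa [inclusion_road_base], ?_⟩, h7⟩
          have h8 : |pos y (inclusion r (road x y₀ h t)) - 1 / 2| < 1 / 2 :=
            abs_lt.2 ⟨by linarith [hy.2.1], by linarith [hy.2.2]⟩
          obtain ⟨h9, h10⟩ := abs_lt.1 (h7.trans_lt h8)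
          exact ⟨by linarith, by linarith⟩

/-- At time `t` a point is lowered to height at most `1 - t`, but not below the root. All heights
are at most `1`, so the motion starts at the identity, and `val o ≥ 0`, so it ends at the root. For
continuity, use a column having the initial point `p₀` on its midline: heights vary continuously by
their formula, and positions converge to `1 / 2` because lowering never increases the distance to
the midline. -/
theorem contractibleSpace_roadSpace (r : T → T → Prop) [IsStrictTotalOrder T r] (hB : IsBinary T)
    (hR : IsRooted T) (hG : Nonempty (TreeHeight T)) : ContractibleSpace (RoadSpace T) := by
  obtain ⟨G⟩ := id hG
  obtain ⟨o, ho, -⟩ := id hR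
  have hcle : ∀ t : unitInterval, G.val o ≤ max (1 - (t : ℝ)) (G.val o) := fun t => le_max_right _ _
  choose F hF1 hF2 using fun (t : unitInterval) (p : RoadSpace T) =>
    exists_below (r := r) G hB hR ho p (hcle t)
  have hemb := isEmbedding_inclusion (r := r) hB hR hG
  have hcont : Continuous fun q : unitInterval × RoadSpace T => F q.1 q.2 := by
    rw [hemb.continuous_iff, continuous_iff_continuousAt]
    rintro ⟨t₀, p₀⟩
    obtain ⟨y, hy, hmid⟩ := exists_midline (r := r) hB p₀
    obtain ⟨h1, h2⟩ := hF2 t₀ p₀ y hy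
    have hcol : ∀ᶠ q in 𝓝 (t₀, p₀), inclusion r q.2 ∈ column y :=
      (hemb.continuous.comp continuous_snd).continuousAt.eventually
        ((isOpen_column hG hB y).mem_nhds hy)
    refine tendsto_of_chart G hB hR h1 ?_ ?_ ?_
    · filter_upwards [hcol] with q hq
      exact (hF2 q.1 q.2 y hq).1
    · rw [hmid, sub_self, abs_zero] at h2
      have h3 : pos y (inclusion r (F t₀ p₀)) = 1 / 2 :=
        sub_eq_zero.1 (abs_eq_zero.1 (le_antisymm h2 (abs_nonneg _)))
      show Filter.Tendsto _ _ (𝓝 (pos y (inclusion r (F t₀ p₀))))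
      rw [h3, tendsto_iff_dist_tendsto_zero]
      have h4 : Filter.Tendsto (fun q : unitInterval × RoadSpace T =>
          dist (pos y (inclusion r q.2)) (1 / 2)) (𝓝 (t₀, p₀)) (𝓝 0) := by
        rw [← tendsto_iff_dist_tendsto_zero]
        have h5 : ContinuousAt (fun q : unitInterval × RoadSpace T => inclusion r q.2) (t₀, p₀) :=
          (hemb.continuous.comp continuous_snd).continuousAt
        have h6 : ContinuousAt (fun q : unitInterval × RoadSpace T => pos y (inclusion r q.2))
            (t₀, p₀) := ContinuousAt.comp (x := (t₀, p₀)) (g := pos y)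
              (f := fun q : unitInterval × RoadSpace T => inclusion r q.2)
              (continuousAt_pos hB hG hy) h5
        have h7 := h6.tendsto
        rwa [hmid] at h7
      refine squeeze_zero' (Filter.Eventually.of_forall fun _ => dist_nonneg) ?_ h4
      filter_upwards [hcol] with q hq
      exact (hF2 q.1 q.2 y hq).2
    · have h3 : Continuous fun q : unitInterval × RoadSpace T =>
          min (height G (inclusion r q.2)) (max (1 - (q.1 : ℝ)) (G.val o)) := by
        have h4 : Continuous fun q : unitInterval × RoadSpace T => height G (inclusion r q.2) :=
          (continuous_height G hB).comp (hemb.continuous.comp continuous_snd)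
        fun_prop
      have h4 := h3.tendsto (t₀, p₀)
      simp only [← hF1] at h4
      exact h4
  have hF0 : ∀ p, F 0 p = p := fun p => by
    obtain ⟨y, hy, hmid⟩ := exists_midline (r := r) hB p
    obtain ⟨h1, h2⟩ := hF2 0 p y hy
    rw [hmid, sub_self, abs_zero] at h2
    have h3 := sub_eq_zero.1 (abs_eq_zero.1 (le_antisymm h2 (abs_nonneg _)))
    refine hemb.injective (eq_of_chart_eq G hB hR h1 hy (h3.trans hmid.symm) ?_)
    rw [hF1, min_eq_left]
    refine (height_lt_next _).le.trans ((G.next_le_one _).trans (le_max_of_le_left ?_))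
    simp
  have hF1' : ∀ p, F 1 p = node o := fun p => by
    obtain ⟨y, hy, hmid⟩ := exists_midline (r := r) hB p
    obtain ⟨h1, h2⟩ := hF2 1 p y hy
    rw [hmid, sub_self, abs_zero] at h2
    have h3 := sub_eq_zero.1 (abs_eq_zero.1 (le_antisymm h2 (abs_nonneg _)))
    have hoy : o < y := (root_le hR ho _).trans_lt hy.1
    refine hemb.injective (eq_of_chart_eq G hB hR h1 (inclusion_node_mem_column hoy)
      (h3.trans (pos_inclusion_node o y).symm) ?_)
    have hs : 1 ≤ (inclusion r p).pt.1 + (inclusion r p).pt.2 := by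
      rcases p with x | ⟨x, y, h, t⟩
      · rw [inclusion_node_pt]; norm_num
      · rw [inclusion_road_sum]; linarith [t.2.1]
    rw [hF1, height_inclusion_node, max_eq_right (by simpa using G.nonneg o), min_eq_right]
    exact (G.strictMono.monotone (root_le hR ho _)).trans (height_bounds hs).1
  rw [contractible_iff_id_nullhomotopic]
  exact ⟨node o, ⟨⟨⟨fun q => F q.1 q.2, hcont⟩, hF0, hF1'⟩⟩⟩

end Fattening

theorem homotopic_of_contractibleSpace {X Y : Type*} [TopologicalSpace X] [TopologicalSpace Y]
    [ContractibleSpace Y] (f g : C(X, Y)) : f.Homotopic g := by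
  obtain ⟨y, hy⟩ := id_nullhomotopic Y
  have key : ∀ k : C(X, Y), k.Homotopic (ContinuousMap.const X y) := fun k =>
    hy.comp (ContinuousMap.Homotopic.refl k)
  exact (key f).trans (key g).symm

/-! ### Contractibility of the fattening and the homotopy equivalence -/

namespace Fattening

variable {T : Type u} [PartialOrder T] [IsSetTree T] {r : T → T → Prop}

theorem exists_collapse [IsStrictTotalOrder T r] (hB : IsBinary T) (hR : IsRooted T)
    (hG : Nonempty (TreeHeight T)) :
    ∃ k : C(Fattening T r, RoadSpace T), ∀ m, inclusion r (k m) = squeeze 1 m := by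
  choose k hk using exists_inclusion_eq_squeeze_one (r := r) hB
  refine ⟨⟨k, ?_⟩, hk⟩
  rw [(isEmbedding_inclusion (r := r) hB hR hG).continuous_iff,
    show inclusion r ∘ k = squeeze 1 from funext hk]
  exact (continuous_squeeze hB hR hG).comp (Continuous.prodMk_right 1)

theorem contractibleSpace [IsStrictTotalOrder T r] (hB : IsBinary T)
    (hR : IsRooted T) (hG : Nonempty (TreeHeight T)) : ContractibleSpace (Fattening T r) := by
  have := contractibleSpace_roadSpace r hB hR hG
  obtain ⟨k, hk⟩ := exists_collapse (r := r) hB hR hG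
  let i : C(RoadSpace T, Fattening T r) := ⟨inclusion r, continuous_inclusion hB⟩
  obtain ⟨p, hp⟩ := id_nullhomotopic (RoadSpace T)
  have h1 : (ContinuousMap.id (Fattening T r)).Homotopic (i.comp k) :=
    ⟨⟨⟨fun q => squeeze q.1 q.2, continuous_squeeze hB hR hG⟩, squeeze_zero, fun m => (hk m).symm⟩⟩
  have h2 : (i.comp k).Homotopic (ContinuousMap.const _ (i p)) :=
    (ContinuousMap.Homotopic.refl i).comp (hp.comp (ContinuousMap.Homotopic.refl k))
  rw [contractible_iff_id_nullhomotopic]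
  exact ⟨i p, h1.trans h2⟩

/-- Maps into a contractible space are all homotopic, so any continuous map back is a homotopy
inverse; the collapse supplies one. -/
theorem exists_homotopyEquiv [IsStrictTotalOrder T r] (hB : IsBinary T)
    (hR : IsRooted T) (hG : Nonempty (TreeHeight T)) :
    ∃ e : RoadSpace T ≃ₕ Fattening T r, ⇑e = inclusion r := by
  have := contractibleSpace_roadSpace r hB hR hG
  have := contractibleSpace (r := r) hB hR hG
  obtain ⟨k, -⟩ := exists_collapse (r := r) hB hR hG
  exact ⟨⟨⟨inclusion r, continuous_inclusion hB⟩, k, homotopic_of_contractibleSpace _ _,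
    homotopic_of_contractibleSpace _ _⟩, rfl⟩

end Fattening

/-! ### Existence of an `ℝ`-special tree -/

namespace CombTree

/-- A node is a subset of `ℚ ×ₗ ℕ` with a greatest element `top`; `below` are its other elements.
The order is end extension. -/
@[ext]
structure Node : Type where
  top : ℚ ×ₗ ℕ
  below : Set (ℚ ×ₗ ℕ)
  lt_top : ∀ y ∈ below, y < top

namespace Node

instance : PartialOrder Node where
  le p q := p = q ∨ (p.top ∈ q.below ∧ p.below = q.below ∩ Iio p.top)
  le_refl p := Or.inl rfl
  le_trans := by
    rintro p q s (rfl | ⟨h1, h2⟩) (rfl | ⟨h3, h4⟩)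
    · exact Or.inl rfl
    · exact Or.inr ⟨h3, h4⟩
    · exact Or.inr ⟨h1, h2⟩
    · have h5 := q.lt_top _ h1
      rw [h4] at h1 h2
      refine Or.inr ⟨h1.1, h2.trans ?_⟩
      rw [inter_assoc, Iio_inter_Iio, inf_eq_right.2 h5.le]
  le_antisymm := by
    rintro p q (rfl | ⟨h1, -⟩) (h | ⟨h2, -⟩)
    · rfl
    · rfl
    · exact h.symm
    · exact ((q.lt_top _ h1).not_gt (p.lt_top _ h2)).elim

theorem lt_iff {p q : Node} : p < q ↔ p.top ∈ q.below ∧ p.below = q.below ∩ Iio p.top := by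
  rw [lt_iff_le_and_ne]
  refine ⟨fun ⟨h, hne⟩ => h.resolve_left hne, fun h => ⟨Or.inr h, ?_⟩⟩
  rintro rfl
  exact (p.lt_top _ h.1).false

theorem top_strictMono : StrictMono Node.top := fun _ q h => q.lt_top _ (lt_iff.1 h).1

theorem lt_of_top_lt {p p' q : Node} (h : p < q) (h' : p' < q) (ht : p.top < p'.top) : p < p' := by
  rw [lt_iff] at *
  rw [h'.2]
  refine ⟨⟨h.1, ht⟩, ?_⟩
  rw [inter_assoc, Iio_inter_Iio, inf_eq_right.2 ht.le]
  exact h.2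

theorem eq_of_top_eq {p p' q : Node} (h : p < q) (h' : p' < q) (ht : p.top = p'.top) : p = p' := by
  rw [lt_iff] at *
  ext1
  · exact ht
  · rw [h.2, h'.2, ht]

theorem lt_of_top_lt_of_le {p p' q : Node} (h : p ≤ q) (h' : p' ≤ q) (ht : p.top < p'.top) :
    p < p' := by
  rcases h.eq_or_lt with rfl | h
  · exact ((top_strictMono.monotone h').not_gt ht).elim
  rcases h'.eq_or_lt with rfl | h'
  · exact h
  · exact lt_of_top_lt h h' ht

theorem exists_lt_top_eq {p : Node} {y : ℚ ×ₗ ℕ} (h : y ∈ p.below) : ∃ q < p, q.top = y :=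
  ⟨⟨y, p.below ∩ Iio y, fun _ h => h.2⟩, lt_iff.2 ⟨h, rfl⟩, rfl⟩

/-- Adding a new greatest element. -/
def extend (p : Node) (x : ℚ ×ₗ ℕ) (h : p.top < x) : Node where
  top := x
  below := insert p.top p.below
  lt_top := by
    rintro y (rfl | hy)
    · exact h
    · exact (p.lt_top y hy).trans h

theorem lt_extend (p : Node) {x : ℚ ×ₗ ℕ} (h : p.top < x) : p < p.extend x h := by
  refine lt_iff.2 ⟨mem_insert _ _, ?_⟩
  show p.below = insert p.top p.below ∩ Iio p.top
  rw [insert_inter_of_notMem (by simp)]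
  exact (inter_eq_left.2 p.lt_top).symm

theorem le_of_lt_extend {p q : Node} {x : ℚ ×ₗ ℕ} {h : p.top < x} (hq : q < p.extend x h) :
    q ≤ p := by
  rcases (lt_iff.1 hq).1 with hq' | hq'
  · exact (eq_of_top_eq hq (p.lt_extend h) hq').le
  · exact (lt_of_top_lt hq (p.lt_extend h) (p.lt_top _ hq')).le

/-- The first coordinate of the greatest element. -/
def coarse (p : Node) : ℚ := (ofLex p.top).1

/-- The second coordinate of the greatest element. -/
def fine (p : Node) : ℕ := (ofLex p.top).2

theorem top_eq (p : Node) : p.top = toLex (p.coarse, p.fine) := rfl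

theorem coarse_mono {p q : Node} (h : p ≤ q) : p.coarse ≤ q.coarse := by
  have := top_strictMono.monotone h
  rw [top_eq, top_eq, Prod.Lex.toLex_le_toLex] at this
  rcases this with h | h
  · exact h.le
  · exact h.1.le

/-- The rational number with number `k` in an enumeration of `ℚ` with infinite repetitions, replaced
by `a + 1` if it is not larger than `a`. -/
noncomputable def jump (a : ℚ) (k : ℕ) : ℚ :=
  if a < (Denumerable.eqv ℚ).symm k.unpair.1 then (Denumerable.eqv ℚ).symm k.unpair.1 else a + 1

theorem lt_jump (a : ℚ) (k : ℕ) : a < jump a k := by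
  rw [jump]
  split_ifs with h
  · exact h
  · exact lt_add_one a

/-- Pairing the code of `q` with `k` gives an index at least `k` that decodes to `q`: each rational
recurs arbitrarily late in the enumeration. -/
theorem exists_jump_eq {a q : ℚ} (h : a < q) (k : ℕ) : ∃ n, jump a (k + n) = q := by
  obtain ⟨n, hn⟩ := Nat.exists_eq_add_of_le (Nat.right_le_pair (Denumerable.eqv ℚ q) k)
  refine ⟨n, ?_⟩
  rw [← hn, jump, Nat.unpair_pair]
  simp only [Equiv.symm_apply_apply]
  exact if_pos h

/-- The immediate successor of `p` with the same first coordinate. -/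
def step (p : Node) : Node :=
  p.extend (toLex (p.coarse, p.fine + 1))
    (Prod.Lex.toLex_lt_toLex.2 (Or.inr ⟨rfl, Nat.lt_succ_self _⟩))

/-- The immediate successor of `p` with a bigger first coordinate. -/
noncomputable def leap (p : Node) : Node :=
  p.extend (toLex (jump p.coarse p.fine, 0)) (Prod.Lex.toLex_lt_toLex.2 (Or.inl (lt_jump _ _)))

theorem step_ne_leap (p : Node) : p.step ≠ p.leap := fun h =>
  (lt_jump p.coarse p.fine).ne (congrArg coarse h)

/-- `p` is above all the levels `F β`, `β < α`, of a tree, it is a least upper bound in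
the first coordinate, and it lies above `A`. -/
structure IsLimitAbove (α : Ordinal.{0}) (F : ∀ β < α, Set Node) (A : Node) (q : ℚ) (p : Node) :
    Prop where
  top_eq : p.top = toLex (q, 0)
  above : A < p
  exists_lt : ∀ β, ∀ h : β < α, ∃ B ∈ F β h, B < p
  exists_mem : ∀ B < p, ∃ β, ∃ h : β < α, B ∈ F β h
  exists_gt : ∀ q' < q, ∃ B < p, q' < B.coarse

end Node

open Node

/-- The levels of the tree. -/
noncomputable def lev (α : Ordinal.{0}) : Set Node :=
  Ordinal.limitRecOn (motive := fun _ => Set Node) α {⟨toLex (0, 0), ∅, by simp⟩}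
    (fun _ S => ⋃ p ∈ S, {p.step, p.leap})
    (fun α _ F => ⋃ β, ⋃ h : β < α, ⋃ A ∈ F β h, ⋃ q : ℚ,
      {p | ∃ e : ∃ p', IsLimitAbove α F A q p', p = e.choose})

theorem lev_zero : lev 0 = {⟨toLex (0, 0), ∅, by simp⟩} := Ordinal.limitRecOn_zero ..

theorem lev_add_one (α : Ordinal.{0}) : lev (α + 1) = ⋃ p ∈ lev α, {p.step, p.leap} :=
  Ordinal.limitRecOn_add_one ..

theorem lev_limit {α : Ordinal.{0}} (h : Order.IsSuccLimit α) :
    lev α = ⋃ β, ⋃ _ : β < α, ⋃ A ∈ lev β, ⋃ q : ℚ,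
      {p | ∃ e : ∃ p', IsLimitAbove α (fun β _ => lev β) A q p', p = e.choose} :=
  Ordinal.limitRecOn_limit _ _ _ _ h

theorem mem_lev_add_one {α : Ordinal.{0}} {p : Node} :
    p ∈ lev (α + 1) ↔ ∃ p' ∈ lev α, p = p'.step ∨ p = p'.leap := by
  simp [lev_add_one]

theorem isLimitAbove_of_mem_lev {α : Ordinal.{0}} (h : Order.IsSuccLimit α) {p : Node}
    (hp : p ∈ lev α) : ∃ A q, IsLimitAbove α (fun β _ => lev β) A q p := by
  rw [lev_limit h] at hp
  simp only [mem_iUnion] at hp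
  obtain ⟨β, -, A, -, q, e, rfl⟩ := hp
  exact ⟨A, q, e.choose_spec⟩

/-- The level keeps one chosen node for `A` and `q`, possibly not `p`, but the specification already
fixes its rational coordinate and its position above `A`. -/
theorem exists_mem_lev_of_isLimitAbove {α β : Ordinal.{0}} (h : Order.IsSuccLimit α) (hβ : β < α)
    {A p : Node} {q : ℚ} (hA : A ∈ lev β) (hp : IsLimitAbove α (fun β _ => lev β) A q p) :
    ∃ p' ∈ lev α, A < p' ∧ p'.coarse = q := by
  have e : ∃ p', IsLimitAbove α (fun β _ => lev β) A q p' := ⟨p, hp⟩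
  refine ⟨e.choose, ?_, e.choose_spec.above, ?_⟩
  · rw [lev_limit h]
    simp only [mem_iUnion]
    exact ⟨β, hβ, A, hA, q, e, rfl⟩
  · rw [coarse, e.choose_spec.top_eq]
    rfl

theorem lt_step (p : Node) : p < p.step := p.lt_extend _

theorem lt_leap (p : Node) : p < p.leap := p.lt_extend _

theorem exists_lt_mem_lev {α : Ordinal.{0}} : ∀ {p}, p ∈ lev α → ∀ β < α, ∃ q ∈ lev β, q < p := by
  induction α using Ordinal.limitRecOn with
  | zero => exact fun _ β hβ => (not_lt_zero hβ).elim
  | add_one α ih =>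
    intro p hp β hβ
    obtain ⟨p', hp', h⟩ := mem_lev_add_one.1 hp
    have hlt : p' < p := by
      rcases h with rfl | rfl
      · exact lt_step p'
      · exact lt_leap p'
    rcases (Order.lt_add_one_iff.1 hβ).eq_or_lt with rfl | hβ
    · exact ⟨p', hp', hlt⟩
    · obtain ⟨q, hq, hqp⟩ := ih hp' β hβ
      exact ⟨q, hq, hqp.trans hlt⟩
  | limit α hα ih =>
    intro p hp β hβ
    obtain ⟨A, q, h⟩ := isLimitAbove_of_mem_lev hα hp
    exact h.exists_lt β hβ

theorem exists_mem_lev_of_lt {α : Ordinal.{0}} : ∀ {p}, p ∈ lev α →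
    ∀ q < p, ∃ β < α, q ∈ lev β := by
  induction α using Ordinal.limitRecOn with
  | zero =>
    intro p hp q hq
    rw [lev_zero, mem_singleton_iff] at hp
    subst hp
    exact (lt_iff.1 hq).1.elim
  | add_one α ih =>
    intro p hp q hq
    obtain ⟨p', hp', h⟩ := mem_lev_add_one.1 hp
    have hle : q ≤ p' := by
      rcases h with rfl | rfl
      · exact le_of_lt_extend hq
      · exact le_of_lt_extend hq
    rcases hle.eq_or_lt with rfl | hlt
    · exact ⟨α, lt_add_one α, hp'⟩
    · obtain ⟨β, hβ, h⟩ := ih hp' q hlt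
      exact ⟨β, hβ.trans (lt_add_one α), h⟩
  | limit α hα ih =>
    intro p hp q hq
    obtain ⟨A, r, h⟩ := isLimitAbove_of_mem_lev hα hp
    obtain ⟨β, hβ, h⟩ := h.exists_mem q hq
    exact ⟨β, hβ, h⟩

/-- At a limit level only one node is chosen for each lower node `A` and rational `q`; adding all
branches could destroy countability. -/
theorem countable_lev {α : Ordinal.{0}} : α < ω₁ → (lev α).Countable := by
  induction α using Ordinal.limitRecOn with
  | zero =>
    intro
    rw [lev_zero]
    exact countable_singleton _
  | add_one α ih =>
    intro h
    rw [lev_add_one]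
    exact (ih ((lt_add_one α).trans h)).biUnion fun p _ => by simp
  | limit α hα ih =>
    intro h
    rw [lev_limit hα]
    refine (countable_Iio_of_lt_omega_one h).biUnion fun β hβ =>
      (ih β hβ (hβ.trans h)).biUnion fun A _ => countable_iUnion fun q => ?_
    refine Set.Subsingleton.countable ?_
    rintro p ⟨_, rfl⟩ p' ⟨_, rfl⟩
    rfl

theorem exists_step_iterate {α : Ordinal.{0}} {p : Node} (hp : p ∈ lev α) (n : ℕ) :
    ∃ p' ∈ lev (α + n), p ≤ p' ∧ p'.coarse = p.coarse ∧ p'.fine = p.fine + n := by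
  induction n with
  | zero => exact ⟨p, by simpa using hp, le_rfl, rfl, rfl⟩
  | succ n ih =>
    obtain ⟨p', h1, h2, h3, h4⟩ := ih
    refine ⟨p'.step, ?_, h2.trans (lt_step p').le, h3, ?_⟩
    · rw [Nat.cast_succ, ← add_assoc]
      exact mem_lev_add_one.2 ⟨p', h1, Or.inl rfl⟩
    · rw [← add_assoc, ← h4]
      rfl

/-- Waiting by `step` increases `fine` without changing `coarse` until `jump` offers `q`; then
`leap` takes it. So every larger rational is reachable in finitely many levels although a node has
only two successors. -/
theorem exists_coarse_eq {α : Ordinal.{0}} {p : Node} (hp : p ∈ lev α) {q : ℚ} (hq : p.coarse < q) :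
    ∃ n : ℕ, ∃ p' ∈ lev (α + n), p < p' ∧ p'.coarse = q := by
  obtain ⟨n, hn⟩ := exists_jump_eq hq p.fine
  obtain ⟨p', h1, h2, h3, h4⟩ := exists_step_iterate hp n
  refine ⟨n + 1, p'.leap, ?_, h2.trans_lt (lt_leap p'), ?_⟩
  · rw [Nat.cast_succ, ← add_assoc]
    exact mem_lev_add_one.2 ⟨p', h1, Or.inr rfl⟩
  · rw [← hn, ← h3, ← h4]
    rfl

/-- A Rasiowa–Sikorski argument on the nodes of lower levels with `coarse < q`. There are countably
many requirements: to pass level `γ < α`, and to pass the rational `s < q`. Each is cofinal, by the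
induction hypothesis for levels and by `exists_coarse_eq` for rationals. An ideal meeting them all
is a branch through all lower levels with supremum `q`, and `(q, 0)` is put on top of it. -/
theorem exists_isLimitAbove {α : Ordinal.{0}} (hα : Order.IsSuccLimit α) (hα' : α < ω₁)
    (ih : ∀ γ < α, ∀ β < γ, ∀ A ∈ lev β, ∀ q, A.coarse < q → ∃ B ∈ lev γ, A < B ∧ B.coarse < q)
    {β : Ordinal.{0}} (hβ : β < α) {A : Node} (hA : A ∈ lev β) {q : ℚ} (hq : A.coarse < q) :
    ∃ p, IsLimitAbove α (fun β _ => lev β) A q p := by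
  let P := {B : Node // ∃ γ < α, B ∈ lev γ ∧ B.coarse < q}
  have : Countable (Iio α) := (countable_Iio_of_lt_omega_one hα').to_subtype
  let _ : Encodable (Iio α × Iio q) := Encodable.ofCountable _
  have hcof : ∀ i : Iio α × Iio q,
      IsCofinal {B : P | (∃ C ∈ lev i.1.1, C < B.1) ∧ i.2.1 < B.1.coarse} := by
    rintro ⟨⟨γ, hγ⟩, ⟨s, hs⟩⟩ ⟨B, δ, hδ, hB, hBq⟩
    -- The successor makes the new level strictly larger than both `γ` and `δ`, as needed to extend
    -- `B` and to find a predecessor at level `γ`.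
    have h1 : max γ δ + 1 < α := hα.add_one_lt (max_lt hγ hδ)
    obtain ⟨B₁, h2, h3, h4⟩ := ih _ h1 δ (Order.lt_add_one_iff.2 (le_max_right _ _)) B hB q hBq
    obtain ⟨m, h5, h6⟩ := exists_between (max_lt (show s < q from hs) h4)
    obtain ⟨n, B₂, h7, h8, h9⟩ := exists_coarse_eq h2 ((le_max_right _ _).trans_lt h5)
    obtain ⟨C, hC, hCB⟩ := exists_lt_mem_lev h2 γ (Order.lt_add_one_iff.2 (le_max_left _ _))
    refine ⟨⟨B₂, _, ?_, h7, h9.trans_lt h6⟩, ⟨⟨C, hC, hCB.trans h8⟩, ?_⟩, (h3.trans h8).le⟩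
    · exact hα.add_natCast_lt h1 n
    · show s < B₂.coarse
      rw [h9]
      exact (le_max_left _ _).trans_lt h5
  let I := Order.idealOfCofinals (⟨A, β, hβ, hA, hq⟩ : P) fun i => ⟨_, hcof i⟩
  have hAI : (⟨A, β, hβ, hA, hq⟩ : P) ∈ I := Order.mem_idealOfCofinals _ _
  have hmeet : ∀ γ < α, ∀ s < q, ∃ B ∈ I, (∃ C ∈ lev γ, C < B.1) ∧ s < B.1.coarse := by
    intro γ hγ s hs
    obtain ⟨B, hB, hBI⟩ := Order.cofinal_meets_idealOfCofinals (⟨A, β, hβ, hA, hq⟩ : P)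
      (fun i => ⟨_, hcof i⟩) (⟨γ, hγ⟩, ⟨s, hs⟩)
    exact ⟨B, hBI, hB⟩
  have hlower : ∀ B ∈ I, ∀ C < B.1, ∃ C' ∈ I, C'.1 = C := by
    rintro ⟨B, γ, hγ, hB, hBq⟩ hBI C hC
    obtain ⟨δ, hδ, hCδ⟩ := exists_mem_lev_of_lt hB C hC
    have hC' : (⟨C, δ, hδ.trans hγ, hCδ, (coarse_mono hC.le).trans_lt hBq⟩ : P) ≤
      ⟨B, γ, hγ, hB, hBq⟩ := hC.le
    exact ⟨_, I.lower hC' hBI, rfl⟩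
  let p : Node :=
    { top := toLex (q, 0)
      below := {y | ∃ B ∈ I, B.1.top = y}
      lt_top := by
        rintro y ⟨⟨B, γ, hγ, hB, hBq⟩, -, rfl⟩
        exact Prod.Lex.toLex_lt_toLex.2 (Or.inl hBq) }
  have hlt : ∀ B ∈ I, B.1 < p := by
    intro B hB
    -- The union end-extends `B`: the ideal is closed downwards, and directedness makes any two of
    -- its members comparable below a third.
    refine lt_iff.2 ⟨⟨B, hB, rfl⟩, Subset.antisymm ?_ ?_⟩
    · intro y hy
      obtain ⟨C, hC, rfl⟩ := Node.exists_lt_top_eq hy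
      obtain ⟨C', hC', rfl⟩ := hlower B hB C hC
      exact ⟨⟨C', hC', rfl⟩, top_strictMono hC⟩
    · rintro y ⟨⟨C, hC, rfl⟩, hy⟩
      obtain ⟨E, hE, hBE, hCE⟩ := I.directed B hB C hC
      exact (lt_iff.1 (lt_of_top_lt_of_le (q := E.1) hCE hBE hy)).1
  refine ⟨p, rfl, hlt _ hAI, fun γ hγ => ?_, fun B hB => ?_, fun s hs => ?_⟩
  · obtain ⟨B, hB, ⟨C, hC, hCB⟩, -⟩ := hmeet γ hγ _ hq
    exact ⟨C, hC, hCB.trans (hlt B hB)⟩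
  · obtain ⟨C, hC, hCB⟩ := (lt_iff.1 hB).1
    rw [← eq_of_top_eq (hlt C hC) hB hCB]
    obtain ⟨γ, hγ, h, -⟩ := C.2
    exact ⟨γ, hγ, h⟩
  · obtain ⟨B, hB, -, h⟩ := hmeet β hβ s hs
    exact ⟨B, hlt B hB, h⟩

/-- The bound by an arbitrary `q` is what carries the induction through limits: a branch can be
continued without using up the rationals below `q`. At a limit the new node has `coarse` equal to
the target, so the target is taken strictly below `q`. -/
theorem exists_gt_mem_lev {α : Ordinal.{0}} : α < ω₁ → ∀ β < α, ∀ A ∈ lev β, ∀ q, A.coarse < q →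
    ∃ B ∈ lev α, A < B ∧ B.coarse < q := by
  induction α using Ordinal.limitRecOn with
  | zero => exact fun _ β hβ => (not_lt_zero hβ).elim
  | add_one α ih =>
    intro hα β hβ A hA q hq
    rcases (Order.lt_add_one_iff.1 hβ).eq_or_lt with rfl | hβ
    · exact ⟨A.step, mem_lev_add_one.2 ⟨A, hA, Or.inl rfl⟩, lt_step A, hq⟩
    · obtain ⟨B, hB, hAB, hBq⟩ := ih ((lt_add_one α).trans hα) β hβ A hA q hq
      exact ⟨B.step, mem_lev_add_one.2 ⟨B, hB, Or.inl rfl⟩, hAB.trans (lt_step B), hBq⟩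
  | limit α hα ih =>
    intro hα' β hβ A hA q hq
    obtain ⟨q', h1, h2⟩ := exists_between hq
    obtain ⟨p, hp⟩ := exists_isLimitAbove hα hα' (fun γ hγ => ih γ hγ (hγ.trans hα')) hβ hA h1
    obtain ⟨B, hB, hAB, h⟩ := exists_mem_lev_of_isLimitAbove hα hβ hA hp
    exact ⟨B, hB, hAB, h.trans_lt h2⟩

/-- The tree formed by the levels below `ω₁`. -/
abbrev Tree : Type := {p : Node // ∃ α < ω₁, p ∈ lev α}

theorem Tree.acc {α : Ordinal.{0}} : ∀ p : Tree, p.1 ∈ lev α → Acc (· < ·) p := by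
  induction α using WellFoundedLT.induction with
  | ind α ih =>
    intro p hp
    refine ⟨_, fun q hq => ?_⟩
    obtain ⟨β, hβ, h⟩ := exists_mem_lev_of_lt hp q.1 hq
    exact ih β hβ q h

instance : IsSetTree Tree where
  wellOrdered_Iio x :=
    { wf := InvImage.wf (fun a : Iio x => a.1) ⟨fun p => Tree.acc p p.2.choose_spec.2⟩
      trichotomous := by
        intro a b h1 h2
        rcases lt_trichotomy a.1.1.top b.1.1.top with h | h | h
        · exact (h1 (lt_of_top_lt (show a.1.1 < x.1 from a.2) b.2 h)).elim
        · exact Subtype.ext (Subtype.ext (eq_of_top_eq (show a.1.1 < x.1 from a.2) b.2 h))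
        · exact (h2 (lt_of_top_lt (show b.1.1 < x.1 from b.2) a.2 h)).elim }

theorem Tree.exists_lt {x : Tree} {α : Ordinal.{0}} (hx : x.1 ∈ lev α)
    {β : Ordinal.{0}} (hβ : β < α) :
    ∃ z < x, z.1 ∈ lev β := by
  obtain ⟨q, hq, hqx⟩ := exists_lt_mem_lev hx β hβ
  obtain ⟨γ, hγ, hxγ⟩ := x.2
  obtain ⟨δ, hδ, h⟩ := exists_mem_lev_of_lt hxγ q hqx
  exact ⟨⟨q, δ, hδ.trans hγ, h⟩, hqx, hq⟩

theorem Tree.ht_eq {α : Ordinal.{0}} : ∀ {x : Tree}, x.1 ∈ lev α → ht x = α := by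
  induction α using WellFoundedLT.induction with
  | ind α ih =>
    intro x hx
    rcases lt_trichotomy (ht x) α with h | h | h
    · obtain ⟨z, hz, hz'⟩ := Tree.exists_lt hx h
      exact ((ht_strictMono hz).ne (ih _ h hz')).elim
    · exact h
    · obtain ⟨z, hz, hz'⟩ := exists_lt_ht_eq h
      obtain ⟨β, hβ, h'⟩ := exists_mem_lev_of_lt hx z.1 hz
      exact (hβ.ne ((ih β hβ h').symm.trans hz')).elim

theorem Tree.mem_lev (x : Tree) : x.1 ∈ lev (ht x) := by
  obtain ⟨α, -, h⟩ := x.2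
  rwa [Tree.ht_eq h]

theorem Tree.ht_lt (x : Tree) : ht x < ω₁ := by
  obtain ⟨α, hα, h⟩ := x.2
  rwa [Tree.ht_eq h]

theorem lev_nonempty {α : Ordinal.{0}} (hα : α < ω₁) : (lev α).Nonempty := by
  rcases eq_zero_or_pos α with rfl | h
  · rw [lev_zero]
    exact singleton_nonempty _
  · obtain ⟨A, hA⟩ : (lev 0).Nonempty := by
      rw [lev_zero]
      exact singleton_nonempty _
    obtain ⟨B, hB, -⟩ := exists_gt_mem_lev hα 0 h A hA _ (lt_add_one _)
    exact ⟨B, hB⟩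

theorem Tree.isOmegaOneTree : IsOmegaOneTree Tree := by
  constructor
  · refine le_antisymm (csInf_le' ?_) (le_csInf ⟨ω₁, ?_⟩ fun α hα => ?_)
    · exact eq_empty_of_forall_notMem fun x hx => (Tree.ht_lt x).ne hx
    · exact eq_empty_of_forall_notMem fun x hx => (Tree.ht_lt x).ne hx
    · by_contra! hlt
      obtain ⟨p, hp⟩ := lev_nonempty hlt
      have hα : level Tree α = ∅ := hα
      have : (⟨p, α, hlt, hp⟩ : Tree) ∈ level Tree α := Tree.ht_eq hp
      rw [hα] at this
      exact this
  · intro α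
    rcases lt_or_ge α ω₁ with h | h
    · refine ((countable_lev h).preimage Subtype.val_injective).mono fun x hx => ?_
      have hx : ht x = α := hx
      exact hx ▸ Tree.mem_lev x
    · convert countable_empty
      exact eq_empty_of_forall_notMem fun x hx => ((Tree.ht_lt x).trans_le h).ne hx

theorem Tree.isRooted : IsRooted Tree := by
  obtain ⟨p, hp⟩ := lev_nonempty (Ordinal.omega_pos 1)
  refine ⟨⟨p, 0, Ordinal.omega_pos 1, hp⟩, ?_, fun x hx => ?_⟩
  · refine isMin_iff_forall_not_lt.2 fun z hz => ?_
    obtain ⟨β, hβ, -⟩ := exists_mem_lev_of_lt hp z.1 hz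
    exact not_lt_zero hβ
  · rcases eq_zero_or_pos (ht x) with h | h
    · have hx := Tree.mem_lev x
      rw [h, lev_zero] at hx
      rw [lev_zero] at hp
      exact Subtype.ext (hx.trans hp.symm)
    · obtain ⟨z, hz, -⟩ := exists_lt_ht_eq h
      exact (hx.not_lt hz).elim

theorem Tree.covBy_iff {x y : Tree} : x ⋖ y ↔ y.1 = x.1.step ∨ y.1 = x.1.leap := by
  have hmem : ∀ p, p = x.1.step ∨ p = x.1.leap → p ∈ lev (ht x + 1) := fun p hp =>
    mem_lev_add_one.2 ⟨x.1, Tree.mem_lev x, hp⟩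
  constructor
  · intro h
    have hy : y.1 ∈ lev (ht x + 1) := by
      have := (ht_covBy h).antisymm (Order.add_one_le_of_lt (ht_strictMono h.lt))
      exact this ▸ Tree.mem_lev y
    obtain ⟨p, hp, hpy⟩ := mem_lev_add_one.1 hy
    have hlt : p < y.1 := by
      rcases hpy with h | h <;> rw [h]
      · exact lt_step p
      · exact lt_leap p
    let p' : Tree := ⟨p, ht x, Tree.ht_lt x, hp⟩
    have hp'y : p' < y := hlt
    rcases lt_trichotomy_of_lt h.lt hp'y with h' | h' | h'
    · exact (h.2 h' hp'y).elim
    · rw [h']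
      exact hpy
    · exact ((ht_strictMono h').ne (Tree.ht_eq hp)).elim
  · intro h
    refine ⟨?_, fun z hxz hzy => ?_⟩
    · show x.1 < y.1
      rcases h with h | h <;> rw [h]
      · exact lt_step x.1
      · exact lt_leap x.1
    · have h1 := ht_strictMono hzy
      rw [Tree.ht_eq (hmem _ h), Order.lt_add_one_iff] at h1
      exact h1.not_gt (ht_strictMono hxz)

theorem Tree.isBinary : IsBinary Tree := by
  intro x
  have hα : ht x + 1 < ω₁ := isSuccLimit_omega_one.add_one_lt (Tree.ht_lt x)
  have hmem : ∀ p, p = x.1.step ∨ p = x.1.leap → p ∈ lev (ht x + 1) := fun p hp =>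
    mem_lev_add_one.2 ⟨x.1, Tree.mem_lev x, hp⟩
  let y : Tree := ⟨x.1.step, _, hα, hmem _ (Or.inl rfl)⟩
  let y' : Tree := ⟨x.1.leap, _, hα, hmem _ (Or.inr rfl)⟩
  have : {z : Tree | x ⋖ z} = {y, y'} := by
    ext z
    refine Tree.covBy_iff.trans ?_
    simp [y, y', Subtype.ext_iff]
  rw [this, ncard_pair fun h => step_ne_leap x.1 (congrArg Subtype.val h)]

/-- A limit node is determined by its predecessors: its `coarse` is the supremum of theirs, by
`exists_gt`, and its `fine` is `0`. -/
theorem Tree.isHausdorff : IsHausdorff Tree := by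
  intro x y hx hy hxy
  obtain ⟨A, q, h⟩ := isLimitAbove_of_mem_lev hx (Tree.mem_lev x)
  obtain ⟨A', q', h'⟩ := isLimitAbove_of_mem_lev hy (Tree.mem_lev y)
  have hlt : ∀ p : Node, p < x.1 ↔ p < y.1 := by
    have key : ∀ a b : Tree, Iio a ⊆ Iio b → ∀ p : Node, p < a.1 → p < b.1 := by
      intro a b hab p hp
      obtain ⟨γ, hγ, ha⟩ := a.2
      obtain ⟨δ, hδ, hpδ⟩ := exists_mem_lev_of_lt ha p hp
      exact hab (show (⟨p, δ, hδ.trans hγ, hpδ⟩ : Tree) ∈ Iio a from hp)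
    exact fun p => ⟨key x y hxy.subset p, key y x hxy.symm.subset p⟩
  have hbelow : ∀ a b : Node, (∀ p, p < a → p < b) → a.below ⊆ b.below := by
    intro a b hab z hz
    obtain ⟨p, hp, rfl⟩ := Node.exists_lt_top_eq hz
    exact (lt_iff.1 (hab p hp)).1
  have hle : ∀ {α β : Ordinal.{0}} {A B a b : Node} {s t : ℚ},
      IsLimitAbove α (fun β _ => lev β) A s a → IsLimitAbove β (fun β _ => lev β) B t b →
      (∀ p, p < b → p < a) → t ≤ s := by
    intro α β A B a b s t ha hb hab
    by_contra! hst
    obtain ⟨p, hp, hsp⟩ := hb.exists_gt s hst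
    have h1 := coarse_mono (hab p hp).le
    rw [coarse, coarse, ha.top_eq] at h1
    exact h1.not_gt hsp
  have hq : q = q' := le_antisymm (hle h' h fun p => (hlt p).1) (hle h h' fun p => (hlt p).2)
  refine Subtype.ext (Node.ext ?_ (Subset.antisymm ?_ ?_))
  · rw [h.top_eq, h'.top_eq, hq]
  · exact hbelow _ _ fun p => (hlt p).1
  · exact hbelow _ _ fun p => (hlt p).2

/-- `top` is strictly increasing into a countable linear order, which embeds in `ℝ`. -/
theorem Tree.isRealSpecial : IsRealSpecial Tree := by
  have : Countable (ℚ ×ₗ ℕ) := inferInstanceAs (Countable (ℚ × ℕ))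
  obtain ⟨e⟩ := Order.embedding_from_countable_to_dense (ℚ ×ₗ ℕ) ℝ
  exact ⟨fun x => e x.1.top, fun x y h => e.strictMono (top_strictMono h)⟩

theorem exists_tree : ∃ (T : Type) (_ : PartialOrder T) (_ : IsSetTree T),
    IsOmegaOneTree T ∧ IsRooted T ∧ IsBinary T ∧ IsHausdorff T ∧ IsRealSpecial T :=
  ⟨Tree, inferInstance, inferInstance, Tree.isOmegaOneTree, Tree.isRooted, Tree.isBinary,
    Tree.isHausdorff, Tree.isRealSpecial⟩

end CombTree

/-! ### Conclusion -/

theorem Fattening.isSurface {T : Type u} [PartialOrder T] [IsSetTree T] (r : T → T → Prop)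
    [IsStrictTotalOrder T r] [ConnectedSpace (Fattening T r)] (hG : Nonempty (TreeHeight T))
    (hB : IsBinary T) (hR : IsRooted T) (hH : IsHausdorff T) : IsSurface (Fattening T r) := by
  refine ⟨inferInstance, t2Space hG hB hR hH, fun m => ?_⟩
  obtain ⟨y, -, hy⟩ := exists_mem_column hB m
  obtain ⟨G⟩ := hG
  exact exists_isOpen_homeomorph_of_isOpenEmbedding (isOpen_column ⟨G⟩ hB y)
    (isOpenEmbedding_chart G hB hR y) ⟨m, hy⟩

theorem theorem1p2 :
    (∃ (T : Type) (_ : PartialOrder T) (_ : IsSetTree T),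
      IsSetTree.IsOmegaOneTree T ∧ IsSetTree.IsRooted T ∧ IsSetTree.IsBinary T ∧
        IsSetTree.IsHausdorff T ∧ IsSetTree.IsRealSpecial T) ∧
    ∀ (T : Type u) [PartialOrder T] [IsSetTree T],
      IsSetTree.IsOmegaOneTree T → IsSetTree.IsRooted T → IsSetTree.IsBinary T →
      IsSetTree.IsHausdorff T → IsSetTree.IsRealSpecial T →
      ∀ (r : T → T → Prop) [IsStrictTotalOrder T r],
        IsSurface (Fattening T r) ∧ IsTypeI (Fattening T r) ∧
        ¬ TopologicalSpace.MetrizableSpace (Fattening T r) ∧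
        ContractibleSpace (Fattening T r) ∧
        ContractibleSpace (RoadSpace T) ∧
        IsEmbedding (Fattening.inclusion r) ∧
        ∃ e : RoadSpace T ≃ₕ Fattening T r, ⇑e = Fattening.inclusion r := by
  refine ⟨CombTree.exists_tree, fun T _ _ hT hR hB hH hf r _ => ?_⟩
  have hG := TreeHeight.exists_of_isRealSpecial hB hf
  have hC : ContractibleSpace (Fattening T r) := Fattening.contractibleSpace hB hR hG
  exact ⟨Fattening.isSurface r hG hB hR hH, Fattening.isTypeI hT hG hB hR,
    Fattening.not_metrizableSpace hT hG hB hR, hC, Fattening.contractibleSpace_roadSpace r hB hR hG,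
    Fattening.isEmbedding_inclusion hB hR hG, Fattening.exists_homotopyEquiv hB hR hG⟩
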